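/- Let $p$ be a prime and let $R\neq 0$ be a commutative ring in which $p$ is invertible. For finite groups $G,H$, let $B(G,H)$ be the Grothendieck group of finite $(G,H)$-bisets (for disjoint union), $RB(G,H)=R\otimes_{\mathbb Z}B(G,H)$, and let $\times_H: RB(G,H)\times RB(H,K)\to RB(G,K)$, written as a product $ab$, be induced by $(U,V)\mapsto U\times_HV=(U\times V)/H$. Let $R\mathcal C_p$ be the category whose objects are the finite $p$-groups, with $\mathrm{Hom}(P,Q)=RB(Q,P)$, composition given by this product, and identities the bisets $P$; its center is the ring of endomorphisms of its identity functor. For a finite group $G$ of order invertible in $R$, let $\mu$ be the Möbius function of the poset of subgroups of $G$, $\mu_{\trianglelefteq G}$ that of the poset of normal subgroups, $\Phi(G)$ the Frattini subgroup, $e_G^G=\frac1{|G|}\sum_{K\le G}|K|\mu(K,G)[G/K]\in RB(G)$, and $\widetilde{e_G^G}\in RB(G,G)$ its image under the linear map sending a $G$-set $X$ to the biset $G\times X$ with $a(g,x)b=(agb,ax)$. For $N\trianglelefteq G$ put $\Delta_N(G)=\{(a,b)\in G\times G: ab^{-1}\in N\}$, and set $$\varphi_{\mathbf 1}^G=\sum_{N\trianglelefteq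 G,\ N\le\Phi(G)}\mu_{\trianglelefteq G}(\mathbf 1,N)\,\widetilde{e_G^G}\,[(G\times G)/\Delta_N(G)]\,\widetilde{e_G^G}.$$ A section of $G$ is a pair $(T,S)$ of subgroups with $S\trianglelefteq T$; it is minimal if $S\le\Phi(T)$. Write $H\sqsubseteq G$ if $H\cong T/S$ for some section $(T,S)$ of $G$. For a minimal section $(T,S)$ put $$\epsilon_{T,S}^G=\frac1{|N_G(T,S):T|}\,[G/S]\,\varphi_{\mathbf 1}^{T/S}\,\varphi_{\mathbf 1}^{T/S}\,[S\backslash G]\in RB(G,G),$$ where $N_G(T,S)=N_G(T)\cap N_G(S)$, and $G/S$, $S\backslash G$ are viewed as a $(G,T/S)$-biset and a $(T/S,G)$-biset. Let $[\mathcal M(G)]$ be a set of representatives of the $G$-conjugacy classes of minimal sections of $G$. A finite $p$-group is atoric if it has no decomposition $E\times Q$ with $E$ a non-trivial elementary abelian $p$-group; let $[\mathcal At_p]$ be a set of representatives of isomorphism classes of atoric $p$-groups. For a finite $p$-group $P$, let $P^@=P/N$, where $N$ is a maximal element among the normal subgroups of $P$ with $N\cap\Phi(P)=\mathbf 1$.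 For $L$ atoric and $P$ a finite $p$-group, set $$b_L^P=\sum_{(T,S)\in[\mathcal M(P)],\ (T/S)^@\cong L}\epsilon_{T,S}^P\in RB(P,P).$$ Then: 1. If $L$ is an atoric $p$-group and $P$ a finite $p$-group, then $b_L^P\neq0$ if and only if $L\sqsubseteq P^@$. 2. If $L,M$ are atoric $p$-groups, $P,Q$ are finite $p$-groups, and $b_M^Q\,RB(Q,P)\,b_L^P\neq\{0\}$, then $M\cong L$. 3. If $L$ is an atoric $p$-group and $P,Q$ are finite $p$-groups, then $b_L^Q\,a=a\,b_L^P$ for all $a\in RB(Q,P)$. 4. For each atoric $L$, the family $(b_L^P)_P$ is an idempotent $b_L$ of the center of $R\mathcal C_p$. The idempotents $b_L$, $L\in[\mathcal At_p]$, are orthogonal, and their sum is the identity of the center: for each $P$ only finitely many $b_L^P$ with $L\in[\mathcal At_p]$ are non-zero, and their sum is the identity of $P$. 5. For each finite $p$-group $P$, there are finitely many $L\in[\mathcal At_p]$ with $L\sqsubseteq P^@$, the corresponding elements $b_L^P$ are non-zero orthogonal central idempotents of $RB(P,P)$, and their sum is the identity of $RB(P,P)$. -/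

import Mathlib

open CategoryTheory MulOpposite TensorProduct

universe u v

noncomputable section

/-! ### Finite sets with a group action, and Burnside groups -/

/-- A finite set with a left action of the group `Γ`. -/
structure FinGSet (Γ : Type u) [Group Γ] : Type (u + 1) where
  carrier : Type u
  [finite : Finite carrier]
  [act : MulAction Γ carrier]

namespace FinGSet

variable {Γ : Type u} [Group Γ]

instance : CoeSort (FinGSet Γ) (Type u) := ⟨FinGSet.carrier⟩
instance (X : FinGSet Γ) : Finite X := X.finite
instance (X : FinGSet Γ) : MulAction Γ X := X.act

/-- Two `Γ`-sets are isomorphic if there is an equivariant bijection between them. -/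
def Iso (X Y : FinGSet Γ) : Prop := ∃ e : X ≃ Y, ∀ (g : Γ) (x : X), e (g • x) = g • e x

theorem Iso.refl (X : FinGSet Γ) : Iso X X := ⟨Equiv.refl _, fun _ _ => rfl⟩

theorem Iso.symm {X Y : FinGSet Γ} : Iso X Y → Iso Y X := by
  rintro ⟨e, he⟩
  exact ⟨e.symm, fun g y => by rw [Equiv.symm_apply_eq, he, Equiv.apply_symm_apply]⟩

theorem Iso.trans {X Y Z : FinGSet Γ} : Iso X Y → Iso Y Z → Iso X Z := by
  rintro ⟨e, he⟩ ⟨f, hf⟩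
  exact ⟨e.trans f, fun g x => by simp [he, hf]⟩

instance isoSetoid (Γ : Type u) [Group Γ] : Setoid (FinGSet Γ) where
  r := Iso
  iseqv := ⟨Iso.refl, Iso.symm, Iso.trans⟩

/-- Two sets that are quotients of one set by the same relation, compatibly with the actions,
are isomorphic. -/
theorem Iso.of_surjective {A B : FinGSet Γ} {X : Type u} (f : X → A) (g : X → B)
    (hf : Function.Surjective f) (hg : Function.Surjective g)
    (h : ∀ x y, f x = f y ↔ g x = g y) (t : Γ → X → X)
    (hft : ∀ c x, f (t c x) = c • f x) (hgt : ∀ c x, g (t c x) = c • g x) : Iso A B := by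
  have key : ∀ x, g (Function.surjInv hf (f x)) = g x := fun x =>
    (h _ _).1 (Function.surjInv_eq hf (f x))
  refine ⟨Equiv.ofBijective (fun a => g (Function.surjInv hf a)) ⟨?_, ?_⟩, ?_⟩
  · intro a b hab
    have := (h _ _).2 hab
    rwa [Function.surjInv_eq hf, Function.surjInv_eq hf] at this
  · intro b
    obtain ⟨x, rfl⟩ := hg b
    exact ⟨f x, key x⟩
  · intro c a
    obtain ⟨x, rfl⟩ := hf a
    change g (Function.surjInv hf (c • f x)) = c • g (Function.surjInv hf (f x))
    rw [← hft, key, key, hgt]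

/-- The empty `Γ`-set. -/
def empty (Γ : Type u) [Group Γ] : FinGSet Γ where
  carrier := PEmpty
  act :=
    { smul := fun _ x => x
      one_smul := fun _ => rfl
      mul_smul := fun _ _ _ => rfl }

/-- The disjoint union of two `Γ`-sets. -/
def sum (X Y : FinGSet Γ) : FinGSet Γ where
  carrier := X ⊕ Y

/-- The inclusion of the first summand. -/
def inl (X Y : FinGSet Γ) (x : X) : X.sum Y := Sum.inl x

/-- The inclusion of the second summand. -/
def inr (X Y : FinGSet Γ) (y : Y) : X.sum Y := Sum.inr y

theorem inl_inj {X Y : FinGSet Γ} {x x' : X} : inl X Y x = inl X Y x' ↔ x = x' :=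
  Sum.inl_injective.eq_iff

theorem inr_inj {X Y : FinGSet Γ} {y y' : Y} : inr X Y y = inr X Y y' ↔ y = y' :=
  Sum.inr_injective.eq_iff

theorem inl_ne_inr {X Y : FinGSet Γ} {x : X} {y : Y} : inl X Y x ≠ inr X Y y := Sum.inl_ne_inr

theorem inr_ne_inl {X Y : FinGSet Γ} {x : X} {y : Y} : inr X Y y ≠ inl X Y x := Sum.inr_ne_inl

theorem smul_inl {X Y : FinGSet Γ} (g : Γ) (x : X) : g • inl X Y x = inl X Y (g • x) := rfl

theorem smul_inr {X Y : FinGSet Γ} (g : Γ) (y : Y) : g • inr X Y y = inr X Y (g • y) := rfl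

/-- The `Γ`-set `Γ / K` of left cosets of the subgroup `K`. -/
def coset [Finite Γ] (K : Subgroup Γ) : FinGSet Γ where
  carrier := Γ ⧸ K

/-- Isomorphism classes of finite `Γ`-sets. -/
def Class (Γ : Type u) [Group Γ] : Type (u + 1) := Quotient (isoSetoid Γ)

instance : Zero (Class Γ) := ⟨Quotient.mk _ (empty Γ)⟩

instance : Add (Class Γ) :=
  ⟨Quotient.map₂ sum (by
    rintro X X' ⟨e, he⟩ Y Y' ⟨f, hf⟩
    refine ⟨Equiv.sumCongr e f, ?_⟩
    rintro g (x | y)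
    · exact congrArg Sum.inl (he g x)
    · exact congrArg Sum.inr (hf g y))⟩

theorem Class.zero_add' (a : Class Γ) : 0 + a = a := by
  obtain ⟨X⟩ := a
  refine Quotient.sound ⟨Equiv.emptySum PEmpty X, ?_⟩
  rintro g (x | x)
  · exact x.elim
  · rfl

theorem Class.add_comm' (a b : Class Γ) : a + b = b + a := by
  obtain ⟨X⟩ := a
  obtain ⟨Y⟩ := b
  refine Quotient.sound ⟨Equiv.sumComm X Y, ?_⟩
  rintro g (x | y) <;> rfl

/-- Isomorphism classes of finite `Γ`-sets form a commutative monoid under disjoint union. -/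
instance : AddCommMonoid (Class Γ) where
  add_assoc := by
    rintro ⟨X⟩ ⟨Y⟩ ⟨Z⟩
    refine Quotient.sound ⟨Equiv.sumAssoc X Y Z, ?_⟩
    rintro g ((x | y) | z) <;> rfl
  zero_add := Class.zero_add'
  add_zero := fun a => (Class.add_comm' a 0).trans (Class.zero_add' a)
  add_comm := Class.add_comm'
  nsmul := nsmulRec

/-- The isomorphism class of a finite `Γ`-set. -/
def toClass (X : FinGSet Γ) : Class Γ := Quotient.mk (isoSetoid Γ) X

theorem toClass_add (X Y : FinGSet Γ) : X.toClass + Y.toClass = (X.sum Y).toClass := rfl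

theorem toClass_eq {X Y : FinGSet Γ} (h : Iso X Y) : X.toClass = Y.toClass := Quotient.sound h

theorem Class.ind {motive : Class Γ → Prop} (h : ∀ X : FinGSet Γ, motive X.toClass)
    (x : Class Γ) : motive x := Quotient.ind h x

end FinGSet

/-- The Burnside group `B(Γ)`: the Grothendieck group of finite `Γ`-sets. -/
abbrev Burnside (Γ : Type u) [Group Γ] : Type (u + 1) :=
  Algebra.GrothendieckAddGroup (FinGSet.Class Γ)

/-- The Burnside group `R B(Γ) = R ⊗ B(Γ)` with coefficients in `R`. -/
abbrev RBurnside (R : Type v) [CommRing R] (Γ : Type u) [Group Γ] : Type (max v (u + 1)) :=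
  R ⊗[ℤ] Burnside Γ

/-- The element `[X]` of `R B(Γ)` defined by a finite `Γ`-set `X`. -/
def RBurnside.mk (R : Type v) [CommRing R] {Γ : Type u} [Group Γ] (X : FinGSet Γ) :
    RBurnside R Γ :=
  (1 : R) ⊗ₜ[ℤ] Algebra.GrothendieckAddGroup.of X.toClass

/-! ### Bilinear extension -/

theorem grothLift_of {M G : Type*} [AddCommMonoid M] [AddCommGroup G] (f : M →+ G) (m : M) :
    Algebra.GrothendieckAddGroup.lift f (Algebra.GrothendieckAddGroup.of m) = f m :=
  DFunLike.congr_fun (Algebra.GrothendieckAddGroup.lift.symm_apply_apply f) m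

theorem groth_hom_ext {M G : Type*} [AddCommMonoid M] [AddCommGroup G]
    {f g : Algebra.GrothendieckAddGroup M →+ G}
    (h : ∀ m, f (Algebra.GrothendieckAddGroup.of m) = g (Algebra.GrothendieckAddGroup.of m)) :
    f = g :=
  Algebra.GrothendieckAddGroup.lift.symm.injective (AddMonoidHom.ext h)

/-- The additive extension of `f : M →+ N` to Grothendieck groups. -/
def grothMap {M N : Type*} [AddCommMonoid M] [AddCommMonoid N] (f : M →+ N) :
    Algebra.GrothendieckAddGroup M →+ Algebra.GrothendieckAddGroup N :=
  Algebra.GrothendieckAddGroup.lift (Algebra.GrothendieckAddGroup.of.comp f)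

theorem grothMap_of {M N : Type*} [AddCommMonoid M] [AddCommMonoid N] (f : M →+ N) (m : M) :
    grothMap f (Algebra.GrothendieckAddGroup.of m) = Algebra.GrothendieckAddGroup.of (f m) :=
  grothLift_of _ _

/-- The biadditive extension of `f : M →+ N →+ P` to Grothendieck groups. -/
def grothMap₂ {M N P : Type*} [AddCommMonoid M] [AddCommMonoid N] [AddCommMonoid P]
    (f : M →+ N →+ P) :
    Algebra.GrothendieckAddGroup M →+ Algebra.GrothendieckAddGroup N →+
      Algebra.GrothendieckAddGroup P :=
  Algebra.GrothendieckAddGroup.lift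
    { toFun := fun m => grothMap (f m)
      map_zero' := groth_hom_ext fun n => by
        rw [grothMap_of, map_zero, AddMonoidHom.zero_apply, map_zero, AddMonoidHom.zero_apply]
      map_add' := fun a b => groth_hom_ext fun n => by
        rw [AddMonoidHom.add_apply, grothMap_of, grothMap_of, grothMap_of, map_add,
          AddMonoidHom.add_apply, map_add] }

theorem grothMap₂_of {M N P : Type*} [AddCommMonoid M] [AddCommMonoid N] [AddCommMonoid P]
    (f : M →+ N →+ P) (m : M) (n : N) :
    grothMap₂ f (Algebra.GrothendieckAddGroup.of m) (Algebra.GrothendieckAddGroup.of n) =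
      Algebra.GrothendieckAddGroup.of (f m n) := by
  unfold grothMap₂
  rw [grothLift_of]
  exact grothMap_of _ _

/-- The `R`-bilinear extension of a biadditive map. -/
def baseChange₂ (R : Type v) [CommRing R] {A B C : Type*} [AddCommGroup A] [AddCommGroup B]
    [AddCommGroup C] (f : A →+ B →+ C) :
    R ⊗[ℤ] A →ₗ[R] R ⊗[ℤ] B →ₗ[R] R ⊗[ℤ] C :=
  LinearMap.liftBaseChange R
    (AddMonoidHom.toIntLinearMap
      { toFun := fun a => LinearMap.baseChange R (f a).toIntLinearMap
        map_zero' := by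
          ext b
          simp
        map_add' := fun a a' => by
          ext b
          simp [TensorProduct.tmul_add] })

theorem baseChange₂_tmul (R : Type v) [CommRing R] {A B C : Type*} [AddCommGroup A]
    [AddCommGroup B] [AddCommGroup C] (f : A →+ B →+ C) (r s : R) (a : A) (b : B) :
    baseChange₂ R f (r ⊗ₜ a) (s ⊗ₜ b) = (r * s) ⊗ₜ f a b := by
  simp [baseChange₂, TensorProduct.smul_tmul']

theorem RBurnside.span_mk (R : Type v) [CommRing R] (Γ : Type u) [Group Γ] :
    Submodule.span R (Set.range (RBurnside.mk R (Γ := Γ))) = ⊤ := by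
  rw [eq_top_iff]
  rintro x -
  induction x using TensorProduct.induction_on with
  | zero => exact zero_mem _
  | add x y hx hy => exact add_mem hx hy
  | tmul r a =>
    have h : (r ⊗ₜ[ℤ] a : RBurnside R Γ) = r • ((1 : R) ⊗ₜ[ℤ] a) := by
      rw [TensorProduct.smul_tmul', smul_eq_mul, mul_one]
    rw [h]
    refine Submodule.smul_mem _ _ ?_
    induction a using AddLocalization.ind with
    | H y =>
      obtain ⟨m, s⟩ := y
      have h2 : (AddLocalization.mk m s : Burnside Γ) =
          Algebra.GrothendieckAddGroup.of m - Algebra.GrothendieckAddGroup.of s.1 := by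
        rw [AddLocalization.mk_eq_addMonoidOf_mk', eq_sub_iff_add_eq]
        exact AddSubmonoid.LocalizationMap.mk'_spec _ _ _
      rw [h2, TensorProduct.tmul_sub]
      obtain ⟨X⟩ := m
      obtain ⟨⟨Y⟩, hY⟩ := s
      exact sub_mem (Submodule.subset_span ⟨X, rfl⟩) (Submodule.subset_span ⟨Y, rfl⟩)

/-- Linear maps out of `R B(Γ)` that agree on the classes of finite `Γ`-sets are equal. -/
theorem RBurnside.hom_ext {R : Type v} [CommRing R] {Γ : Type u} [Group Γ] {M : Type*}
    [AddCommMonoid M] [Module R M] {f g : RBurnside R Γ →ₗ[R] M}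
    (h : ∀ X, f (RBurnside.mk R X) = g (RBurnside.mk R X)) : f = g :=
  LinearMap.ext_on (RBurnside.span_mk R Γ) (by rintro _ ⟨X, rfl⟩; exact h X)

theorem RBurnside.mk_eq {R : Type v} [CommRing R] {Γ : Type u} [Group Γ] {X Y : FinGSet Γ}
    (h : X.Iso Y) : RBurnside.mk R X = RBurnside.mk R Y := by
  unfold RBurnside.mk
  rw [FinGSet.toClass_eq h]

/-! ### Bisets -/

/-- A finite `(G, H)`-biset is a finite set with an action of `G × Hᵐᵒᵖ`: the left action of `g` is
`(g, 1) • u` and the right action of `h` is `(1, op h) • u`. -/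
abbrev Biset (G H : Type u) [Group G] [Group H] : Type (u + 1) := FinGSet (G × Hᵐᵒᵖ)

namespace Biset

variable {G H K K' : Type u} [Group G] [Group H] [Group K] [Group K']

/-- The right action of `H` on `U × V` given by `(u, v) · h = (u h, h⁻¹ v)`; its orbits. -/
def compSetoid (U : Biset G H) (V : Biset H K) : Setoid (U × V) where
  r x y := ∃ h : H, y = (((1 : G), op h) • x.1, (h⁻¹, (1 : Kᵐᵒᵖ)) • x.2)
  iseqv := by
    refine ⟨fun x => ⟨1, ?_⟩, ?_, ?_⟩
    · ext <;> simp [← Prod.one_eq_mk]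
    · rintro x _ ⟨h, rfl⟩
      refine ⟨h⁻¹, ?_⟩
      ext <;> simp [smul_smul, ← Prod.one_eq_mk]
    · rintro x _ _ ⟨h, rfl⟩ ⟨k, rfl⟩
      refine ⟨h * k, ?_⟩
      ext <;> simp [smul_smul]

/-- The product `U ×_H V = (U × V) / H` of bisets. -/
def comp (U : Biset G H) (V : Biset H K) : Biset G K where
  carrier := Quotient (compSetoid U V)
  act :=
    { smul := fun c => Quotient.map (fun x => ((c.1, (1 : Hᵐᵒᵖ)) • x.1, ((1 : H), c.2) • x.2)) (by
        rintro x _ ⟨h, rfl⟩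
        refine ⟨h, ?_⟩
        ext <;> simp [smul_smul])
      one_smul := by
        rintro ⟨x⟩
        refine congrArg (Quotient.mk _) ?_
        ext <;> simp [← Prod.one_eq_mk]
      mul_smul := by
        rintro c d ⟨x⟩
        refine congrArg (Quotient.mk _) ?_
        ext <;> simp [smul_smul] }

/-- The class of `(u, v)` in `U ×_H V`. -/
def pair {U : Biset G H} {V : Biset H K} (u : U) (v : V) : comp U V :=
  Quotient.mk (compSetoid U V) (u, v)

theorem pair_surjective {U : Biset G H} {V : Biset H K} (z : comp U V) :
    ∃ (u : U) (v : V), pair u v = z := by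
  obtain ⟨⟨u, v⟩⟩ := z
  exact ⟨u, v, rfl⟩

theorem pair_eq_pair {U : Biset G H} {V : Biset H K} {u u' : U} {v v' : V} :
    pair u v = pair u' v' ↔
      ∃ h : H, u' = ((1 : G), op h) • u ∧ v' = (h⁻¹, (1 : Kᵐᵒᵖ)) • v := by
  unfold pair
  refine Quotient.eq.trans (exists_congr fun h => Prod.ext_iff)

theorem smul_pair {U : Biset G H} {V : Biset H K} (c : G × Kᵐᵒᵖ) (u : U) (v : V) :
    c • pair u v = pair ((c.1, (1 : Hᵐᵒᵖ)) • u) (((1 : H), c.2) • v) := rfl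

/-- The group `G` as a `(G, G)`-biset under left and right multiplication. -/
def id (G : Type u) [Group G] [Finite G] : Biset G G where
  carrier := G
  act :=
    { smul := fun c x => c.1 * x * c.2.unop
      one_smul := fun x => by
        change 1 * x * 1 = x
        simp
      mul_smul := fun c d x => by
        change c.1 * d.1 * x * (d.2.unop * c.2.unop) = c.1 * (d.1 * x * d.2.unop) * c.2.unop
        simp [mul_assoc] }

theorem id_smul [Finite G] (c : G × Gᵐᵒᵖ) (g : G) :
    c • (show Biset.id G from g) = (show Biset.id G from c.1 * g * c.2.unop) := rfl

theorem comp_congr {U U' : Biset G H} {V V' : Biset H K} (hU : U.Iso U') (hV : V.Iso V') :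
    (comp U V).Iso (comp U' V') := by
  obtain ⟨e, he⟩ := hU
  obtain ⟨f, hf⟩ := hV
  refine FinGSet.Iso.of_surjective (X := U × V)
    (fun x => pair x.1 x.2) (fun x => pair (e x.1) (f x.2)) ?_ ?_ ?_
    (fun c x => ((c.1, (1 : Hᵐᵒᵖ)) • x.1, ((1 : H), c.2) • x.2)) ?_ ?_
  · intro z
    obtain ⟨u, v, rfl⟩ := pair_surjective z
    exact ⟨(u, v), rfl⟩
  · intro z
    obtain ⟨u, v, rfl⟩ := pair_surjective z
    exact ⟨(e.symm u, f.symm v), by simp⟩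
  · intro x y
    simp only [pair_eq_pair, ← he, ← hf, e.injective.eq_iff, f.injective.eq_iff]
  · intro c x
    rw [smul_pair]
  · intro c x
    simp only [he, hf, smul_pair]

theorem comp_sum_left (U U' : Biset G H) (V : Biset H K) :
    (comp (U.sum U') V).Iso ((comp U V).sum (comp U' V)) := by
  refine FinGSet.Iso.of_surjective (X := (U × V) ⊕ (U' × V))
    (Sum.elim (fun x => pair (FinGSet.inl U U' x.1) x.2)
      (fun x => pair (FinGSet.inr U U' x.1) x.2))
    (Sum.elim (fun x => FinGSet.inl _ _ (pair x.1 x.2)) (fun x => FinGSet.inr _ _ (pair x.1 x.2)))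
    ?_ ?_ ?_
    (fun c => Sum.map (fun x => ((c.1, (1 : Hᵐᵒᵖ)) • x.1, ((1 : H), c.2) • x.2))
      (fun x => ((c.1, (1 : Hᵐᵒᵖ)) • x.1, ((1 : H), c.2) • x.2))) ?_ ?_
  · intro z
    obtain ⟨u | u, v, rfl⟩ := pair_surjective z
    · exact ⟨Sum.inl (u, v), rfl⟩
    · exact ⟨Sum.inr (u, v), rfl⟩
  · rintro (z | z)
    · obtain ⟨u, v, rfl⟩ := pair_surjective z
      exact ⟨Sum.inl (u, v), rfl⟩
    · obtain ⟨u, v, rfl⟩ := pair_surjective z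
      exact ⟨Sum.inr (u, v), rfl⟩
  · rintro (x | x) (y | y) <;>
      simp [pair_eq_pair, FinGSet.smul_inl, FinGSet.smul_inr, FinGSet.inl_inj, FinGSet.inr_inj,
        FinGSet.inl_ne_inr, FinGSet.inr_ne_inl]
  · rintro c (x | x) <;> simp [smul_pair, FinGSet.smul_inl, FinGSet.smul_inr]
  · rintro c (x | x) <;> simp [smul_pair, FinGSet.smul_inl, FinGSet.smul_inr]

theorem comp_sum_right (U : Biset G H) (V V' : Biset H K) :
    (comp U (V.sum V')).Iso ((comp U V).sum (comp U V')) := by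
  refine FinGSet.Iso.of_surjective (X := (U × V) ⊕ (U × V'))
    (Sum.elim (fun x => pair x.1 (FinGSet.inl V V' x.2))
      (fun x => pair x.1 (FinGSet.inr V V' x.2)))
    (Sum.elim (fun x => FinGSet.inl _ _ (pair x.1 x.2)) (fun x => FinGSet.inr _ _ (pair x.1 x.2)))
    ?_ ?_ ?_
    (fun c => Sum.map (fun x => ((c.1, (1 : Hᵐᵒᵖ)) • x.1, ((1 : H), c.2) • x.2))
      (fun x => ((c.1, (1 : Hᵐᵒᵖ)) • x.1, ((1 : H), c.2) • x.2))) ?_ ?_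
  · intro z
    obtain ⟨u, v | v, rfl⟩ := pair_surjective z
    · exact ⟨Sum.inl (u, v), rfl⟩
    · exact ⟨Sum.inr (u, v), rfl⟩
  · rintro (z | z)
    · obtain ⟨u, v, rfl⟩ := pair_surjective z
      exact ⟨Sum.inl (u, v), rfl⟩
    · obtain ⟨u, v, rfl⟩ := pair_surjective z
      exact ⟨Sum.inr (u, v), rfl⟩
  · rintro (x | x) (y | y) <;>
      simp [pair_eq_pair, FinGSet.smul_inl, FinGSet.smul_inr, FinGSet.inl_inj, FinGSet.inr_inj,
        FinGSet.inl_ne_inr, FinGSet.inr_ne_inl]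
  · rintro c (x | x) <;> simp [smul_pair, FinGSet.smul_inl, FinGSet.smul_inr]
  · rintro c (x | x) <;> simp [smul_pair, FinGSet.smul_inl, FinGSet.smul_inr]

theorem comp_assoc (U : Biset G H) (V : Biset H K) (W : Biset K K') :
    (comp (comp U V) W).Iso (comp U (comp V W)) := by
  refine FinGSet.Iso.of_surjective (X := U × V × W)
    (fun x => pair (pair x.1 x.2.1) x.2.2) (fun x => pair x.1 (pair x.2.1 x.2.2)) ?_ ?_ ?_
    (fun c x => ((c.1, (1 : Hᵐᵒᵖ)) • x.1, x.2.1, ((1 : K), c.2) • x.2.2)) ?_ ?_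
  · intro z
    obtain ⟨z, w, rfl⟩ := pair_surjective z
    obtain ⟨u, v, rfl⟩ := pair_surjective z
    exact ⟨(u, v, w), rfl⟩
  · intro z
    obtain ⟨u, z, rfl⟩ := pair_surjective z
    obtain ⟨v, w, rfl⟩ := pair_surjective z
    exact ⟨(u, v, w), rfl⟩
  · rintro ⟨u, v, w⟩ ⟨u', v', w'⟩
    trans ∃ (h : H) (k : K), u' = ((1 : G), op h) • u ∧ v' = (h⁻¹, op k) • v ∧
      w' = (k⁻¹, (1 : K'ᵐᵒᵖ)) • w
    · refine pair_eq_pair.trans ?_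
      simp only [smul_pair]
      constructor
      · rintro ⟨k, h1, h2⟩
        obtain ⟨h, h3, h4⟩ := pair_eq_pair.1 h1.symm
        refine ⟨h, k, ?_, ?_, h2⟩
        · simpa [smul_smul] using h3
        · simpa [smul_smul] using h4
      · rintro ⟨h, k, rfl, rfl, rfl⟩
        refine ⟨k, Eq.symm (pair_eq_pair.2 ⟨h, ?_⟩), rfl⟩
        simp [smul_smul]
    · refine Iff.trans ?_ pair_eq_pair.symm
      simp only [smul_pair]
      constructor
      · rintro ⟨h, k, rfl, rfl, rfl⟩
        refine ⟨h, rfl, Eq.symm (pair_eq_pair.2 ⟨k, ?_⟩)⟩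
        simp [smul_smul]
      · rintro ⟨h, h1, h2⟩
        obtain ⟨k, h3, h4⟩ := pair_eq_pair.1 h2.symm
        refine ⟨h, k, h1, ?_, ?_⟩
        · simpa [smul_smul] using h3
        · simpa [smul_smul] using h4
  · rintro c ⟨u, v, w⟩
    simp [smul_pair, ← Prod.one_eq_mk]
  · rintro c ⟨u, v, w⟩
    simp [smul_pair, ← Prod.one_eq_mk]

theorem id_comp [Finite G] (U : Biset G H) : (comp (id G) U).Iso U := by
  refine FinGSet.Iso.of_surjective (X := G × U)
    (fun x => pair (show Biset.id G from x.1) x.2) (fun x => (x.1, (1 : Hᵐᵒᵖ)) • x.2)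
    ?_ (fun u => ⟨(1, u), one_smul _ u⟩) ?_
    (fun c x => (c.1 * x.1, ((1 : G), c.2) • x.2)) ?_ ?_
  · intro z
    obtain ⟨g, u, rfl⟩ := pair_surjective z
    exact ⟨(g, u), rfl⟩
  · rintro ⟨g, u⟩ ⟨g', u'⟩
    refine pair_eq_pair.trans ?_
    constructor
    · rintro ⟨h, h1, h2⟩
      have h1' : g' = 1 * g * h := h1
      have h2' : u' = (h⁻¹, (1 : Hᵐᵒᵖ)) • u := h2
      simp [h1', h2', smul_smul]
    · intro hg
      refine ⟨g⁻¹ * g', ?_, ?_⟩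
      · change g' = 1 * g * (g⁻¹ * g')
        group
      · have hg' : (g, (1 : Hᵐᵒᵖ)) • u = (g', (1 : Hᵐᵒᵖ)) • u' := hg
        have := congrArg (fun z => (g'⁻¹, (1 : Hᵐᵒᵖ)) • z) hg'
        simp only [smul_smul, Prod.mk_mul_mk, inv_mul_cancel, mul_one, ← Prod.one_eq_mk,
          one_smul] at this
        simp [← this]
  · rintro c ⟨g, u⟩
    rw [smul_pair, id_smul]
    simp
  · rintro ⟨c, d⟩ ⟨g, u⟩
    simp [smul_smul]

theorem comp_id [Finite H] (U : Biset G H) : (comp U (id H)).Iso U := by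
  refine FinGSet.Iso.of_surjective (X := U × H)
    (fun x => pair x.1 (show Biset.id H from x.2)) (fun x => ((1 : G), op x.2) • x.1)
    ?_ (fun u => ⟨(u, 1), one_smul _ u⟩) ?_
    (fun c x => ((c.1, (1 : Hᵐᵒᵖ)) • x.1, x.2 * c.2.unop)) ?_ ?_
  · intro z
    obtain ⟨u, h, rfl⟩ := pair_surjective z
    exact ⟨(u, h), rfl⟩
  · rintro ⟨u, h⟩ ⟨u', h'⟩
    refine pair_eq_pair.trans ?_
    constructor
    · rintro ⟨k, h1, h2⟩
      have h1' : u' = ((1 : G), op k) • u := h1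
      have h2' : h' = k⁻¹ * h * 1 := h2
      simp [h1', h2', smul_smul, ← op_mul]
    · intro hg
      refine ⟨h * h'⁻¹, ?_, ?_⟩
      · have hg' : ((1 : G), op h) • u = ((1 : G), op h') • u' := hg
        have := congrArg (fun z => ((1 : G), op h'⁻¹) • z) hg'
        simp only [smul_smul, Prod.mk_mul_mk, ← op_mul, mul_inv_cancel, mul_one, op_one,
          ← Prod.one_eq_mk, one_smul] at this
        exact this.symm
      · change h' = (h * h'⁻¹)⁻¹ * h * 1
        group
  · rintro c ⟨u, h⟩
    rw [smul_pair, id_smul]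
    simp
  · rintro ⟨c, d⟩ ⟨u, h⟩
    simp [smul_smul]

theorem comp_empty (U : Biset G H) :
    (comp U (FinGSet.empty (H × Kᵐᵒᵖ))).Iso (FinGSet.empty (G × Kᵐᵒᵖ)) := by
  have : IsEmpty (comp U (FinGSet.empty (H × Kᵐᵒᵖ))) := ⟨by rintro ⟨_, x⟩; exact x.elim⟩
  have : IsEmpty (FinGSet.empty (G × Kᵐᵒᵖ)) := ⟨fun x => PEmpty.elim x⟩
  exact ⟨Equiv.equivOfIsEmpty _ _, fun _ x => isEmptyElim x⟩

theorem empty_comp (V : Biset H K) :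
    (comp (FinGSet.empty (G × Hᵐᵒᵖ)) V).Iso (FinGSet.empty (G × Kᵐᵒᵖ)) := by
  have : IsEmpty (comp (FinGSet.empty (G × Hᵐᵒᵖ)) V) := ⟨by rintro ⟨x, _⟩; exact x.elim⟩
  have : IsEmpty (FinGSet.empty (G × Kᵐᵒᵖ)) := ⟨fun x => PEmpty.elim x⟩
  exact ⟨Equiv.equivOfIsEmpty _ _, fun _ x => isEmptyElim x⟩

/-- The product of bisets on isomorphism classes. -/
def compClass : FinGSet.Class (G × Hᵐᵒᵖ) →+ FinGSet.Class (H × Kᵐᵒᵖ) →+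
    FinGSet.Class (G × Kᵐᵒᵖ) where
  toFun a :=
    { toFun := fun b => Quotient.map₂ comp (fun _ _ h _ _ h' => comp_congr h h') a b
      map_zero' := by
        obtain ⟨U⟩ := a
        exact FinGSet.toClass_eq (comp_empty U)
      map_add' := by
        obtain ⟨U⟩ := a
        rintro ⟨V⟩ ⟨V'⟩
        exact FinGSet.toClass_eq (comp_sum_right U V V') }
  map_zero' := by
    ext b
    obtain ⟨V⟩ := b
    exact FinGSet.toClass_eq (empty_comp V)
  map_add' a a' := by
    ext b
    obtain ⟨U⟩ := a
    obtain ⟨U'⟩ := a'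
    obtain ⟨V⟩ := b
    exact FinGSet.toClass_eq (comp_sum_left U U' V)

end Biset

/-! ### The biset category -/

/-- The module `R B(G, H)`, where `B(G, H)` is the Grothendieck group of finite
`(G, H)`-bisets. -/
abbrev RB (R : Type v) [CommRing R] (G H : Type u) [Group G] [Group H] : Type (max v (u + 1)) :=
  RBurnside R (G × Hᵐᵒᵖ)

namespace RB

variable {R : Type v} [CommRing R] {G H K K' : Type u} [Group G] [Group H] [Group K] [Group K']

/-- The bilinear product `×_H : R B(G, H) × R B(H, K) → R B(G, K)`. -/
def comp : RB R G H →ₗ[R] RB R H K →ₗ[R] RB R G K :=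
  baseChange₂ R (grothMap₂ Biset.compClass)

theorem comp_mk (U : Biset G H) (V : Biset H K) :
    comp (RBurnside.mk R U) (RBurnside.mk R V) = RBurnside.mk R (Biset.comp U V) := by
  unfold comp RBurnside.mk
  rw [baseChange₂_tmul, grothMap₂_of, mul_one]
  rfl

/-- The identity element of `R B(G, G)`: the class of the biset `G`. -/
def id (R : Type v) [CommRing R] (G : Type u) [Group G] [Finite G] : RB R G G :=
  RBurnside.mk R (Biset.id G)

theorem id_comp [Finite G] (a : RB R G H) : comp (id R G) a = a := by
  have : (comp (id R G) : RB R G H →ₗ[R] RB R G H) = LinearMap.id :=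
    RBurnside.hom_ext fun U => by
      rw [id, comp_mk, RBurnside.mk_eq (Biset.id_comp U), LinearMap.id_apply]
  rw [this, LinearMap.id_apply]

theorem comp_id [Finite H] (a : RB R G H) : comp a (id R H) = a := by
  have : (comp.flip (id R H) : RB R G H →ₗ[R] RB R G H) = LinearMap.id :=
    RBurnside.hom_ext fun U => by
      rw [LinearMap.flip_apply, id, comp_mk, RBurnside.mk_eq (Biset.comp_id U),
        LinearMap.id_apply]
  exact LinearMap.congr_fun this a

theorem comp_assoc (a : RB R G H) (b : RB R H K) (c : RB R K K') :
    comp (comp a b) c = comp a (comp b c) := by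
  have h3 : ∀ (U : Biset G H) (V : Biset H K),
      (comp (comp (RBurnside.mk R U) (RBurnside.mk R V)) : RB R K K' →ₗ[R] RB R G K') =
        (comp (RBurnside.mk R U)) ∘ₗ (comp (RBurnside.mk R V)) := fun U V =>
    RBurnside.hom_ext fun W => by
      rw [LinearMap.comp_apply, comp_mk, comp_mk, comp_mk, comp_mk,
        RBurnside.mk_eq (Biset.comp_assoc U V W)]
  have h2 : ∀ (U : Biset G H),
      (comp.flip c ∘ₗ comp (RBurnside.mk R U) : RB R H K →ₗ[R] RB R G K') =
        (comp (RBurnside.mk R U)) ∘ₗ (comp.flip c) := fun U =>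
    RBurnside.hom_ext fun V => LinearMap.congr_fun (h3 U V) c
  have h1 : (comp.flip c ∘ₗ comp.flip b : RB R G H →ₗ[R] RB R G K') =
      comp.flip (comp b c) :=
    RBurnside.hom_ext fun U => LinearMap.congr_fun (h2 U) b
  exact LinearMap.congr_fun h1 a

end RB

/-- The biset category `R C` of finite groups over `R`: its objects are the finite groups. -/
structure BisetCat (R : Type v) [CommRing R] : Type (u + 1) where
  carrier : Type u
  [group : Group carrier]
  [finite : Finite carrier]

namespace BisetCat

variable {R : Type v} [CommRing R]

instance : CoeSort (BisetCat.{u, v} R) (Type u) := ⟨BisetCat.carrier⟩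
instance (G : BisetCat.{u, v} R) : Group G := G.group
instance (G : BisetCat.{u, v} R) : Finite G := G.finite

/-- Morphisms `G ⟶ H` are the elements of `R B(H, G)`, and composition is the product
`R B(K, H) × R B(H, G) → R B(K, G)`. -/
instance : Category.{max v (u + 1)} (BisetCat.{u, v} R) where
  Hom G H := RB R H G
  id G := RB.id R G
  comp f g := RB.comp g f
  id_comp f := RB.comp_id f
  comp_id f := RB.id_comp f
  assoc f g h := (RB.comp_assoc h g f).symm

instance homGroup (G H : BisetCat.{u, v} R) : AddCommGroup (G ⟶ H) :=
  inferInstanceAs (AddCommGroup (RB R H G))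

instance : Preadditive (BisetCat.{u, v} R) where
  homGroup G H := BisetCat.homGroup G H
  add_comp _ _ _ f f' g := map_add (RB.comp g) f f'
  comp_add _ _ _ f g g' := LinearMap.map_add₂ RB.comp g g' f

end BisetCat

/-- The full subcategory `R C_p` of the biset category consisting of the finite `p`-groups. -/
abbrev PBisetCat (R : Type v) [CommRing R] (p : ℕ) : Type (u + 1) :=
  ObjectProperty.FullSubcategory (fun G : BisetCat.{u, v} R => IsPGroup p G)

namespace PBisetCat

variable {R : Type v} [CommRing R] {p : ℕ}

/-- The finite `p`-group `P` as an object of `R C_p`. -/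
def of (R : Type v) [CommRing R] {p : ℕ} (P : Type u) [Group P] [Finite P] (hP : IsPGroup p P) :
    PBisetCat.{u, v} R p := ⟨⟨P⟩, hP⟩

/-- A morphism `P ⟶ Q` of `R C_p`, as an element of `R B(Q, P)`. -/
def toRB {P Q : PBisetCat.{u, v} R p} (f : P ⟶ Q) : RB R Q.obj P.obj := f.hom

end PBisetCat

/-! ### Particular bisets -/

section Bisets

variable {G H : Type u} [Group G] [Group H]

/-- The `(G, H)`-biset `(G × H) / L`, with `a · (g, h) L · b = (a g, b⁻¹ h) L`. -/
def Biset.coset [Finite G] [Finite H] (L : Subgroup (G × H)) : Biset G H where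
  carrier := (G × H) ⧸ L
  act := MulAction.compHom ((G × H) ⧸ L)
    ({ toFun := fun c => (c.1, c.2.unop⁻¹)
       map_one' := by simp
       map_mul' := fun c d => by simp } : G × Hᵐᵒᵖ →* G × H)

/-- The subgroup `Δ_N(G) = {(a, b) | a b⁻¹ ∈ N}` of `G × G`. -/
def deltaSubgroup (N : Subgroup G) [hN : N.Normal] : Subgroup (G × G) where
  carrier := {x | x.1 * x.2⁻¹ ∈ N}
  one_mem' := by simp
  mul_mem' := by
    rintro ⟨a, b⟩ ⟨c, d⟩ h h'
    change a * b⁻¹ ∈ N at h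
    change c * d⁻¹ ∈ N at h'
    change a * c * (b * d)⁻¹ ∈ N
    have : a * c * (b * d)⁻¹ = a * (c * d⁻¹) * a⁻¹ * (a * b⁻¹) := by group
    rw [this]
    exact mul_mem (hN.conj_mem _ h' a) h
  inv_mem' := by
    rintro ⟨a, b⟩ h
    change a * b⁻¹ ∈ N at h
    change a⁻¹ * b⁻¹⁻¹ ∈ N
    have : a⁻¹ * b⁻¹⁻¹ = a⁻¹ * (a * b⁻¹)⁻¹ * a⁻¹⁻¹ := by group
    rw [this]
    exact hN.conj_mem _ (inv_mem h) _

/-- The `(G, G)`-biset `G × X` attached to a `G`-set `X`, with `a (g, x) b = (a g b, a x)`. -/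
def Biset.tilde [Finite G] (X : FinGSet G) : Biset G G where
  carrier := G × X
  act :=
    { smul := fun c x => (c.1 * x.1 * c.2.unop, c.1 • x.2)
      one_smul := fun x => by
        change (1 * x.1 * 1, (1 : G) • x.2) = x
        simp
      mul_smul := fun c d x => by
        change (c.1 * d.1 * x.1 * (d.2.unop * c.2.unop), (c.1 * d.1) • x.2) =
          (c.1 * (d.1 * x.1 * d.2.unop) * c.2.unop, c.1 • d.1 • x.2)
        simp [mul_assoc, mul_smul] }

/-- `X ↦ G × X` on isomorphism classes. -/
def Biset.tildeClass (G : Type u) [Group G] [Finite G] :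
    FinGSet.Class G →+ FinGSet.Class (G × Gᵐᵒᵖ) where
  toFun := Quotient.map Biset.tilde (by
    rintro X Y ⟨e, he⟩
    refine ⟨Equiv.prodCongr (Equiv.refl G) e, ?_⟩
    rintro c ⟨g, x⟩
    exact Prod.ext rfl (he c.1 x))
  map_zero' := by
    have h1 : IsEmpty (Biset.tilde (FinGSet.empty G)) := ⟨fun x => PEmpty.elim x.2⟩
    have h2 : IsEmpty (FinGSet.empty (G × Gᵐᵒᵖ)) := ⟨fun x => PEmpty.elim x⟩
    exact FinGSet.toClass_eq ⟨Equiv.equivOfIsEmpty _ _, fun _ x => isEmptyElim x⟩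
  map_add' := by
    rintro ⟨X⟩ ⟨Y⟩
    refine FinGSet.toClass_eq ⟨Equiv.prodSumDistrib G X Y, ?_⟩
    rintro c ⟨g, x | y⟩ <;> rfl

/-- The linear map `α ↦ α̃` from `R B(G)` to `R B(G, G)`. -/
def RB.tilde (R : Type v) [CommRing R] (G : Type u) [Group G] [Finite G] :
    RBurnside R G →ₗ[R] RB R G G :=
  LinearMap.baseChange R (grothMap (Biset.tildeClass G)).toIntLinearMap

theorem RB.tilde_mk (R : Type v) [CommRing R] [Finite G] (X : FinGSet G) :
    RB.tilde R G (RBurnside.mk R X) = RBurnside.mk R (Biset.tilde X) := by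
  unfold RB.tilde RBurnside.mk
  rw [LinearMap.baseChange_tmul, AddMonoidHom.coe_toIntLinearMap, grothMap_of]
  rfl

end Bisets

/-! ### The idempotents `φ` -/

/-- The Möbius function of a finite poset. -/
def moebius {α : Type*} [PartialOrder α] [Finite α] (a b : α) : ℤ := by
  classical
  letI := Fintype.ofFinite α
  letI : LocallyFiniteOrder α := Fintype.toLocallyFiniteOrder
  exact IncidenceAlgebra.mu ℤ a b

section Idempotents

variable (R : Type v) [CommRing R] {G : Type u} [Group G] [Finite G]

/-- `e_H^G = |N_G(H)|⁻¹ ∑_{K ≤ H} |K| μ(K, H) [G / K]` in `R B(G)`. -/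
def idemE (H : Subgroup G) : RBurnside R G :=
  Ring.inverse (Nat.card (Subgroup.normalizer (H : Set G)) : R) •
    ∑ᶠ K : {K : Subgroup G // K ≤ H},
      ((Nat.card K.1 : R) * (moebius K.1 H : R)) • RBurnside.mk R (FinGSet.coset K.1)

/-- `Y_L = ẽ_G^G [(G × G) / L] ẽ_G^G` in `R B(G, G)`. -/
def elemY (L : Subgroup (G × G)) : RB R G G :=
  RB.comp (RB.comp (RB.tilde R G (idemE R ⊤)) (RBurnside.mk R (Biset.coset L)))
    (RB.tilde R G (idemE R ⊤))

/-- The normal subgroups of `G`. -/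
abbrev NormalSubgroup (G : Type u) [Group G] : Type u := {N : Subgroup G // N.Normal}

instance (N : NormalSubgroup G) : N.1.Normal := N.2

/-- `φ_N^G = ∑_{N ≤ M ≤ Φ(G)} μ_⊴(N, M) Y_{Δ_M(G)}`, where `M` runs through the normal
subgroups of `G`. -/
def idemPhi (N : NormalSubgroup G) : RB R G G :=
  ∑ᶠ M : {M : NormalSubgroup G // N ≤ M ∧ M.1 ≤ frattini G},
    (moebius N M.1 : R) • elemY R (deltaSubgroup M.1.1)

variable (G) in
/-- `φ_1^G`. -/
def idemPhiOne : RB R G G := idemPhi R (⟨⊥, inferInstance⟩ : NormalSubgroup G)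

end Idempotents

/-! ### Sections and the idempotents `ε` -/

/-- A section `(T, S)` of `G`: subgroups with `S ⊴ T`. -/
structure GroupSection (G : Type u) [Group G] : Type u where
  T : Subgroup G
  S : Subgroup G
  le : S ≤ T
  normal : (S.subgroupOf T).Normal

namespace GroupSection

variable {G : Type u} [Group G]

instance (s : GroupSection G) : (s.S.subgroupOf s.T).Normal := s.normal

instance [Finite G] : Finite (GroupSection G) :=
  Finite.of_injective (fun s : GroupSection G => (s.T, s.S)) (by
    rintro ⟨T, S, _, _⟩ ⟨T', S', _, _⟩ h
    obtain ⟨rfl, rfl⟩ := Prod.ext_iff.1 h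
    rfl)

/-- The group `T / S`. -/
abbrev quot (s : GroupSection G) : Type u := s.T ⧸ s.S.subgroupOf s.T

/-- A section `(T, S)` is minimal if `S ≤ Φ(T)`. -/
def IsMinimal (s : GroupSection G) : Prop := s.S.subgroupOf s.T ≤ frattini s.T

/-- Conjugacy of sections. -/
def IsConj (s t : GroupSection G) : Prop :=
  ∃ g : G, t.T = s.T.map (MulAut.conj g).toMonoidHom ∧ t.S = s.S.map (MulAut.conj g).toMonoidHom

/-- `X` is a set of representatives of the conjugacy classes of minimal sections of `G`. -/
def IsRepresentatives (X : Set (GroupSection G)) : Prop :=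
  (∀ s ∈ X, s.IsMinimal) ∧ ∀ s : GroupSection G, s.IsMinimal → ∃! t, t ∈ X ∧ s.IsConj t

/-- The subgroup `N_G(T, S) = N_G(T) ∩ N_G(S)`. -/
def normalizer (s : GroupSection G) : Subgroup G :=
  Subgroup.normalizer (s.T : Set G) ⊓ Subgroup.normalizer (s.S : Set G)

variable [Finite G]

/-- The `(G, T / S)`-biset `G / S`. -/
def indinf (s : GroupSection G) : Biset G s.quot where
  carrier := G ⧸ s.S
  act :=
    { smul := fun c x => Quotient.liftOn₂' c.2.unop x
        (fun t g => (QuotientGroup.mk (c.1 * g * (t : G)) : G ⧸ s.S)) (by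
          intro t g t' g' ht hg
          rw [QuotientGroup.leftRel_apply] at ht hg
          refine QuotientGroup.eq.2 ?_
          have h1 : ((t : G)⁻¹ * (t' : G)) ∈ s.S := by simpa [Subgroup.mem_subgroupOf] using ht
          have h2 := s.normal.conj_mem ⟨g⁻¹ * g', s.le hg⟩ hg t'⁻¹
          have h2' : (t' : G)⁻¹ * (g⁻¹ * g') * t' ∈ s.S := by
            simpa [Subgroup.mem_subgroupOf] using h2
          have : (c.1 * g * (t : G))⁻¹ * (c.1 * g' * t') =
              ((t : G)⁻¹ * (t' : G)) * ((t' : G)⁻¹ * (g⁻¹ * g') * t') := by group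
          rw [this]
          exact mul_mem h1 h2')
      one_smul := by
        rintro ⟨g⟩
        refine congrArg (QuotientGroup.mk (s := s.S)) ?_
        change 1 * g * ((1 : s.T) : G) = g
        simp
      mul_smul := by
        rintro ⟨a, ⟨⟨t⟩⟩⟩ ⟨b, ⟨⟨t'⟩⟩⟩ ⟨g⟩
        refine congrArg (QuotientGroup.mk (s := s.S)) ?_
        change a * b * g * ((t' * t : s.T) : G) = a * (b * g * (t' : G)) * (t : G)
        simp [mul_assoc] }

/-- The `(T / S, G)`-biset `S \ G`. -/
def defres (s : GroupSection G) : Biset s.quot G where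
  carrier := Quotient (QuotientGroup.rightRel s.S)
  act :=
    { smul := fun c x => Quotient.liftOn₂' c.1 x
        (fun t g => (Quotient.mk (QuotientGroup.rightRel s.S) ((t : G) * g * c.2.unop))) (by
          intro t g t' g' ht hg
          rw [QuotientGroup.leftRel_apply] at ht
          rw [QuotientGroup.rightRel_apply] at hg
          refine Quotient.sound (s := QuotientGroup.rightRel s.S)
            (QuotientGroup.rightRel_apply.2 ?_)
          have h1 := s.normal.conj_mem _ ht t'
          have h1' : (t' : G) * ((t : G)⁻¹ * t') * (t' : G)⁻¹ ∈ s.S := by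
            simpa [Subgroup.mem_subgroupOf] using h1
          have h2 := s.normal.conj_mem ⟨g' * g⁻¹, s.le hg⟩ hg t'
          have h2' : (t' : G) * (g' * g⁻¹) * (t' : G)⁻¹ ∈ s.S := by
            simpa [Subgroup.mem_subgroupOf] using h2
          have : (t' * g' * c.2.unop : G) * (t * g * c.2.unop : G)⁻¹ =
              ((t' : G) * (g' * g⁻¹) * (t' : G)⁻¹) *
                ((t' : G) * ((t : G)⁻¹ * t') * (t' : G)⁻¹) := by group
          rw [this]
          exact mul_mem h2' h1')
      one_smul := by
        rintro ⟨g⟩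
        refine congrArg (Quotient.mk (QuotientGroup.rightRel s.S)) ?_
        change ((1 : s.T) : G) * g * 1 = g
        simp
      mul_smul := by
        rintro ⟨⟨t⟩, a⟩ ⟨⟨t'⟩, b⟩ ⟨g⟩
        refine congrArg (Quotient.mk (QuotientGroup.rightRel s.S)) ?_
        change ((t * t' : s.T) : G) * g * (b.unop * a.unop) =
          (t : G) * ((t' : G) * g * b.unop) * a.unop
        simp [mul_assoc] }

variable (R : Type v) [CommRing R]

/-- `u_{T,S}^G = Indinf_{T/S}^G φ_1^{T/S}` in `R B(G, T/S)`. -/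
def u (s : GroupSection G) : RB R G s.quot :=
  RB.comp (RBurnside.mk R s.indinf) (idemPhiOne R s.quot)

/-- `v_{T,S}^G = φ_1^{T/S} Defres_{T/S}^G` in `R B(T/S, G)`. -/
def v (s : GroupSection G) : RB R s.quot G :=
  RB.comp (idemPhiOne R s.quot) (RBurnside.mk R s.defres)

/-- `ε_{T,S}^G = |N_G(T,S) : T|⁻¹ u_{T,S}^G v_{T,S}^G` in `R B(G, G)`. -/
def epsilon (s : GroupSection G) : RB R G G :=
  Ring.inverse (s.T.relIndex s.normalizer : R) • RB.comp (s.u R) (s.v R)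

end GroupSection

/-- `H ⊑ G`: the group `H` is a subquotient of `G`. -/
def IsSubquotient (H G : Type u) [Group H] [Group G] : Prop :=
  ∃ s : GroupSection G, Nonempty (s.quot ≃* H)

/-! ### Atoric `p`-groups -/

/-- `E` is an elementary abelian `p`-group (possibly trivial). -/
def IsElementaryAbelian (p : ℕ) (E : Type u) [Group E] : Prop :=
  (∀ x y : E, x * y = y * x) ∧ ∀ x : E, x ^ p = 1

/-- `P` is an atoric `p`-group: a finite `p`-group that has no decomposition `P = E × Q` with `E` a
nontrivial elementary abelian `p`-group. -/
structure IsAtoric (p : ℕ) (P : Type u) [Group P] : Prop where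
  finite : Finite P
  isPGroup : IsPGroup p P
  subsingleton : ∀ (E Q : Type u) [Group E] [Group Q], IsElementaryAbelian p E →
    Nonempty (P ≃* E × Q) → Subsingleton E

theorem exists_maximal_normal (P : Type u) [Group P] [Finite P] :
    ∃ N : Subgroup P, Maximal (fun N : Subgroup P => N.Normal ∧ N ⊓ frattini P = ⊥) N :=
  Set.Finite.exists_maximal (Set.toFinite {N : Subgroup P | N.Normal ∧ N ⊓ frattini P = ⊥})
    ⟨⊥, inferInstance, bot_inf_eq _⟩

/-- A chosen maximal element among the normal subgroups `N` of `P` with `N ∩ Φ(P) = 1`. -/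
def atKernel (P : Type u) [Group P] [Finite P] : Subgroup P :=
  (exists_maximal_normal P).choose

theorem atKernel_spec (P : Type u) [Group P] [Finite P] :
    Maximal (fun N : Subgroup P => N.Normal ∧ N ⊓ frattini P = ⊥) (atKernel P) :=
  (exists_maximal_normal P).choose_spec

instance (P : Type u) [Group P] [Finite P] : (atKernel P).Normal := (atKernel_spec P).prop.1

/-- The largest atoric quotient `P^@ = P / N` of `P`, where `N` is a maximal normal subgroup of `P`
such that `N ∩ Φ(P) = 1`. -/
abbrev AtQuotient (P : Type u) [Group P] [Finite P] : Type u := P ⧸ atKernel P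

/-- `b_L^P = ∑ ε_{T,S}^P`, where `(T, S)` runs through the elements of the set `X` of
representatives of conjugacy classes of minimal sections of `P` such that `(T/S)^@ ≅ L`. -/
def idemB (R : Type v) [CommRing R] (L : Type u) [Group L] {P : Type u} [Group P] [Finite P]
    (X : Set (GroupSection P)) : RB R P P :=
  ∑ᶠ s : {s : GroupSection P // s ∈ X ∧ Nonempty (AtQuotient s.quot ≃* L)}, s.1.epsilon R

end

set_option linter.unusedSectionVars false

noncomputable section

/-! ### Möbius functions of finite posets -/

section Moebius

variable {α β : Type*} [PartialOrder α] [PartialOrder β]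

/-! Two facts about the elements `ε_{T,S}` carry everything: over representatives of the conjugacy
classes of minimal sections they sum to the identity (`finsum_epsilon`), and `ε_{T,S}^Q a
ε_{T',S'}^P ≠ 0` forces `(T/S)^@ ≅ (T'/S')^@` (`nonempty_atQuotient_equiv_of_epsilon`). Grouping the
`ε_{T,S}` by the atoric group `(T/S)^@` gives `∑_M b_M^P = 1`, together with `b_M^Q a b_L^P = 0`
unless `M ≅ L`. The rest is formal: `b_L a = b_L a ∑_M b_M = b_L a b_L = ∑_M b_M a b_L = a b_L`, and
idempotence and orthogonality follow in the same way. Neither idempotence nor orthogonality of the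
individual `ε_{T,S}` is needed.

Sum: `|T| u_{T,S} v_{T,S}` is a combination of the bisets `(G×G)/{(a,b) : a ∈ K, ab⁻¹ ∈ M}`, for `M
⊴ T`, `S ≤ M ≤ Φ(T)` and `K ≤ T`, with coefficients `μ_⊴(S,M) |K| μ(K,T)`. The biset does not
involve `S`, so summing over `S` leaves only `M = 1`; then it does not involve `T` either, and
summing over `T` leaves only `K = G`, that is, `|G|` times the identity. Counting orbits of sections
replaces all sections by representatives.

Vanishing: by linearity `a` may be a transitive biset `(G×H)/L`. The idempotent `ẽ_G^G` kills it
unless `L` projects onto `G`, and `φ_1^G` kills it unless `L` meets `Φ(G) × 1` trivially; likewise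
for `H`. Since the projections map `Φ(L)` into `Φ(G)` and `Φ(H)`, the kernels of both projections of
`L` meet `Φ(L)` trivially, and such quotients do not change `(-)^@`. Hence `G^@ ≅ L^@ ≅ H^@`.

Support of `b_L^P`: a nonzero term makes `L` a subquotient of `P`, and an atoric subquotient of `P`
is already one of `P^@` (`IsSubquotient.of_ker_inf_frattini`). Conversely, `L` is realized by a
minimal section; its `ε` is nonzero, as is seen by counting points with a fixed stabilizer
(`epsilon_ne_zero`), and `ε b_L = ε`. -/

theorem moebius_self [Finite α] (a : α) : moebius a a = 1 := by
  classical
  let := Fintype.ofFinite α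
  let : LocallyFiniteOrder α := Fintype.toLocallyFiniteOrder
  exact IncidenceAlgebra.mu_self a

theorem moebius_eq_zero [Finite α] {a b : α} (h : ¬ a ≤ b) : moebius a b = 0 := by
  classical
  let := Fintype.ofFinite α
  let : LocallyFiniteOrder α := Fintype.toLocallyFiniteOrder
  exact IncidenceAlgebra.apply_eq_zero_of_not_le h _

open Classical in
theorem sum_moebius_right [Fintype α] (a b : α) :
    ∑ c, (if c ≤ b then moebius a c else 0) = if a = b then 1 else 0 := by
  let : LocallyFiniteOrder α := Fintype.toLocallyFiniteOrder
  have h := IncidenceAlgebra.sum_Icc_mu_right (𝕜 := ℤ) a b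
  rw [← h, ← Finset.sum_filter]
  symm
  have e : ∀ c, moebius a c = IncidenceAlgebra.mu ℤ a c := by
    intro c
    unfold moebius
    congr!
  simp only [e]
  refine Finset.sum_subset (fun c hc => ?_) (fun c hc hc' => ?_)
  · simpa using (Finset.mem_Icc.1 hc).2
  · refine IncidenceAlgebra.apply_eq_zero_of_not_le (fun hac => hc' ?_) _
    exact Finset.mem_Icc.2 ⟨hac, by simpa using hc⟩

open Classical in
theorem sum_moebius_left [Fintype α] (a b : α) :
    ∑ c, (if a ≤ c then moebius c b else 0) = if a = b then 1 else 0 := by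
  let : LocallyFiniteOrder α := Fintype.toLocallyFiniteOrder
  have h := IncidenceAlgebra.sum_Icc_mu_left (𝕜 := ℤ) a b
  rw [← h, ← Finset.sum_filter]
  symm
  have e : ∀ c, moebius c b = IncidenceAlgebra.mu ℤ c b := by
    intro c
    unfold moebius
    congr!
  simp only [e]
  refine Finset.sum_subset (fun c hc => ?_) (fun c hc hc' => ?_)
  · simpa using (Finset.mem_Icc.1 hc).1
  · refine IncidenceAlgebra.apply_eq_zero_of_not_le (fun hac => hc' ?_) _
    exact Finset.mem_Icc.2 ⟨by simpa using hc, hac⟩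

/-- The Möbius function only depends on the interval. -/
theorem moebius_orderEmbedding [Finite α] [Finite β] (f : α ↪o β) (a : α) :
    ∀ b, (∀ y, f a ≤ y → y ≤ f b → y ∈ Set.range f) →
      moebius (f a) (f b) = moebius a b := by
  classical
  have := Fintype.ofFinite α
  have := Fintype.ofFinite β
  intro b
  induction b using WellFoundedLT.induction with
  | ind b ih =>
    intro hb
    by_cases hab : a ≤ b
    swap
    · rw [moebius_eq_zero hab, moebius_eq_zero (by simpa using hab)]
    have h1 := sum_moebius_right a b
    have h2 := sum_moebius_right (f a) (f b)
    rw [← Finset.sum_filter] at h1 h2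
    -- An element `y ≤ f b` outside the range is not above `f a`, so it contributes nothing and the
    -- two recursions agree below `b`.
    have h3 : ∑ y with y ≤ f b, moebius (f a) y = ∑ x with x ≤ b, moebius (f a) (f x) := by
      symm
      refine Finset.sum_of_injOn f f.injective.injOn ?_ ?_ ?_
      · intro x hx
        simpa using hx
      · intro y hy hy'
        refine moebius_eq_zero fun hle => hy' ?_
        obtain ⟨x, rfl⟩ := hb y hle (by simpa using hy)
        exact ⟨x, by simpa using hy, rfl⟩
      · intro x hx
        rfl
    have hbm : b ∈ Finset.univ.filter (· ≤ b) := by simp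
    rw [h3, ← Finset.add_sum_erase _ _ hbm] at h2
    rw [← Finset.add_sum_erase _ _ hbm] at h1
    have h4 : ∑ x ∈ (Finset.univ.filter (· ≤ b)).erase b, moebius (f a) (f x) =
        ∑ x ∈ (Finset.univ.filter (· ≤ b)).erase b, moebius a x := by
      refine Finset.sum_congr rfl fun x hx => ?_
      have hx' : x ≠ b ∧ x ≤ b := by simpa using hx
      exact ih x (lt_of_le_of_ne hx'.2 hx'.1)
        fun y hy hy' => hb y hy (hy'.trans (f.monotone hx'.2))
    have h5 : (if f a = f b then (1 : ℤ) else 0) = if a = b then 1 else 0 := by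
      simp [f.injective.eq_iff]
    rw [h4, h5] at h2
    linarith

theorem moebius_orderIso [Finite α] [Finite β] (f : α ≃o β) (a b : α) :
    moebius (f a) (f b) = moebius a b :=
  moebius_orderEmbedding f.toOrderEmbedding a b fun y _ _ => ⟨f.symm y, by simp⟩

open Classical in
/-- Weisner's theorem: here `c j` plays the role of the meet of `j` and `k`. -/
theorem sum_smul_meet_eq_zero {R M : Type*} [Ring R] [AddCommGroup M] [Module R M] [Fintype α]
    (m : α → R) (k : α) (hm : ∀ i ≤ k, ∑ j, (if i ≤ j then m j else 0) = 0) (c : α → α)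
    (hc : ∀ i j, i ≤ c j ↔ i ≤ j ∧ i ≤ k) (F : α → M) : ∑ j, m j • F (c j) = 0 := by
  -- Downward induction on `i`: for `i ≤ k` one has `i ≤ c j` if and only if `i ≤ j`, so the
  -- hypothesis on `m` says that the fibers of `c` over all `i' ≥ i` have total weight zero.
  have key : ∀ i, ∑ j, (if c j = i then m j else 0) = 0 := by
    intro i
    induction i using WellFoundedGT.induction with
    | ind i ih =>
      by_cases hik : i ≤ k
      · have h1 := hm i hik
        have h2 : ∑ i', (if i ≤ i' then ∑ j, (if c j = i' then m j else 0) else 0) =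
            ∑ j, (if i ≤ j then m j else 0) := by
          simp only [← Finset.sum_filter]
          simp only [Finset.sum_filter]
          rw [← Finset.sum_filter, Finset.sum_comm]
          refine Finset.sum_congr rfl fun j _ => ?_
          rw [Finset.sum_ite_eq]
          simp [hc, hik]
        rw [h1, Finset.sum_eq_single i] at h2
        · simpa using h2
        · intro b _ hb
          split_ifs with hib
          · exact ih b (lt_of_le_of_ne hib hb.symm)
          · rfl
        · simp
      · refine Finset.sum_eq_zero fun j _ => if_neg ?_
        rintro rfl
        exact hik ((hc _ _).1 le_rfl).2
  have h : ∑ j, m j • F (c j) = ∑ i, (∑ j, (if c j = i then m j else 0)) • F i := by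
    simp only [Finset.sum_smul]
    rw [Finset.sum_comm]
    refine Finset.sum_congr rfl fun j _ => ?_
    simp [ite_smul]
  rw [h]
  simp [key]

end Moebius

/-! ### Burnside groups -/

namespace FinGSet

variable {Γ : Type u} [Group Γ]

theorem iso_coset [Finite Γ] {X : FinGSet Γ} (x : X) (hx : ∀ y : X, ∃ g : Γ, g • x = y) :
    X.Iso (coset (MulAction.stabilizer Γ x)) := by
  refine Iso.of_surjective (X := Γ) (fun g => g • x)
    (fun g => (QuotientGroup.mk g : Γ ⧸ MulAction.stabilizer Γ x)) hx
    QuotientGroup.mk_surjective ?_ (fun c g => c * g) ?_ ?_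
  · intro a b
    refine Iff.trans ?_ QuotientGroup.eq.symm
    rw [MulAction.mem_stabilizer_iff, mul_smul, inv_smul_eq_iff, eq_comm]
  · intro c g
    exact mul_smul _ _ _
  · intro c g
    rfl

theorem coset_iso_of_smul [Finite Γ] {X : FinGSet Γ} (x : X) (g : Γ) :
    (coset (MulAction.stabilizer Γ (g • x))).Iso (coset (MulAction.stabilizer Γ x)) := by
  let x' : coset (MulAction.stabilizer Γ x) := (QuotientGroup.mk g : Γ ⧸ MulAction.stabilizer Γ x)
  have h : MulAction.stabilizer Γ x' = MulAction.stabilizer Γ (g • x) := by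
    ext a
    rw [MulAction.mem_stabilizer_iff, MulAction.mem_stabilizer_iff]
    have : a • x' = x' ↔ (QuotientGroup.mk (a * g) : Γ ⧸ MulAction.stabilizer Γ x) =
        QuotientGroup.mk g := Iff.rfl
    rw [this, QuotientGroup.eq, MulAction.mem_stabilizer_iff, mul_smul, inv_smul_eq_iff, mul_smul]
    exact eq_comm
  have := iso_coset x' (fun y => by
    obtain ⟨b, rfl⟩ := QuotientGroup.mk_surjective y
    refine ⟨b * g⁻¹, ?_⟩
    change (QuotientGroup.mk (b * g⁻¹ * g) : Γ ⧸ MulAction.stabilizer Γ x) = _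
    simp)
  rw [h] at this
  exact this.symm

/-- The complement of an orbit. -/
def orbitCompl (X : FinGSet Γ) (x : X) : FinGSet Γ where
  carrier := {y : X // y ∉ MulAction.orbit Γ x}
  act :=
    { smul := fun g y => ⟨g • y.1, fun h => y.2 (by
          simpa using MulAction.mem_orbit_of_mem_orbit g⁻¹ h)⟩
      one_smul := fun y => Subtype.ext (one_smul _ y.1)
      mul_smul := fun g h y => Subtype.ext (mul_smul g h y.1) }

theorem iso_coset_sum_orbitCompl [Finite Γ] (X : FinGSet Γ) (x : X) :
    ((coset (MulAction.stabilizer Γ x)).sum (X.orbitCompl x)).Iso X := by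
  refine ⟨Equiv.ofBijective (Sum.elim (MulAction.ofQuotientStabilizer Γ x) Subtype.val)
    ⟨?_, ?_⟩, ?_⟩
  · refine Function.Injective.sumElim (MulAction.injective_ofQuotientStabilizer Γ x)
      Subtype.val_injective ?_
    intro a b h
    exact b.2 (h ▸ MulAction.ofQuotientStabilizer_mem_orbit Γ x a)
  · intro y
    by_cases hy : y ∈ MulAction.orbit Γ x
    · obtain ⟨g, rfl⟩ := hy
      exact ⟨Sum.inl (QuotientGroup.mk g), rfl⟩
    · exact ⟨Sum.inr ⟨y, hy⟩, rfl⟩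
  · rintro g (y | y)
    · exact MulAction.ofQuotientStabilizer_smul Γ x g y
    · rfl

end FinGSet

namespace RBurnside

variable (R : Type v) [CommRing R] {Γ : Type u} [Group Γ]

theorem mk_sum (X Y : FinGSet Γ) : mk R (X.sum Y) = mk R X + mk R Y := by
  unfold mk
  rw [← FinGSet.toClass_add, map_add, TensorProduct.tmul_add]

theorem mk_of_isEmpty (X : FinGSet Γ) [IsEmpty X] : mk R X = 0 := by
  have : IsEmpty (FinGSet.empty Γ) := ⟨fun x => PEmpty.elim x⟩
  have h : X.toClass = 0 := FinGSet.toClass_eq (Y := FinGSet.empty Γ)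
    ⟨Equiv.equivOfIsEmpty _ _, fun _ x => isEmptyElim x⟩
  unfold mk
  rw [h, map_zero, TensorProduct.tmul_zero]

variable [Finite Γ]

/-- The element `|A| [Γ / A]`. -/
def wt (A : Subgroup Γ) : RBurnside R Γ := (Nat.card A : R) • mk R (FinGSet.coset A)

theorem wt_stabilizer_smul {X : FinGSet Γ} (x : X) (g : Γ) :
    wt R (MulAction.stabilizer Γ (g • x)) = wt R (MulAction.stabilizer Γ x) := by
  unfold wt
  rw [mk_eq (FinGSet.coset_iso_of_smul x g), MulAction.stabilizer_smul_eq_stabilizer_map_conj]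
  congr 2
  exact Nat.card_congr
    (Subgroup.equivMapOfInjective _ _ (MulAut.conj g).injective).toEquiv.symm

/-- The `|Γ : A|` points have conjugate stabilizers, so each contributes `|A| [Γ/A]`. With the
weight `|A|`, a decomposition into orbits becomes a sum over points, and no orbit representatives
have to be chosen. -/
theorem finsum_wt_coset (A : Subgroup Γ) :
    ∑ᶠ x : FinGSet.coset A, wt R (MulAction.stabilizer Γ x) =
      (Nat.card Γ : R) • mk R (FinGSet.coset A) := by
  classical
  let x0 : FinGSet.coset A := ((1 : Γ) : Γ ⧸ A)
  have hA : MulAction.stabilizer Γ x0 = A := MulAction.stabilizer_quotient A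
  have hw : ∀ x : FinGSet.coset A, wt R (MulAction.stabilizer Γ x) = wt R A := by
    intro x
    obtain ⟨g, rfl⟩ := QuotientGroup.mk_surjective x
    have h := wt_stabilizer_smul R x0 g
    rw [hA] at h
    rw [← h]
    have h' : g • x0 = (QuotientGroup.mk g : Γ ⧸ A) := by
      change (QuotientGroup.mk (g * 1) : Γ ⧸ A) = _
      rw [mul_one]
    rw [h']
  have := Fintype.ofFinite (FinGSet.coset A)
  simp only [finsum_eq_sum_of_fintype, hw, Finset.sum_const, Finset.card_univ]
  unfold wt
  rw [← Nat.cast_smul_eq_nsmul R, smul_smul, ← Nat.cast_mul, ← Nat.card_eq_fintype_card]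
  congr 2
  exact (Subgroup.card_eq_card_quotient_mul_card_subgroup A).symm

/-- Decomposition of a `Γ`-set into orbits, as a sum over points. -/
theorem card_smul_mk (X : FinGSet Γ) :
    (Nat.card Γ : R) • mk R X = ∑ᶠ x : X, wt R (MulAction.stabilizer Γ x) := by
  classical
  induction hn : Nat.card X using Nat.strong_induction_on generalizing X with
  | _ n ih =>
    rcases isEmpty_or_nonempty X with hX | ⟨⟨x⟩⟩
    · rw [mk_of_isEmpty, smul_zero, finsum_of_isEmpty]
    · obtain ⟨e, he⟩ := FinGSet.iso_coset_sum_orbitCompl X x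
      have hlt : Nat.card (X.orbitCompl x) < n := by
        rw [← hn]
        exact Finite.card_subtype_lt (x := x) (by simp)
      have h1 := ih _ hlt (X.orbitCompl x) rfl
      rw [← mk_eq (FinGSet.iso_coset_sum_orbitCompl X x), mk_sum, smul_add, h1,
        ← finsum_wt_coset]
      have h2 : ∑ᶠ y : X, wt R (MulAction.stabilizer Γ y) =
          ∑ᶠ z : (FinGSet.coset (MulAction.stabilizer Γ x)).sum (X.orbitCompl x),
            wt R (MulAction.stabilizer Γ z) := by
        rw [← finsum_comp_equiv e]
        refine finsum_congr fun z => ?_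
        congr 1
        ext g
        rw [MulAction.mem_stabilizer_iff, MulAction.mem_stabilizer_iff, ← he,
          e.injective.eq_iff]
      rw [h2]
      have := Fintype.ofFinite (FinGSet.coset (MulAction.stabilizer Γ x))
      have := Fintype.ofFinite (X.orbitCompl x)
      let : Fintype ((FinGSet.coset (MulAction.stabilizer Γ x)).sum (X.orbitCompl x)) :=
        inferInstanceAs (Fintype (_ ⊕ _))
      simp only [finsum_eq_sum_of_fintype]
      refine Eq.trans ?_ (Fintype.sum_sum_type (α₁ := FinGSet.coset (MulAction.stabilizer Γ x))
        (α₂ := X.orbitCompl x) (fun z => wt R (MulAction.stabilizer Γ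
          (show (FinGSet.coset (MulAction.stabilizer Γ x)).sum (X.orbitCompl x) from z)))).symm
      congr 1
      · refine Finset.sum_congr rfl fun a _ => ?_
        congr 1
        ext g
        exact (FinGSet.inl_inj (X := FinGSet.coset (MulAction.stabilizer Γ x))
          (Y := X.orbitCompl x) (x := g • a) (x' := a)).symm
      · refine Finset.sum_congr rfl fun a _ => ?_
        congr 1
        ext g
        exact (FinGSet.inr_inj (X := FinGSet.coset (MulAction.stabilizer Γ x))
          (Y := X.orbitCompl x) (y := g • a) (y' := a)).symm

end RBurnside

/-! ### Products of `Γ`-sets with `G`-sets, and the vanishing property of `e_G^G`. -/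

namespace FinGSet

variable {Γ G : Type u} [Group Γ] [Group G]

/-- The `Γ`-set `X × U`, where `Γ` acts on the `G`-set `X` through `π : Γ →* G`. -/
def twist (π : Γ →* G) (X : FinGSet G) (U : FinGSet Γ) : FinGSet Γ where
  carrier := X × U
  act :=
    { smul := fun c x => (π c • x.1, c • x.2)
      one_smul := fun x => by
        change (π 1 • x.1, (1 : Γ) • x.2) = x
        simp
      mul_smul := fun c d x => by
        change (π (c * d) • x.1, (c * d) • x.2) = (π c • π d • x.1, c • d • x.2)
        simp [mul_smul] }

theorem smul_twist (π : Γ →* G) (X : FinGSet G) (U : FinGSet Γ) (c : Γ) (x : X) (y : U) :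
    c • (show twist π X U from (x, y)) = (show twist π X U from (π c • x, c • y)) := rfl

theorem stabilizer_twist (π : Γ →* G) (X : FinGSet G) (U : FinGSet Γ) (x : X) (y : U) :
    MulAction.stabilizer Γ (show twist π X U from (x, y)) =
      (MulAction.stabilizer G x).comap π ⊓ MulAction.stabilizer Γ y := by
  ext c
  rw [MulAction.mem_stabilizer_iff, smul_twist]
  exact Prod.ext_iff

theorem sum_mk_coset {M : Type*} [AddCommMonoid M] [Fintype G] (J : Subgroup G) [Fintype (G ⧸ J)]
    (f : G ⧸ J → M) : ∑ g : G, f g = Nat.card J • ∑ x, f x := by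
  classical
  rw [← Finset.sum_fiberwise Finset.univ (fun g : G => (g : G ⧸ J)), Finset.smul_sum]
  refine Finset.sum_congr rfl fun x _ => ?_
  rw [Finset.sum_congr rfl (g := fun _ => f x) (fun g hg => by simp at hg; rw [hg]),
    Finset.sum_const]
  congr 1
  have h := QuotientGroup.card_preimage_mk J {x}
  rw [show Nat.card ({x} : Set (G ⧸ J)) = 1 from Nat.card_unique, mul_one] at h
  rw [← h, Nat.card_eq_card_toFinset]
  congr 1
  ext g
  simp

end FinGSet

namespace RBurnside

variable (R : Type v) [CommRing R] {Γ G : Type u} [Group Γ] [Group G] [Finite Γ] [Finite G]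

open FinGSet

/-- The stabilizer of `(gJ, y)` is `π⁻¹(gJg⁻¹) ∩ Stab(y)`. Summing over elements `g` instead of
cosets costs the factor `|J|`, which is precisely the one occurring in `e_G^G`. -/
theorem card_smul_mk_twist (π : Γ →* G) (J : Subgroup G) (U : FinGSet Γ) [Fintype G] [Fintype U] :
    (Nat.card Γ : R) • (Nat.card J : R) • mk R (twist π (coset J) U) =
      ∑ y : U, ∑ g : G, wt R ((J.map (MulAut.conj g).toMonoidHom).comap π ⊓
        MulAction.stabilizer Γ y) := by
  classical
  have := Fintype.ofFinite (coset J)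
  let : Fintype (twist π (coset J) U) := inferInstanceAs (Fintype (_ × _))
  rw [smul_comm, card_smul_mk, finsum_eq_sum_of_fintype]
  have h : ∑ z : twist π (coset J) U, wt R (MulAction.stabilizer Γ z) =
      ∑ y : U, ∑ x : coset J, wt R ((MulAction.stabilizer G x).comap π ⊓
        MulAction.stabilizer Γ y) := by
    rw [Finset.sum_comm]
    refine (Fintype.sum_prod_type (γ := RBurnside R Γ) (α₁ := coset J) (α₂ := U)
      (fun z => wt R (MulAction.stabilizer Γ (show twist π (coset J) U from z)))).trans ?_
    simp only [stabilizer_twist]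
  rw [h, Finset.smul_sum]
  refine Finset.sum_congr rfl fun y _ => ?_
  have h2 := @sum_mk_coset _ _ _ _ _ J ‹_› (fun x : coset J => wt R ((MulAction.stabilizer G x).comap π ⊓
        MulAction.stabilizer Γ y))
  rw [Nat.cast_smul_eq_nsmul]
  refine h2.symm.trans ?_
  refine Finset.sum_congr rfl fun g _ => ?_
  congr 3
  have h3 := MulAction.stabilizer_smul_eq_stabilizer_map_conj g ((1 : G) : G ⧸ J)
  rw [MulAction.stabilizer_quotient] at h3
  have h4 : g • ((1 : G) : G ⧸ J) = (g : G ⧸ J) := by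
    change ((g * 1 : G) : G ⧸ J) = _
    rw [mul_one]
  rw [h4] at h3
  exact h3

open Classical in
-- Weisner's theorem in the subgroup lattice, with weights `μ(J, G)`: no `i ≤ K` equals `G`, so the
-- weights above `i` sum to zero.
theorem sum_moebius_smul_meet {M : Type*} [AddCommGroup M] [Module R M]
    [Fintype (Subgroup G)] {K : Subgroup G}
    (hK : K ≠ ⊤) (F : Subgroup G → M) :
    ∑ J : Subgroup G, (moebius J ⊤ : R) • F (J ⊓ K) = 0 := by
  refine sum_smul_meet_eq_zero (fun J => (moebius J ⊤ : R)) K (fun i hi => ?_) (fun J => J ⊓ K)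
    (fun i j => le_inf_iff) F
  have h := sum_moebius_left i ⊤
  rw [if_neg (by rintro rfl; exact hK (top_le_iff.1 hi))] at h
  have h2 := congrArg (Int.cast (R := R)) h
  rw [Int.cast_sum] at h2
  simpa [apply_ite] using h2

/-- The idempotent `e_G^G` kills the `Γ`-sets whose stabilizers have proper image in `G`. -/
theorem finsum_moebius_twist (hΓ : IsUnit (Nat.card Γ : R)) (π : Γ →* G) (U : FinGSet Γ)
    (hU : ∀ y : U, (MulAction.stabilizer Γ y).map π ≠ ⊤) :
    ∑ᶠ J : Subgroup G, ((Nat.card J : R) * (moebius J ⊤ : R)) • mk R (twist π (coset J) U) = 0 := by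
  classical
  have := Fintype.ofFinite G
  have := Fintype.ofFinite U
  have := Fintype.ofFinite (Subgroup G)
  rw [finsum_eq_sum_of_fintype]
  refine (hΓ.smul_left_cancel).1 ?_
  rw [smul_zero, Finset.smul_sum]
  have h1 : ∀ J : Subgroup G, (Nat.card Γ : R) • ((Nat.card J : R) * (moebius J ⊤ : R)) •
      mk R (twist π (coset J) U) = ∑ y : U, ∑ g : G, (moebius J ⊤ : R) •
        wt R ((J.map (MulAut.conj g).toMonoidHom).comap π ⊓ MulAction.stabilizer Γ y) := by
    intro J
    rw [mul_comm, mul_smul, smul_comm, card_smul_mk_twist, Finset.smul_sum]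
    simp only [Finset.smul_sum]
  simp only [h1]
  rw [Finset.sum_comm]
  refine Finset.sum_eq_zero fun y _ => ?_
  rw [Finset.sum_comm]
  refine Finset.sum_eq_zero fun g _ => ?_
  -- `π⁻¹(J) ∩ Stab(y)` depends only on the meet of `J` with the proper subgroup `π(Stab(y))`, as
  -- `h4` below records. Conjugation by `g` only permutes the subgroups `J` and preserves `μ(J, G)`.
  have h2 := sum_moebius_smul_meet R (hU y)
    (fun J => wt R (J.comap π ⊓ MulAction.stabilizer Γ y))
  rw [← h2]
  refine Fintype.sum_equiv (MulEquiv.mapSubgroup (MulAut.conj g)).toEquiv _ _ fun J => ?_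
  have h3 : moebius (MulEquiv.mapSubgroup (MulAut.conj g) J) ⊤ = moebius J ⊤ := by
    have h := moebius_orderIso (MulEquiv.mapSubgroup (MulAut.conj g)) J ⊤
    rwa [map_top] at h
  have h4 : ∀ J : Subgroup G, (J ⊓ (MulAction.stabilizer Γ y).map π).comap π ⊓
      MulAction.stabilizer Γ y = J.comap π ⊓ MulAction.stabilizer Γ y := by
    intro J
    ext c
    simp only [Subgroup.mem_inf, Subgroup.mem_comap]
    exact ⟨fun h => ⟨h.1.1, h.2⟩, fun h => ⟨⟨h.1, c, h.2, rfl⟩, h.2⟩⟩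
  rw [h4]
  change _ = (moebius (MulEquiv.mapSubgroup (MulAut.conj g) J) ⊤ : R) • _
  rw [h3]
  rfl

end RBurnside

/-! ### Composition with `X̃` as a twisted product. -/

namespace Biset

variable {G H K : Type u} [Group G] [Group H] [Group K]

/-- The homomorphism `(g, h) ↦ h⁻¹` through which `G × Hᵐᵒᵖ` acts on left `H`-sets. -/
def sndInv (G H : Type u) [Group G] [Group H] : G × Hᵐᵒᵖ →* H where
  toFun c := c.2.unop⁻¹
  map_one' := by simp
  map_mul' := by simp

theorem tilde_smul [Finite G] (X : FinGSet G) (c : G × Gᵐᵒᵖ) (g : G) (x : X) :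
    c • (show tilde X from (g, x)) = (show tilde X from (c.1 * g * c.2.unop, c.1 • x)) := rfl

/-- Moving `a` across the product sends `((a, x), u)` to `((1, x), au)`, so the classes correspond
to the pairs `(x, au)`. -/
theorem tilde_comp_iso [Finite G] (X : FinGSet G) (U : Biset G H) :
    (comp (tilde X) U).Iso (FinGSet.twist (MonoidHom.fst G Hᵐᵒᵖ) X U) := by
  refine FinGSet.Iso.of_surjective (X := (G × X) × U)
    (fun z => pair (show tilde X from z.1) z.2)
    (fun z => (show FinGSet.twist (MonoidHom.fst G Hᵐᵒᵖ) X U from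
      (z.1.2, (z.1.1, (1 : Hᵐᵒᵖ)) • z.2))) ?_ ?_ ?_
    (fun c z => ((c.1 * z.1.1, c.1 • z.1.2), ((1 : G), c.2) • z.2)) ?_ ?_
  · intro z
    obtain ⟨a, u, rfl⟩ := pair_surjective z
    exact ⟨(a, u), rfl⟩
  · rintro ⟨x, u⟩
    exact ⟨((1, x), u), Prod.ext rfl (one_smul _ u)⟩
  · rintro ⟨⟨a, x⟩, u⟩ ⟨⟨a', x'⟩, u'⟩
    rw [pair_eq_pair]
    refine Iff.trans ?_ Prod.ext_iff.symm
    constructor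
    · rintro ⟨h, h1, h2⟩
      obtain ⟨h1, h3⟩ := Prod.ext_iff.1 h1
      change a' = 1 * a * h at h1
      change x' = (1 : G) • x at h3
      change u' = _ at h2
      refine ⟨by simp [h3], ?_⟩
      change (a, (1 : Hᵐᵒᵖ)) • u = (a', (1 : Hᵐᵒᵖ)) • u'
      simp [h1, h2, smul_smul]
    · rintro ⟨h1, h2⟩
      change x = x' at h1
      change (a, (1 : Hᵐᵒᵖ)) • u = (a', (1 : Hᵐᵒᵖ)) • u' at h2
      refine ⟨a⁻¹ * a', Prod.ext ?_ ?_, ?_⟩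
      · change a' = 1 * a * (a⁻¹ * a')
        group
      · change x' = (1 : G) • x
        simp [h1]
      · change u' = _
        have := congrArg (fun z => (a'⁻¹, (1 : Hᵐᵒᵖ)) • z) h2
        simp only [smul_smul, Prod.mk_mul_mk, inv_mul_cancel, mul_one, ← Prod.one_eq_mk,
          one_smul] at this
        simp [← this]
  · rintro c ⟨⟨a, x⟩, u⟩
    rw [smul_pair, tilde_smul]
    simp
  · rintro ⟨c, d⟩ ⟨⟨a, x⟩, u⟩
    refine Prod.ext rfl ?_
    change (c * a, (1 : Hᵐᵒᵖ)) • ((1 : G), d) • u = (c, d) • (a, (1 : Hᵐᵒᵖ)) • u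
    simp [smul_smul]

/-- Here `(u, (a, x))` is equivalent to `(ua, (1, a⁻¹x))`; a right translation by `h` therefore acts
on the `X`-coordinate through `h⁻¹`, whence `sndInv`. -/
theorem comp_tilde_iso [Finite H] (U : Biset G H) (X : FinGSet H) :
    (comp U (tilde X)).Iso (FinGSet.twist (sndInv G H) X U) := by
  refine FinGSet.Iso.of_surjective (X := U × (H × X))
    (fun z => pair z.1 (show tilde X from z.2))
    (fun z => (show FinGSet.twist (sndInv G H) X U from
      (z.2.1⁻¹ • z.2.2, ((1 : G), op z.2.1) • z.1))) ?_ ?_ ?_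
    (fun c z => ((c.1, (1 : Hᵐᵒᵖ)) • z.1, (z.2.1 * c.2.unop, z.2.2))) ?_ ?_
  · intro z
    obtain ⟨u, a, rfl⟩ := pair_surjective z
    exact ⟨(u, a), rfl⟩
  · rintro ⟨x, u⟩
    exact ⟨(u, (1, x)), Prod.ext (by simp) (one_smul _ u)⟩
  · rintro ⟨u, ⟨a, x⟩⟩ ⟨u', ⟨a', x'⟩⟩
    rw [pair_eq_pair]
    refine Iff.trans ?_ Prod.ext_iff.symm
    constructor
    · rintro ⟨h, h2, h1⟩
      obtain ⟨h1, h3⟩ := Prod.ext_iff.1 h1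
      change a' = h⁻¹ * a * 1 at h1
      change x' = h⁻¹ • x at h3
      change u' = _ at h2
      refine ⟨?_, ?_⟩
      · change a⁻¹ • x = a'⁻¹ • x'
        simp [h3, h1, smul_smul]
      · change ((1 : G), op a) • u = ((1 : G), op a') • u'
        simp [h1, h2, smul_smul, ← op_mul]
    · rintro ⟨h1, h2⟩
      change a⁻¹ • x = a'⁻¹ • x' at h1
      change ((1 : G), op a) • u = ((1 : G), op a') • u' at h2
      refine ⟨a * a'⁻¹, ?_, Prod.ext ?_ ?_⟩
      · change u' = _
        have := congrArg (fun z => ((1 : G), op a'⁻¹) • z) h2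
        simp only [smul_smul, Prod.mk_mul_mk, ← op_mul, mul_inv_cancel, mul_one, op_one,
          ← Prod.one_eq_mk, one_smul] at this
        exact this.symm
      · change a' = (a * a'⁻¹)⁻¹ * a * 1
        group
      · change x' = (a * a'⁻¹)⁻¹ • x
        rw [mul_inv_rev, inv_inv, mul_smul, h1, smul_inv_smul]
  · rintro c ⟨u, ⟨a, x⟩⟩
    rw [smul_pair, tilde_smul]
    simp
  · rintro ⟨c, d⟩ ⟨u, ⟨a, x⟩⟩
    refine Prod.ext ?_ ?_
    · change (a * d.unop)⁻¹ • x = d.unop⁻¹ • a⁻¹ • x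
      simp [mul_smul]
    · change ((1 : G), op (a * d.unop)) • (c, (1 : Hᵐᵒᵖ)) • u = (c, d) • ((1 : G), op a) • u
      simp [smul_smul]

end Biset

instance MulOpposite.finite_mulOpposite {α : Type*} [Finite α] : Finite αᵐᵒᵖ :=
  Finite.of_equiv _ MulOpposite.opEquiv

/-! ### The idempotent `ẽ_G^G`. -/

section Tilde

variable (R : Type v) [CommRing R] {G H K : Type u} [Group G] [Group H] [Group K]
  [Finite G] [Finite H] [Finite K]

variable (G) in
/-- The element `ẽ_G^G` of `R B(G, G)`. -/
def idemETilde : RB R G G := RB.tilde R G (idemE R ⊤)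

theorem idemE_top : idemE R (⊤ : Subgroup G) = Ring.inverse (Nat.card G : R) •
    ∑ᶠ K : Subgroup G, ((Nat.card K : R) * (moebius K ⊤ : R)) •
      RBurnside.mk R (FinGSet.coset K) := by
  unfold idemE
  have h1 : Nat.card (Subgroup.normalizer ((⊤ : Subgroup G) : Set G)) = Nat.card G := by
    rw [Subgroup.normalizer_eq_top_iff.2 inferInstance, Subgroup.card_top]
  rw [h1]
  congr 1
  exact finsum_comp_equiv (Equiv.subtypeUnivEquiv (fun K : Subgroup G => le_top))
    (f := fun K : Subgroup G => ((Nat.card K : R) * (moebius K ⊤ : R)) •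
      RBurnside.mk R (FinGSet.coset K))

theorem LinearMap.map_finsum_of_finite {ι M N : Type*} [Finite ι] [AddCommGroup M] [Module R M]
    [AddCommGroup N] [Module R N] (f : M →ₗ[R] N) (a : ι → M) :
    f (∑ᶠ i, a i) = ∑ᶠ i, f (a i) :=
  map_finsum (f : M →+ N) (Set.toFinite _)

theorem idemETilde_eq : idemETilde R G = Ring.inverse (Nat.card G : R) •
    ∑ᶠ K : Subgroup G, ((Nat.card K : R) * (moebius K ⊤ : R)) •
      RBurnside.mk R (Biset.tilde (FinGSet.coset K)) := by
  rw [idemETilde, idemE_top, map_smul, LinearMap.map_finsum_of_finite]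
  simp only [map_smul, RB.tilde_mk]

theorem idemETilde_comp (U : Biset G H) : RB.comp (idemETilde R G) (RBurnside.mk R U) =
    Ring.inverse (Nat.card G : R) •
    ∑ᶠ K : Subgroup G, ((Nat.card K : R) * (moebius K ⊤ : R)) •
      RBurnside.mk R (FinGSet.twist (MonoidHom.fst G Hᵐᵒᵖ) (FinGSet.coset K) U) := by
  rw [idemETilde_eq, map_smul, LinearMap.smul_apply, LinearMap.map_finsum_of_finite,
    ← LinearMap.applyₗ_apply_apply (RBurnside.mk R U), LinearMap.map_finsum_of_finite]
  simp only [map_smul, LinearMap.applyₗ_apply_apply, RB.comp_mk,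
    RBurnside.mk_eq (Biset.tilde_comp_iso _ U)]

theorem comp_idemETilde (U : Biset G H) : RB.comp (RBurnside.mk R U) (idemETilde R H) =
    Ring.inverse (Nat.card H : R) •
    ∑ᶠ K : Subgroup H, ((Nat.card K : R) * (moebius K ⊤ : R)) •
      RBurnside.mk R (FinGSet.twist (Biset.sndInv G H) (FinGSet.coset K) U) := by
  rw [idemETilde_eq, map_smul, LinearMap.map_finsum_of_finite]
  simp only [map_smul, RB.comp_mk, RBurnside.mk_eq (Biset.comp_tilde_iso U _)]

variable {R}

theorem isUnit_card_biset (hG : IsUnit (Nat.card G : R)) (hH : IsUnit (Nat.card H : R)) :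
    IsUnit (Nat.card (G × Hᵐᵒᵖ) : R) := by
  rw [Nat.card_prod, Nat.card_congr (MulOpposite.opEquiv (α := H)).symm, Nat.cast_mul]
  exact hG.mul hH

theorem idemETilde_comp_eq_zero (hG : IsUnit (Nat.card G : R)) (hH : IsUnit (Nat.card H : R))
    (U : Biset G H)
    (hU : ∀ y : U, (MulAction.stabilizer (G × Hᵐᵒᵖ) y).map (MonoidHom.fst G Hᵐᵒᵖ) ≠ ⊤) :
    RB.comp (idemETilde R G) (RBurnside.mk R U) = 0 := by
  rw [idemETilde_comp, RBurnside.finsum_moebius_twist R (isUnit_card_biset hG hH) _ U hU,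
    smul_zero]

theorem comp_idemETilde_eq_zero (hG : IsUnit (Nat.card G : R)) (hH : IsUnit (Nat.card H : R))
    (U : Biset G H)
    (hU : ∀ y : U, (MulAction.stabilizer (G × Hᵐᵒᵖ) y).map (Biset.sndInv G H) ≠ ⊤) :
    RB.comp (RBurnside.mk R U) (idemETilde R H) = 0 := by
  rw [comp_idemETilde, RBurnside.finsum_moebius_twist R (isUnit_card_biset hG hH) _ U hU,
    smul_zero]

theorem tilde_top_iso : (Biset.tilde (FinGSet.coset (⊤ : Subgroup G))).Iso (Biset.id G) := by
  have : Subsingleton (FinGSet.coset (⊤ : Subgroup G)) :=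
    QuotientGroup.subsingleton_quotient_top
  have : Nonempty (FinGSet.coset (⊤ : Subgroup G)) := ⟨((1 : G) : G ⧸ (⊤ : Subgroup G))⟩
  exact ⟨@Equiv.prodUnique _ _ ⟨⟨Classical.arbitrary (FinGSet.coset (⊤ : Subgroup G))⟩,
    fun _ => Subsingleton.elim _ _⟩, fun _ _ => rfl⟩

/-- In the expansion of the right-hand factor, the term of a proper subgroup `K` is killed by the
left-hand factor, because the stabilizers in `G × G/K` project into conjugates of `K`. The term `K =
G` is the identity with coefficient `|G|⁻¹ |G| = 1`. -/
theorem idemETilde_idem (hG : IsUnit (Nat.card G : R)) :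
    RB.comp (idemETilde R G) (idemETilde R G) = idemETilde R G := by
  nth_rewrite 2 [idemETilde_eq]
  rw [map_smul, LinearMap.map_finsum_of_finite, finsum_eq_single _ (⊤ : Subgroup G)]
  · rw [map_smul, RBurnside.mk_eq tilde_top_iso, moebius_self, Int.cast_one, mul_one,
      Subgroup.card_top, smul_smul, Ring.inverse_mul_cancel _ hG, one_smul]
    exact RB.comp_id _
  · intro K hK
    rw [map_smul, idemETilde_comp_eq_zero hG hG, smul_zero]
    rintro ⟨g, x⟩ h
    refine hK ?_
    obtain ⟨y, rfl⟩ := QuotientGroup.mk_surjective x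
    rw [eq_top_iff]
    intro a _
    have ha : y * a * y⁻¹ ∈ (⊤ : Subgroup G) := trivial
    rw [← h] at ha
    obtain ⟨⟨b, c⟩, hb, hb'⟩ := ha
    change b = _ at hb'
    have h2 : b • ((y : G) : G ⧸ K) = y := (Prod.ext_iff.1 hb).2
    have h3 : ((b * y : G) : G ⧸ K) = y := h2
    rw [eq_comm, QuotientGroup.eq] at h3
    simpa [hb', mul_assoc] using h3

end Tilde

/-! ### Transitive bisets and composition of subgroups. -/

namespace Biset

variable {G H K : Type u} [Group G] [Group H] [Group K] [Finite G] [Finite H] [Finite K]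

/-- The coset of `x` as an element of the biset `(G × H) / L`. -/
def cosetMk (L : Subgroup (G × H)) (x : G × H) : coset L := (x : (G × H) ⧸ L)

theorem cosetMk_surjective (L : Subgroup (G × H)) : Function.Surjective (cosetMk L) :=
  QuotientGroup.mk_surjective

theorem cosetMk_eq {L : Subgroup (G × H)} {x y : G × H} :
    cosetMk L x = cosetMk L y ↔ x⁻¹ * y ∈ L := QuotientGroup.eq

theorem smul_cosetMk (L : Subgroup (G × H)) (c : G × Hᵐᵒᵖ) (x : G × H) :
    c • cosetMk L x = cosetMk L (c.1 * x.1, c.2.unop⁻¹ * x.2) := rfl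

/-- A transitive biset is determined by the stabilizer of a point. -/
theorem iso_coset {U : Biset G H} (y : U) (hy : ∀ z : U, ∃ c : G × Hᵐᵒᵖ, c • y = z)
    (L : Subgroup (G × H)) (hL : ∀ g h, (g, op h⁻¹) • y = y ↔ (g, h) ∈ L) :
    U.Iso (coset L) := by
  refine FinGSet.Iso.of_surjective (X := G × H) (fun x => (x.1, op x.2⁻¹) • y)
    (cosetMk L) ?_ (cosetMk_surjective L) ?_
    (fun c x => (c.1 * x.1, c.2.unop⁻¹ * x.2)) ?_ ?_
  · intro z
    obtain ⟨c, rfl⟩ := hy z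
    exact ⟨(c.1, c.2.unop⁻¹), by simp⟩
  · rintro ⟨a, b⟩ ⟨c, d⟩
    refine Iff.trans ?_ cosetMk_eq.symm
    rw [Prod.inv_mk, Prod.mk_mul_mk, ← hL, eq_comm, ← inv_smul_eq_iff, smul_smul]
    simp
  · intro c x
    rw [smul_smul, mul_inv_rev, inv_inv]
    rfl
  · intro c x
    rfl

/-- The composition of subgroups of `G × H` and `H × K`, viewed as relations. -/
def star (L : Subgroup (G × H)) (L' : Subgroup (H × K)) : Subgroup (G × K) where
  carrier := {x | ∃ h, (x.1, h) ∈ L ∧ (h, x.2) ∈ L'}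
  one_mem' := ⟨1, one_mem _, one_mem _⟩
  mul_mem' := by
    rintro x y ⟨h, h1, h2⟩ ⟨k, h3, h4⟩
    exact ⟨h * k, mul_mem h1 h3, mul_mem h2 h4⟩
  inv_mem' := by
    rintro x ⟨h, h1, h2⟩
    exact ⟨h⁻¹, inv_mem h1, inv_mem h2⟩

theorem mem_star {L : Subgroup (G × H)} {L' : Subgroup (H × K)} {x : G × K} :
    x ∈ star L L' ↔ ∃ h, (x.1, h) ∈ L ∧ (h, x.2) ∈ L' := Iff.rfl

/-- The one-term case of the Mackey formula: `hL` says that `H` is the product of the projections of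
`L` and `L'`, so there is a single double coset and the composite is transitive. The stabilizer of
the class of `(1, 1)` is the composed relation. -/
theorem coset_comp_coset (L : Subgroup (G × H)) (L' : Subgroup (H × K))
    (hL : ∀ h : H, ∃ g a b k, (g, a) ∈ L ∧ (b, k) ∈ L' ∧ h = a * b) :
    (comp (coset L) (coset L')).Iso (coset (star L L')) := by
  have key : ∀ (g : G) (h h' : H) (k : K) (x : G) (y : K),
      pair (cosetMk L (g, h)) (cosetMk L' (h', k)) =
        (x, op y⁻¹) • pair (cosetMk L 1) (cosetMk L' 1) ↔
      ∃ z, (g⁻¹ * x, h⁻¹ * z) ∈ L ∧ (h'⁻¹ * z, k⁻¹ * y) ∈ L' := by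
    intro g h h' k x y
    rw [smul_pair, pair_eq_pair]
    simp only [smul_cosetMk, cosetMk_eq]
    constructor
    · rintro ⟨z, h1, h2⟩
      refine ⟨z, ?_, ?_⟩
      · simpa using inv_mem h1
      · simpa using inv_mem h2
    · rintro ⟨z, h1, h2⟩
      refine ⟨z, ?_, ?_⟩
      · simpa using inv_mem h1
      · simpa using inv_mem h2
  refine iso_coset (pair (cosetMk L 1) (cosetMk L' 1)) ?_ _ ?_
  · intro z
    obtain ⟨u, w, rfl⟩ := pair_surjective z
    obtain ⟨⟨g, h⟩, rfl⟩ := cosetMk_surjective _ u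
    obtain ⟨⟨h', k⟩, rfl⟩ := cosetMk_surjective _ w
    obtain ⟨g1, a, b, k1, h1, h2, h3⟩ := hL (h⁻¹ * h')
    refine ⟨(g * g1, op (k * k1⁻¹)⁻¹), Eq.symm ((key g h h' k _ _).2 ⟨h * a, ?_, ?_⟩)⟩
    · simpa using h1
    · have h4 : h' = h * (a * b) := by rw [← h3]; group
      have h5 : h'⁻¹ * (h * a) = b⁻¹ := by rw [h4]; group
      rw [h5]
      simpa using inv_mem h2
  · intro g k
    rw [eq_comm]
    refine (key 1 1 1 1 g k).trans ?_
    simp [mem_star]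

theorem id_iso_coset : (Biset.id G).Iso (coset (deltaSubgroup (⊥ : Subgroup G))) := by
  refine iso_coset (show Biset.id G from (1 : G)) (fun z => ⟨(z, 1), ?_⟩) _ fun g h => ?_
  · rw [id_smul]
    change (show G from z) * 1 * 1 = z
    rw [mul_one, mul_one]
  · rw [id_smul]
    change g * 1 * h⁻¹ = 1 ↔ g * h⁻¹ ∈ (⊥ : Subgroup G)
    simp

theorem mem_deltaSubgroup {N : Subgroup G} [N.Normal] {x : G × G} :
    x ∈ deltaSubgroup N ↔ x.1 * x.2⁻¹ ∈ N := Iff.rfl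

theorem star_delta_left (N : Subgroup G) [N.Normal] (L : Subgroup (G × H))
    (hN : ∀ n ∈ N, (n, (1 : H)) ∈ L) : star (deltaSubgroup N) L = L := by
  ext ⟨g, h⟩
  rw [mem_star]
  constructor
  · rintro ⟨a, h1, h2⟩
    have := mul_mem (hN _ h1) h2
    simpa using this
  · intro h1
    exact ⟨g, by simp [mem_deltaSubgroup], h1⟩

theorem star_delta_right (N : Subgroup H) [N.Normal] (L : Subgroup (G × H))
    (hN : ∀ n ∈ N, ((1 : G), n) ∈ L) : star L (deltaSubgroup N) = L := by
  ext ⟨g, h⟩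
  rw [mem_star]
  constructor
  · rintro ⟨a, h1, h2⟩
    have := mul_mem (hN _ (inv_mem h2)) h1
    simpa using this
  · intro h1
    exact ⟨h, h1, by simp [mem_deltaSubgroup]⟩

theorem star_delta_delta (M N : Subgroup G) [M.Normal] [N.Normal] :
    star (deltaSubgroup M) (deltaSubgroup N) = deltaSubgroup (M ⊔ N) := by
  ext ⟨a, b⟩
  rw [mem_star]
  simp only [mem_deltaSubgroup]
  constructor
  · rintro ⟨c, h1, h2⟩
    have := mul_mem (Subgroup.mem_sup_left (T := N) h1) (Subgroup.mem_sup_right (S := M) h2)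
    simpa using this
  · intro h
    obtain ⟨m, hm, n, hn, h⟩ := Subgroup.mem_sup_of_normal_right.1 h
    refine ⟨m⁻¹ * a, by simpa using hm, ?_⟩
    have : m⁻¹ * a * b⁻¹ = n := by rw [mul_assoc, ← h]; group
    rwa [this]

theorem delta_comp_coset (N : Subgroup G) [N.Normal] (L : Subgroup (G × H)) :
    (comp (coset (deltaSubgroup N)) (coset L)).Iso (coset (star (deltaSubgroup N) L)) :=
  coset_comp_coset _ _ fun h => ⟨h, h, 1, 1, by simp [mem_deltaSubgroup], one_mem _, by simp⟩

theorem coset_comp_delta (N : Subgroup H) [N.Normal] (L : Subgroup (G × H)) :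
    (comp (coset L) (coset (deltaSubgroup N))).Iso (coset (star L (deltaSubgroup N))) :=
  coset_comp_coset _ _ fun h => ⟨1, 1, h, h, one_mem _, by simp [mem_deltaSubgroup], by simp⟩

theorem twist_fst_delta_iso (M : Subgroup G) [M.Normal] (J : Subgroup G) :
    (FinGSet.twist (MonoidHom.fst G Gᵐᵒᵖ) (FinGSet.coset J) (coset (deltaSubgroup M))).Iso
      (coset (deltaSubgroup M ⊓ J.prod ⊤)) := by
  refine iso_coset (show FinGSet.twist _ _ _ from
    (((1 : G) : G ⧸ J), ((1 : G × G) : (G × G) ⧸ deltaSubgroup M))) ?_ _ ?_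
  · rintro ⟨x, y⟩
    obtain ⟨x, rfl⟩ := QuotientGroup.mk_surjective x
    obtain ⟨⟨a, b⟩, rfl⟩ := QuotientGroup.mk_surjective y
    refine ⟨(x, op (b * a⁻¹ * x)⁻¹), Prod.ext ?_ ?_⟩
    · change ((x * 1 : G) : G ⧸ J) = x
      simp
    · refine QuotientGroup.eq.2 ?_
      change _ ∈ M
      simp [mul_assoc]
  · intro g h
    refine Iff.trans Prod.ext_iff ?_
    have h1 : ((g * 1 : G) : G ⧸ J) = (1 : G) ↔ g ∈ J := by
      rw [eq_comm, QuotientGroup.eq]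
      simp
    have h2 : (((g * 1, h⁻¹⁻¹ * 1) : G × G) : (G × G) ⧸ deltaSubgroup M) = (1 : G × G) ↔
        g * h⁻¹ ∈ M := by
      rw [eq_comm, QuotientGroup.eq, mem_deltaSubgroup]
      simp
    refine (and_congr h1 h2).trans ?_
    simp [Subgroup.mem_prod, mem_deltaSubgroup, and_comm]

/-- The base point imposes `h ∈ J` where `twist_fst_delta_iso` has `g ∈ J`. The two conditions agree
when `gh⁻¹ ∈ M ≤ J`; this is what lets `ẽ_G^G` pass across `Δ_M(G)`. -/
theorem twist_sndInv_delta_iso (M : Subgroup G) [M.Normal] (J : Subgroup G) (hM : M ≤ J) :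
    (FinGSet.twist (sndInv G G) (FinGSet.coset J) (coset (deltaSubgroup M))).Iso
      (coset (deltaSubgroup M ⊓ J.prod ⊤)) := by
  refine iso_coset (show FinGSet.twist _ _ _ from
    (((1 : G) : G ⧸ J), ((1 : G × G) : (G × G) ⧸ deltaSubgroup M))) ?_ _ ?_
  · rintro ⟨x, y⟩
    obtain ⟨x, rfl⟩ := QuotientGroup.mk_surjective x
    obtain ⟨⟨a, b⟩, rfl⟩ := QuotientGroup.mk_surjective y
    refine ⟨(a * b⁻¹ * x, op x⁻¹), Prod.ext ?_ ?_⟩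
    · change ((x⁻¹⁻¹ * 1 : G) : G ⧸ J) = x
      simp
    · refine QuotientGroup.eq.2 ?_
      change _ ∈ M
      simp [mul_assoc]
  · intro g h
    refine Iff.trans Prod.ext_iff ?_
    have h1 : ((h⁻¹⁻¹ * 1 : G) : G ⧸ J) = (1 : G) ↔ h ∈ J := by
      rw [eq_comm, QuotientGroup.eq]
      simp
    have h2 : (((g * 1, h⁻¹⁻¹ * 1) : G × G) : (G × G) ⧸ deltaSubgroup M) = (1 : G × G) ↔
        g * h⁻¹ ∈ M := by
      rw [eq_comm, QuotientGroup.eq, mem_deltaSubgroup]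
      simp
    refine (and_congr h1 h2).trans ?_
    simp only [Subgroup.mem_inf, Subgroup.mem_prod, mem_deltaSubgroup, Subgroup.mem_top, and_true]
    rw [and_comm]
    refine and_congr_right fun h3 => ?_
    rw [← Subgroup.mul_mem_cancel_left J (hM h3)]
    simp

end Biset

/-! ### The Möbius function of the subgroup lattice and the Frattini subgroup. -/

section Frattini

variable {G : Type u} [Group G] [Finite G]

/-- If `Φ(G)` is not contained in `K`, then `K` and `KΦ(G)` are both proper, since `Φ(G)` consists
of non-generators. The Möbius relations above `K` and above `KΦ(G)` differ by the terms of those `J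
≥ K` that do not contain `Φ(G)`; downward induction removes all of these but `J = K`. -/
theorem frattini_le_of_moebius_ne_zero {K : Subgroup G} (hK : moebius K ⊤ ≠ 0) :
    frattini G ≤ K := by
  classical
  have := Fintype.ofFinite (Subgroup G)
  by_contra h
  revert hK h
  induction K using WellFoundedGT.induction with
  | ind K ih =>
    intro hK h
    have hK1 : K ≠ ⊤ := by
      rintro rfl
      exact h le_top
    have hK2 : K ⊔ frattini G ≠ ⊤ := fun h => hK1 (frattini_nongenerating h)
    have h1 := sum_moebius_left K ⊤
    have h2 := sum_moebius_left (K ⊔ frattini G) ⊤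
    rw [if_neg hK1] at h1
    rw [if_neg hK2] at h2
    replace h1 := h1.trans h2.symm
    rw [← sub_eq_zero, ← Finset.sum_sub_distrib, Finset.sum_eq_single K] at h1
    · refine hK ?_
      rw [if_pos le_rfl, if_neg (fun h3 => h (le_sup_right.trans h3)), sub_zero] at h1
      exact h1
    · intro J _ hJ
      by_cases hKJ : K ≤ J
      · by_cases hJ2 : frattini G ≤ J
        · rw [if_pos hKJ, if_pos (sup_le hKJ hJ2), sub_self]
        · have : moebius J ⊤ = 0 := by
            by_contra h3
            exact ih J (lt_of_le_of_ne hKJ hJ.symm) h3 hJ2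
          simp [this]
      · rw [if_neg hKJ, if_neg (fun h3 => hKJ (le_sup_left.trans h3)), sub_self]
    · simp

end Frattini

/-! ### The elements `Y_{Δ_M(G)}` and the idempotent `φ_1^G`. -/

section Y

variable {R : Type v} [CommRing R] {G H : Type u} [Group G] [Group H] [Finite G] [Finite H]

theorem idemETilde_comp_delta (M : Subgroup G) [M.Normal] :
    RB.comp (idemETilde R G) (RBurnside.mk R (Biset.coset (deltaSubgroup M))) =
      Ring.inverse (Nat.card G : R) • ∑ᶠ K : Subgroup G, ((Nat.card K : R) * (moebius K ⊤ : R)) •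
        RBurnside.mk R (Biset.coset (deltaSubgroup M ⊓ K.prod ⊤)) := by
  rw [idemETilde_comp]
  simp only [RBurnside.mk_eq (Biset.twist_fst_delta_iso M _)]

/-- Only subgroups `K ≥ Φ(G) ≥ M` occur in `e_G^G` with nonzero coefficient, and for these the left
and the right products yield the same biset. -/
theorem delta_comp_idemETilde (M : Subgroup G) [M.Normal] (hM : M ≤ frattini G) :
    RB.comp (RBurnside.mk R (Biset.coset (deltaSubgroup M))) (idemETilde R G) =
      RB.comp (idemETilde R G) (RBurnside.mk R (Biset.coset (deltaSubgroup M))) := by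
  rw [comp_idemETilde, idemETilde_comp_delta]
  congr 1
  refine finsum_congr fun K => ?_
  by_cases hK : moebius K ⊤ = 0
  · simp [hK]
  · rw [RBurnside.mk_eq (Biset.twist_sndInv_delta_iso M _
      (hM.trans (frattini_le_of_moebius_ne_zero hK)))]

theorem RB.comp_finsum {ι : Type*} [Finite ι] {K : Type u} [Group K] (a : RB R G H)
    (b : ι → RB R H K) : RB.comp a (∑ᶠ i, b i) = ∑ᶠ i, RB.comp a (b i) :=
  LinearMap.map_finsum_of_finite R _ _

theorem RB.finsum_comp {ι : Type*} [Finite ι] {K : Type u} [Group K] (a : ι → RB R G H)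
    (b : RB R H K) : RB.comp (∑ᶠ i, a i) b = ∑ᶠ i, RB.comp (a i) b :=
  LinearMap.map_finsum_of_finite R (RB.comp.flip b) _

variable (hG : IsUnit (Nat.card G : R))
include hG

theorem elemY_delta (M : Subgroup G) [M.Normal] (hM : M ≤ frattini G) :
    elemY R (deltaSubgroup M) =
      RB.comp (idemETilde R G) (RBurnside.mk R (Biset.coset (deltaSubgroup M))) := by
  unfold elemY
  rw [RB.comp_assoc]
  change RB.comp (idemETilde R G) (RB.comp _ (idemETilde R G)) = _
  rw [delta_comp_idemETilde M hM, ← RB.comp_assoc, idemETilde_idem hG]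

theorem elemY_comp_elemY (M N : Subgroup G) [M.Normal] [N.Normal] (hM : M ≤ frattini G)
    (hN : N ≤ frattini G) : RB.comp (elemY R (deltaSubgroup M)) (elemY R (deltaSubgroup N)) =
      elemY R (deltaSubgroup (M ⊔ N)) := by
  rw [elemY_delta hG M hM, elemY_delta hG N hN, elemY_delta hG _ (sup_le hM hN),
    ← delta_comp_idemETilde M hM, RB.comp_assoc, ← RB.comp_assoc (idemETilde R G),
    idemETilde_idem hG, ← RB.comp_assoc, delta_comp_idemETilde M hM, RB.comp_assoc, RB.comp_mk,
    RBurnside.mk_eq (Biset.delta_comp_coset M _), Biset.star_delta_delta]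

theorem elemY_bot : elemY R (deltaSubgroup (⊥ : Subgroup G)) = idemETilde R G := by
  rw [elemY_delta hG _ bot_le, ← RBurnside.mk_eq Biset.id_iso_coset]
  exact RB.comp_id _

omit hG in
theorem elemY_congr {M N : Subgroup G} [M.Normal] [N.Normal] (h : M = N) :
    elemY R (deltaSubgroup M) = elemY R (deltaSubgroup N) := by
  subst h
  rfl

/-- By `Y_M Y_N = Y_{MN}` the product is `∑ μ_⊴(1,M) Y_{MN}`, which vanishes by Weisner's theorem
for joins. The theorem is stated for meets, so it is applied to the order dual of the poset of
normal subgroups contained in `Φ(G)`. -/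
theorem idemPhiOne_comp_elemY (N : Subgroup G) [N.Normal] (hN : N ≤ frattini G) (hN1 : N ≠ ⊥) :
    RB.comp (idemPhiOne R G) (elemY R (deltaSubgroup N)) = 0 := by
  classical
  let b : NormalSubgroup G := ⟨⊥, inferInstance⟩
  let α := {M : NormalSubgroup G // b ≤ M ∧ M.1 ≤ frattini G}
  have := Fintype.ofFinite (NormalSubgroup G)
  let : Fintype α := Fintype.ofFinite α
  let : Fintype αᵒᵈ := Fintype.ofFinite αᵒᵈ
  let c : α → α := fun M => ⟨⟨M.1.1 ⊔ N, inferInstance⟩,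
    (bot_le : (⊥ : Subgroup G) ≤ _), sup_le M.2.2 hN⟩
  let k : α := ⟨⟨N, inferInstance⟩, (bot_le : (⊥ : Subgroup G) ≤ _), hN⟩
  have h := sum_smul_meet_eq_zero (α := αᵒᵈ) (R := R) (fun M => (moebius b M.ofDual.1 : R))
    (OrderDual.toDual k) (fun i hi => ?_) (fun j => OrderDual.toDual (c j.ofDual)) (fun i j => ?_)
    (fun M => elemY R (deltaSubgroup M.ofDual.1.1))
  · rw [← h]
    unfold idemPhiOne idemPhi
    rw [RB.finsum_comp, ← finsum_eq_sum_of_fintype]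
    refine finsum_congr (α := αᵒᵈ) fun M => ?_
    rw [map_smul, LinearMap.smul_apply, elemY_comp_elemY hG _ _ M.2.2 hN]
    rfl
  · have h1 := sum_moebius_right b i.ofDual.1
    have hbi : b ≠ i.ofDual.1 := by
      intro hb
      have h2 : k.1.1 ≤ i.ofDual.1.1 := hi
      rw [← hb] at h2
      exact hN1 (le_bot_iff.1 h2)
    rw [if_neg hbi] at h1
    have h2 := congrArg (Int.cast (R := R)) h1
    rw [Int.cast_sum, Int.cast_zero] at h2
    refine Eq.trans ?_ h2
    -- A normal subgroup below `i ≤ Φ(G)` automatically lies in `Φ(G)`, so the Möbius relation among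
    -- all normal subgroups may be used.
    have h3 : ∑ j : α, (if j.1 ≤ i.ofDual.1 then (moebius b j.1 : R) else 0) =
        ∑ M : NormalSubgroup G, ((if M ≤ i.ofDual.1 then moebius b M else 0 : ℤ) : R) := by
      rw [← Finset.sum_subset (Finset.subset_univ
        (Finset.univ.filter fun M : NormalSubgroup G => b ≤ M ∧ M.1 ≤ frattini G))]
      · refine (Finset.sum_subtype (p := fun M : NormalSubgroup G => b ≤ M ∧ M.1 ≤ frattini G)
          (Finset.univ.filter fun M : NormalSubgroup G => b ≤ M ∧ M.1 ≤ frattini G)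
          (by simp) (fun M => if M ≤ i.ofDual.1 then (moebius b M : R) else 0)).symm.trans ?_
        refine Finset.sum_congr rfl fun M _ => ?_
        split_ifs <;> simp
      · intro M _ hM
        rw [if_neg, Int.cast_zero]
        intro hMi
        refine hM ?_
        simp only [Finset.mem_filter, Finset.mem_univ, true_and]
        exact ⟨(bot_le : (⊥ : Subgroup G) ≤ M.1), le_trans (show M.1 ≤ _ from hMi) i.ofDual.2.2⟩
    refine Eq.trans ?_ h3
    rw [← finsum_eq_sum_of_fintype, ← finsum_eq_sum_of_fintype]
    refine finsum_congr (α := α) fun M => ?_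
    rfl
  · change (j.ofDual.1.1 ⊔ N ≤ i.ofDual.1.1) ↔ _
    rw [sup_le_iff]
    rfl

theorem elemY_comp_idemPhiOne' (N : Subgroup G) [N.Normal] (hN : N ≤ frattini G) :
    RB.comp (elemY R (deltaSubgroup N)) (idemPhiOne R G) =
      RB.comp (idemPhiOne R G) (elemY R (deltaSubgroup N)) := by
  unfold idemPhiOne idemPhi
  rw [RB.finsum_comp, RB.comp_finsum]
  refine finsum_congr fun M => ?_
  rw [map_smul, map_smul, LinearMap.smul_apply, elemY_comp_elemY hG _ _ M.2.2 hN,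
    elemY_comp_elemY hG _ _ hN M.2.2]
  congr 1
  exact elemY_congr (sup_comm _ _)

theorem idemPhiOne_comp_idemETilde : RB.comp (idemPhiOne R G) (idemETilde R G) =
    idemPhiOne R G := by
  rw [← elemY_bot hG]
  unfold idemPhiOne idemPhi
  rw [RB.finsum_comp]
  refine finsum_congr fun M => ?_
  rw [map_smul, LinearMap.smul_apply, elemY_comp_elemY hG _ _ M.2.2 bot_le]
  congr 1
  exact elemY_congr (sup_bot_eq _)

theorem idemETilde_comp_idemPhiOne : RB.comp (idemETilde R G) (idemPhiOne R G) =
    idemPhiOne R G := by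
  nth_rewrite 2 [← idemPhiOne_comp_idemETilde hG]
  rw [← elemY_bot hG, elemY_comp_idemPhiOne' hG _ bot_le]

/-- `φ_1^G` is an idempotent. -/
theorem idemPhiOne_idem : RB.comp (idemPhiOne R G) (idemPhiOne R G) = idemPhiOne R G := by
  nth_rewrite 2 [idemPhiOne]
  unfold idemPhi
  -- In the second factor every `Y_{Δ_M(G)}` with `M ≠ 1` is killed by `φ_1^G`; the term `M = 1` is
  -- `ẽ_G^G`, which acts as the identity on `φ_1^G`.
  rw [LinearMap.map_finsum_of_finite, finsum_eq_single _ ⟨⟨⊥, inferInstance⟩, le_rfl, bot_le⟩]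
  · rw [map_smul, elemY_bot hG, idemPhiOne_comp_idemETilde hG, moebius_self, Int.cast_one,
      one_smul]
  · intro M hM
    rw [map_smul, idemPhiOne_comp_elemY hG _ M.2.2, smul_zero]
    intro h
    exact hM (Subtype.ext (Subtype.ext h))

/-- If `L` does not project onto `G`, then `ẽ_G^G` kills the biset. If it does, `N = {g ∈ Φ(G) :
(g,1) ∈ L}` is normal in `G` and `Δ_N(G)` is absorbed by `L`; hence a factor `φ_1^G Y_{Δ_N(G)}` can
be split off, and it vanishes unless `N = 1`. -/
theorem idemPhiOne_comp_coset_ne_zero (hH : IsUnit (Nat.card H : R)) {L : Subgroup (G × H)}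
    (h : RB.comp (idemPhiOne R G) (RBurnside.mk R (Biset.coset L)) ≠ 0) :
    (∀ g, ∃ h, (g, h) ∈ L) ∧ ∀ g ∈ frattini G, (g, (1 : H)) ∈ L → g = 1 := by
  have h1 : ∀ g, ∃ h, (g, h) ∈ L := by
    intro g
    by_contra hg
    refine h ?_
    rw [← idemPhiOne_comp_idemETilde hG, RB.comp_assoc, idemETilde_comp_eq_zero hG hH, map_zero]
    rintro ⟨⟨a, b⟩⟩ hU
    refine hg ?_
    have ha : a * g * a⁻¹ ∈ (⊤ : Subgroup G) := trivial
    rw [← hU] at ha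
    obtain ⟨⟨x, y⟩, hx, hx'⟩ := ha
    change x = _ at hx'
    have h3 := inv_mem (Biset.cosetMk_eq.1 (show Biset.cosetMk L (x * a, y.unop⁻¹ * b) =
      Biset.cosetMk L (a, b) from hx))
    rw [mul_inv_rev, inv_inv, Prod.inv_mk, Prod.mk_mul_mk, hx'] at h3
    refine ⟨b⁻¹ * (y.unop⁻¹ * b), ?_⟩
    convert h3 using 2
    group
  refine ⟨h1, ?_⟩
  let N : Subgroup G := L.comap (MonoidHom.inl G H) ⊓ frattini G
  have hmem : ∀ g, g ∈ N ↔ (g, (1 : H)) ∈ L ∧ g ∈ frattini G := fun g => Iff.rfl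
  have hN : N.Normal := by
    refine ⟨fun n hn g => ?_⟩
    rw [hmem] at hn ⊢
    obtain ⟨k, hk⟩ := h1 g
    refine ⟨?_, Subgroup.Normal.conj_mem inferInstance _ hn.2 _⟩
    simpa using mul_mem (mul_mem hk hn.1) (inv_mem hk)
  by_contra! h2
  obtain ⟨g, hg1, hg2, hg3⟩ := h2
  refine h ?_
  have h3 : RB.comp (RBurnside.mk R (Biset.coset (deltaSubgroup N)))
      (RBurnside.mk R (Biset.coset L)) = RBurnside.mk R (Biset.coset L) := by
    rw [RB.comp_mk, RBurnside.mk_eq (Biset.delta_comp_coset N L), Biset.star_delta_left]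
    exact fun n hn => hn.1
  rw [← idemPhiOne_comp_idemETilde hG, ← h3, ← RB.comp_assoc, RB.comp_assoc _ (idemETilde R G),
    ← elemY_delta hG N inf_le_right, idemPhiOne_comp_elemY hG N inf_le_right, map_zero,
    LinearMap.zero_apply]
  intro hN
  exact hg3 (by
    have : g ∈ N := ⟨hg2, hg1⟩
    rwa [hN] at this)

theorem coset_comp_idemPhiOne_ne_zero (hH : IsUnit (Nat.card H : R)) {L : Subgroup (H × G)}
    (h : RB.comp (RBurnside.mk R (Biset.coset L)) (idemPhiOne R G) ≠ 0) :
    (∀ g, ∃ h, (h, g) ∈ L) ∧ ∀ g ∈ frattini G, ((1 : H), g) ∈ L → g = 1 := by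
  have h1 : ∀ g, ∃ h, (h, g) ∈ L := by
    intro g
    by_contra hg
    refine h ?_
    rw [← idemETilde_comp_idemPhiOne hG, ← RB.comp_assoc, comp_idemETilde_eq_zero hH hG, map_zero,
      LinearMap.zero_apply]
    rintro ⟨⟨b, a⟩⟩ hU
    refine hg ?_
    have ha : a * g * a⁻¹ ∈ (⊤ : Subgroup G) := trivial
    rw [← hU] at ha
    obtain ⟨⟨y, x⟩, hx, hx'⟩ := ha
    change x.unop⁻¹ = _ at hx'
    have h3 := inv_mem (Biset.cosetMk_eq.1 (show Biset.cosetMk L (y * b, x.unop⁻¹ * a) =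
      Biset.cosetMk L (b, a) from hx))
    rw [mul_inv_rev, inv_inv, Prod.inv_mk, Prod.mk_mul_mk, hx'] at h3
    refine ⟨b⁻¹ * (y * b), ?_⟩
    convert h3 using 2
    group
  refine ⟨h1, ?_⟩
  let N : Subgroup G := L.comap (MonoidHom.inr H G) ⊓ frattini G
  have hmem : ∀ g, g ∈ N ↔ ((1 : H), g) ∈ L ∧ g ∈ frattini G := fun g => Iff.rfl
  have hN : N.Normal := by
    refine ⟨fun n hn g => ?_⟩
    rw [hmem] at hn ⊢
    obtain ⟨k, hk⟩ := h1 g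
    refine ⟨?_, Subgroup.Normal.conj_mem inferInstance _ hn.2 _⟩
    simpa using mul_mem (mul_mem hk hn.1) (inv_mem hk)
  by_contra! h2
  obtain ⟨g, hg1, hg2, hg3⟩ := h2
  refine h ?_
  have h3 : RB.comp (RBurnside.mk R (Biset.coset L))
      (RBurnside.mk R (Biset.coset (deltaSubgroup N))) = RBurnside.mk R (Biset.coset L) := by
    rw [RB.comp_mk, RBurnside.mk_eq (Biset.coset_comp_delta N L), Biset.star_delta_right]
    exact fun n hn => hn.1
  rw [← idemETilde_comp_idemPhiOne hG, ← h3, RB.comp_assoc, ← RB.comp_assoc _ (idemETilde R G),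
    delta_comp_idemETilde N inf_le_right, ← elemY_delta hG N inf_le_right,
    elemY_comp_idemPhiOne' hG N inf_le_right, idemPhiOne_comp_elemY hG N inf_le_right, map_zero]
  intro hN
  exact hg3 (by
    have : g ∈ N := ⟨hg2, hg1⟩
    rwa [hN] at this)

end Y

/-! ### Rearrangement of finite sums. -/

theorem finsum_of_injective {α β M : Type*} [Finite β] [AddCommMonoid M] (j : α → β)
    (hj : Function.Injective j) (f : α → M) (g : β → M) (h0 : ∀ b, b ∉ Set.range j → g b = 0)
    (h : ∀ a, f a = g (j a)) : ∑ᶠ a, f a = ∑ᶠ b, g b := by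
  classical
  have := Finite.of_injective j hj
  have := Fintype.ofFinite α
  have := Fintype.ofFinite β
  rw [finsum_eq_sum_of_fintype, finsum_eq_sum_of_fintype]
  exact Fintype.sum_of_injective j hj f g h0 h

theorem finsum_comm_of_finite {α β M : Type*} [Finite α] [Finite β] [AddCommMonoid M]
    (f : α → β → M) : ∑ᶠ a, ∑ᶠ b, f a b = ∑ᶠ b, ∑ᶠ a, f a b := by
  have := Fintype.ofFinite α
  have := Fintype.ofFinite β
  simp only [finsum_eq_sum_of_fintype]
  exact Finset.sum_comm

theorem smul_finsum_of_finite {α R M : Type*} [Finite α] [Semiring R] [AddCommMonoid M]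
    [Module R M] (r : R) (f : α → M) : r • ∑ᶠ a, f a = ∑ᶠ a, r • f a := by
  have := Fintype.ofFinite α
  simp only [finsum_eq_sum_of_fintype]
  exact Finset.smul_sum

theorem finsum_smul_of_finite {α R M : Type*} [Finite α] [Semiring R] [AddCommMonoid M]
    [Module R M] (r : α → R) (x : M) : (∑ᶠ a, r a) • x = ∑ᶠ a, r a • x := by
  have := Fintype.ofFinite α
  simp only [finsum_eq_sum_of_fintype]
  exact Finset.sum_smul

/-! ### Expansion of `φ_1^{T/N}` over subgroups of `T`. -/

section Quotient

variable {T Q : Type u} [Group T] [Group Q] [Finite T] [Finite Q]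

/-- All maximal subgroups of `T` contain the kernel, so each of them is the preimage of a maximal
subgroup of `Q`. -/
theorem comap_frattini_le {f : T →* Q} (hf : Function.Surjective f) (hker : f.ker ≤ frattini T) :
    (frattini Q).comap f ≤ frattini T := by
  intro x hx
  rw [frattini, Order.radical]
  simp only [Subgroup.mem_iInf]
  intro C hC
  have hkC : f.ker ≤ C := hker.trans (frattini_le_coatom hC)
  have hCC : (C.map f).comap f = C := by
    rw [Subgroup.comap_map_eq, sup_eq_left.2 hkC]
  have hcoatom : IsCoatom (C.map f) := by
    refine ⟨fun h => hC.1 (by rw [← hCC, h, Subgroup.comap_top]), fun B hB => ?_⟩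
    have h1 : C < B.comap f := by
      rw [← hCC]
      exact (Subgroup.comap_lt_comap_of_surjective hf).2 hB
    have h2 := hC.2 _ h1
    rw [← Subgroup.map_comap_eq_self_of_surjective hf B, h2, Subgroup.map_top_of_surjective f hf]
  have h3 : f x ∈ C.map f := frattini_le_coatom hcoatom hx
  rw [← hCC]
  exact h3

/-- The order embedding of the subgroups of a quotient. -/
def comapEmbedding (f : T →* Q) (hf : Function.Surjective f) : Subgroup Q ↪o Subgroup T :=
  OrderEmbedding.ofMapLEIff (Subgroup.comap f) fun _ _ => Subgroup.comap_le_comap_of_surjective hf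

/-- The order embedding of the normal subgroups of a quotient. -/
def normalComapEmbedding (f : T →* Q) (hf : Function.Surjective f) :
    NormalSubgroup Q ↪o NormalSubgroup T :=
  OrderEmbedding.ofMapLEIff (fun M => ⟨M.1.comap f, M.2.comap f⟩)
    fun _ _ => Subgroup.comap_le_comap_of_surjective hf

theorem mem_range_comapEmbedding {f : T →* Q} (hf : Function.Surjective f) {K : Subgroup T}
    (hK : f.ker ≤ K) : K ∈ Set.range (comapEmbedding f hf) :=
  ⟨K.map f, by
    change (K.map f).comap f = K
    rw [Subgroup.comap_map_eq, sup_eq_left.2 hK]⟩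

theorem mem_range_normalComapEmbedding {f : T →* Q} (hf : Function.Surjective f)
    {K : NormalSubgroup T} (hK : f.ker ≤ K.1) : K ∈ Set.range (normalComapEmbedding f hf) :=
  ⟨⟨K.1.map f, K.2.map f hf⟩, Subtype.ext (by
    change (K.1.map f).comap f = K
    rw [Subgroup.comap_map_eq, sup_eq_left.2 hK])⟩

theorem moebius_comap {f : T →* Q} (hf : Function.Surjective f) (K : Subgroup Q) :
    moebius (K.comap f) ⊤ = moebius K ⊤ := by
  rw [← Subgroup.comap_top f]
  refine moebius_orderEmbedding (comapEmbedding f hf) K ⊤ fun y hy _ => ?_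
  refine mem_range_comapEmbedding hf (le_trans ?_ hy)
  exact Subgroup.comap_mono (f := f) bot_le

variable {R : Type v} [CommRing R]

open Classical in
/-- The coefficient of the expansion of `φ_1^{T/N}` at a normal subgroup `M` and a
subgroup `K` of `T`. -/
def phiCoeff (R : Type v) [CommRing R] (N M : NormalSubgroup T) (K : Subgroup T) : R :=
  if N ≤ M ∧ M.1 ≤ frattini T then (moebius N M : R) * ((Nat.card K : R) * (moebius K ⊤ : R))
  else 0

/-- Expansion of `φ_1^Q` for a quotient `Q = T / N` with `N ≤ Φ(T)`. -/
theorem card_smul_map_idemPhiOne (hT : IsUnit (Nat.card T : R)) {f : T →* Q}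
    (hf : Function.Surjective f) (hker : f.ker ≤ frattini T) {M : Type*} [AddCommGroup M]
    [Module R M] (F : RB R Q Q →ₗ[R] M) (F' : NormalSubgroup T → Subgroup T → M)
    (hF : ∀ (N : NormalSubgroup Q) (K : Subgroup Q), F (RBurnside.mk R (Biset.coset (deltaSubgroup N.1 ⊓ K.prod ⊤))) =
      F' (normalComapEmbedding f hf N) (K.comap f)) :
    (Nat.card T : R) • F (idemPhiOne R Q) =
      ∑ᶠ N : NormalSubgroup T, ∑ᶠ K : Subgroup T,
        phiCoeff R ⟨f.ker, inferInstance⟩ N K • F' N K := by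
  classical
  -- Together with `|T| = |Q| |ker f|` this turns `|T| |Q|⁻¹ |K|` into `|f⁻¹(K)|`; the factor `|T|`
  -- thus makes the coefficients intrinsic to `T`.
  have hcard : ∀ K : Subgroup Q, Nat.card (K.comap f) = Nat.card K * Nat.card f.ker := by
    intro K
    have h1 := Subgroup.card_mul_index (K.comap f)
    rw [Subgroup.index_comap_of_surjective K hf] at h1
    have h2 := Subgroup.card_mul_index K
    have h3 := Subgroup.card_mul_index f.ker
    rw [Subgroup.index_ker, MonoidHom.range_eq_top_of_surjective f hf, Subgroup.card_top] at h3
    have h4 : K.index ≠ 0 := Subgroup.index_ne_zero_of_finite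
    refine Nat.eq_of_mul_eq_mul_right (Nat.pos_of_ne_zero h4) ?_
    rw [h1, ← h3, ← h2]
    ring
  have hTQ : Nat.card T = Nat.card Q * Nat.card f.ker := by
    have := hcard ⊤
    rwa [Subgroup.comap_top, Subgroup.card_top, Subgroup.card_top] at this
  have hQ : IsUnit (Nat.card Q : R) := by
    rw [hTQ, Nat.cast_mul] at hT
    exact isUnit_of_mul_isUnit_left hT
  have h1 : ∀ N : Subgroup Q, (hN : N.Normal) → N ≤ frattini Q →
      (Nat.card T : R) • F (elemY R (deltaSubgroup N)) = ∑ᶠ K : Subgroup T,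
        ((Nat.card K : R) * (moebius K ⊤ : R)) • F' (normalComapEmbedding f hf ⟨N, hN⟩) K := by
    intro N hN hNf
    rw [elemY_delta hQ N hNf, idemETilde_comp_delta, map_smul, LinearMap.map_finsum_of_finite,
      smul_smul, hTQ, Nat.cast_mul, mul_right_comm, Ring.mul_inverse_cancel _ hQ, one_mul,
      smul_finsum_of_finite]
    refine finsum_of_injective (comapEmbedding f hf) (comapEmbedding f hf).injective _ _ ?_ ?_
    · intro K hK
      -- A subgroup with `μ(K, T) ≠ 0` contains `Φ(T)`, hence the kernel, and is then a preimage.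
      have : moebius K ⊤ = 0 := by
        by_contra h
        exact hK (mem_range_comapEmbedding hf (hker.trans (frattini_le_of_moebius_ne_zero h)))
      rw [this, Int.cast_zero, mul_zero, zero_smul]
    · intro K
      rw [map_smul, hF ⟨N, hN⟩ K, smul_smul]
      change _ = ((Nat.card (K.comap f) : R) * (moebius (K.comap f) ⊤ : R)) •
        F' _ (K.comap f)
      rw [moebius_comap hf, hcard, Nat.cast_mul]
      congr 1
      ring
  unfold idemPhiOne idemPhi
  rw [LinearMap.map_finsum_of_finite, smul_finsum_of_finite]
  refine finsum_of_injective (fun N => normalComapEmbedding f hf N.1)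
    (fun _ _ h => Subtype.ext ((normalComapEmbedding f hf).injective h)) _ _ ?_ ?_
  · intro N hN
    rw [finsum_eq_zero_of_forall_eq_zero]
    intro K
    rw [phiCoeff, if_neg, zero_smul]
    rintro ⟨h2, h3⟩
    obtain ⟨N', rfl⟩ := mem_range_normalComapEmbedding hf (show f.ker ≤ N.1 from h2)
    refine hN ⟨⟨N', (bot_le : (⊥ : Subgroup Q) ≤ _), ?_⟩, rfl⟩
    intro y hy
    obtain ⟨x, rfl⟩ := hf y
    exact frattini_le_comap_frattini_of_surjective hf (h3 hy)
  · rintro ⟨N, hN1, hN2⟩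
    rw [map_smul, smul_comm, h1 N.1 N.2 hN2, smul_finsum_of_finite]
    refine finsum_congr fun K => ?_
    rw [smul_smul]
    congr 1
    rw [phiCoeff, if_pos]
    · congr 2
      refine ((moebius_orderEmbedding (normalComapEmbedding f hf) ⟨⊥, inferInstance⟩ N ?_)).symm
      intro y hy _
      exact mem_range_normalComapEmbedding hf hy
    · refine ⟨?_, (Subgroup.comap_mono hN2).trans (comap_frattini_le hf hker)⟩
      exact Subgroup.comap_mono (f := f) (bot_le : ⊥ ≤ N.1)

end Quotient

/-! ### Expansion of `u_{T,S} v_{T,S}` into transitive bisets. -/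

namespace GroupSection

variable {G : Type u} [Group G] [Finite G]

/-- The bottom group of a section as a normal subgroup of the top group. -/
def bot (s : GroupSection G) : NormalSubgroup s.T := ⟨s.S.subgroupOf s.T, s.normal⟩

/-- The quotient map of a section. -/
def proj (s : GroupSection G) : s.T →* s.quot := QuotientGroup.mk' (s.S.subgroupOf s.T)

theorem proj_surjective (s : GroupSection G) : Function.Surjective s.proj :=
  QuotientGroup.mk'_surjective _

theorem ker_proj (s : GroupSection G) : s.proj.ker = s.S.subgroupOf s.T := QuotientGroup.ker_mk' _

theorem indinf_iso (s : GroupSection G) :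
    s.indinf.Iso (Biset.coset (s.T.subtype.prod s.proj).range) := by
  have key : ∀ (c : G) (t : s.T), (c, op (s.proj t)) • (show s.indinf from ((1 : G) : G ⧸ s.S)) =
      (show s.indinf from ((c * 1 * t : G) : G ⧸ s.S)) := fun _ _ => rfl
  refine Biset.iso_coset (show s.indinf from ((1 : G) : G ⧸ s.S)) ?_ _ ?_
  · intro z
    obtain ⟨g, rfl⟩ := QuotientGroup.mk_surjective z
    refine ⟨(g, op (s.proj 1)), (key _ _).trans ?_⟩
    simp
    rfl
  · intro g h
    obtain ⟨t, rfl⟩ := s.proj_surjective h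
    rw [← map_inv, key]
    refine QuotientGroup.eq.trans ?_
    constructor
    · intro h1
      have hg : g ∈ s.T := by
        have h2 : (t : G) * g⁻¹ ∈ s.S := by simpa using h1
        simpa using mul_mem (inv_mem (s.le h2)) t.2
      refine ⟨⟨g, hg⟩, Prod.ext rfl ?_⟩
      refine QuotientGroup.eq.2 ?_
      rw [Subgroup.mem_subgroupOf]
      have h3 := s.normal.conj_mem ⟨_, s.le h1⟩ (by simpa [Subgroup.mem_subgroupOf] using h1) t⁻¹
      simpa [Subgroup.mem_subgroupOf, mul_assoc] using h3
    · rintro ⟨t', ht'⟩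
      obtain ⟨rfl, h2⟩ := Prod.ext_iff.1 ht'
      have h3 := QuotientGroup.eq.1 h2
      have h4 := s.normal.conj_mem _ h3 t
      simpa [Subgroup.mem_subgroupOf, mul_assoc] using h4

theorem defres_iso (s : GroupSection G) :
    s.defres.Iso (Biset.coset (s.proj.prod s.T.subtype).range) := by
  have key : ∀ (c : G) (t : s.T), (s.proj t, op c) •
      (show s.defres from Quotient.mk (QuotientGroup.rightRel s.S) (1 : G)) =
      (show s.defres from Quotient.mk (QuotientGroup.rightRel s.S) (t * 1 * c)) := fun _ _ => rfl
  refine Biset.iso_coset (show s.defres from Quotient.mk (QuotientGroup.rightRel s.S) (1 : G))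
    ?_ _ ?_
  · intro z
    obtain ⟨g, rfl⟩ := Quotient.exists_rep z
    refine ⟨(s.proj 1, op g), (key _ _).trans ?_⟩
    simp
    rfl
  · intro h g
    obtain ⟨t, rfl⟩ := s.proj_surjective h
    rw [key]
    refine (Quotient.eq (r := QuotientGroup.rightRel s.S)).trans ?_
    rw [QuotientGroup.rightRel_apply]
    constructor
    · intro h1
      have h1' : g * (t : G)⁻¹ ∈ s.S := by simpa using h1
      have hg : g ∈ s.T := by
        simpa using mul_mem (s.le h1') t.2
      refine ⟨⟨g, hg⟩, Prod.ext ?_ rfl⟩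
      refine QuotientGroup.eq.2 ?_
      have h3 := s.normal.conj_mem ⟨_, s.le (inv_mem h1')⟩
        (by simpa [Subgroup.mem_subgroupOf] using inv_mem h1') ⟨g, hg⟩⁻¹
      simpa [Subgroup.mem_subgroupOf, mul_assoc] using h3
    · rintro ⟨t', ht'⟩
      obtain ⟨h2, rfl⟩ := Prod.ext_iff.1 ht'
      have h3 := QuotientGroup.eq.1 h2
      have h4 := s.normal.conj_mem _ (inv_mem h3) t'
      have h5 := s.normal.conj_mem _ (inv_mem h3) t
      simpa [Subgroup.mem_subgroupOf, mul_assoc] using h4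

/-- The image in `G × G` of a subgroup of `T × T`. -/
abbrev push {T : Subgroup G} (D : Subgroup (T × T)) : Subgroup (G × G) :=
  D.map (T.subtype.prodMap T.subtype)

theorem mem_push {T : Subgroup G} {D : Subgroup (T × T)} {x : G × G} :
    x ∈ push D ↔ ∃ a b : T, (a, b) ∈ D ∧ x = (↑a, ↑b) := by
  rw [Subgroup.mem_map]
  constructor
  · rintro ⟨⟨a, b⟩, h, rfl⟩
    exact ⟨a, b, h, rfl⟩
  · rintro ⟨a, b, h, rfl⟩
    exact ⟨(a, b), h, rfl⟩

variable {R : Type v} [CommRing R]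

/-- Both outer bisets come from the graph of `T → T/S`, which is onto `T/S`, so `coset_comp_coset`
applies twice and no Mackey sum appears. -/
theorem indinf_comp_defres (s : GroupSection G) (D : Subgroup (s.quot × s.quot)) :
    RB.comp (RB.comp (RBurnside.mk R s.indinf) (RBurnside.mk R (Biset.coset D)))
      (RBurnside.mk R s.defres) =
    RBurnside.mk R (Biset.coset (push (D.comap (s.proj.prodMap s.proj)))) := by
  rw [RBurnside.mk_eq s.indinf_iso, RBurnside.mk_eq s.defres_iso, RB.comp_mk,
    RBurnside.mk_eq (Biset.coset_comp_coset _ _ ?_), RB.comp_mk,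
    RBurnside.mk_eq (Biset.coset_comp_coset _ _ ?_)]
  · congr 2
    ext ⟨a, b⟩
    rw [mem_push]
    constructor
    · rintro ⟨_, ⟨_, ⟨t, ht⟩, h⟩, ⟨t', ht'⟩⟩
      obtain ⟨rfl, rfl⟩ := Prod.ext_iff.1 ht
      obtain ⟨rfl, rfl⟩ := Prod.ext_iff.1 ht'
      exact ⟨t, t', h, rfl⟩
    · rintro ⟨t, t', h, h'⟩
      obtain ⟨rfl, rfl⟩ := Prod.ext_iff.1 h'
      exact ⟨_, ⟨_, ⟨t, rfl⟩, h⟩, ⟨t', rfl⟩⟩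
  · intro h
    obtain ⟨t, rfl⟩ := s.proj_surjective h
    exact ⟨1, 1, s.proj t, t, one_mem _, ⟨t, rfl⟩, by simp⟩
  · intro h
    obtain ⟨t, rfl⟩ := s.proj_surjective h
    exact ⟨t, s.proj t, 1, 1, ⟨t, rfl⟩, one_mem _, by simp⟩

theorem isUnit_card_quot (s : GroupSection G) (hG : IsUnit (Nat.card G : R)) :
    IsUnit (Nat.card s.quot : R) := by
  obtain ⟨k, hk⟩ := (Subgroup.card_quotient_dvd_card (s.S.subgroupOf s.T)).trans
    (Subgroup.card_subgroup_dvd_card s.T)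
  rw [hk, Nat.cast_mul] at hG
  exact isUnit_of_mul_isUnit_left hG

theorem isUnit_card_subgroup (T : Subgroup G) (hG : IsUnit (Nat.card G : R)) :
    IsUnit (Nat.card T : R) := by
  obtain ⟨k, hk⟩ := Subgroup.card_subgroup_dvd_card T
  rw [hk, Nat.cast_mul] at hG
  exact isUnit_of_mul_isUnit_left hG

variable (R) in
/-- The transitive biset attached to a normal subgroup `M` and a subgroup `K` of `T ≤ G`. -/
def zElem (T : Subgroup G) (M : NormalSubgroup T) (K : Subgroup T) : RB R G G :=
  RBurnside.mk R (Biset.coset (push (deltaSubgroup M.1 ⊓ K.prod ⊤)))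

/-- Expansion of `u_{T,S} v_{T,S}`. -/
theorem card_smul_u_comp_v (hG : IsUnit (Nat.card G : R)) (s : GroupSection G) (hs : s.IsMinimal) :
    (Nat.card s.T : R) • RB.comp (s.u R) (s.v R) =
      ∑ᶠ M : NormalSubgroup s.T, ∑ᶠ K : Subgroup s.T,
        phiCoeff R s.bot M K • zElem R s.T M K := by
  have h1 : RB.comp (s.u R) (s.v R) =
      RB.comp (RB.comp (RBurnside.mk R s.indinf) (idemPhiOne R s.quot))
        (RBurnside.mk R s.defres) := by
    unfold u v
    rw [← RB.comp_assoc, RB.comp_assoc _ (idemPhiOne R s.quot) (idemPhiOne R s.quot),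
      idemPhiOne_idem (s.isUnit_card_quot hG)]
  let F : RB R s.quot s.quot →ₗ[R] RB R G G :=
    RB.comp.flip (RBurnside.mk R s.defres) ∘ₗ RB.comp (RBurnside.mk R s.indinf)
  -- The resulting bisets depend on the preimages `M` and `K` in `T`, not on `S`; `S` survives only
  -- in the coefficients.
  have h2 := card_smul_map_idemPhiOne (isUnit_card_subgroup s.T hG) s.proj_surjective
    (by rw [ker_proj]; exact hs) F (zElem R s.T) (fun N K => by
      rw [LinearMap.comp_apply, LinearMap.flip_apply, indinf_comp_defres]
      unfold zElem
      congr 2)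
  rw [h1]
  refine h2.trans ?_
  have h3 : (⟨s.proj.ker, inferInstance⟩ : NormalSubgroup s.T) = s.bot :=
    Subtype.ext s.ker_proj
  rw [h3]

end GroupSection

namespace Biset

variable {G H : Type u} [Group G] [Group H] [Finite G] [Finite H]

theorem coset_conj_iso (L : Subgroup (G × H)) (x : G × H) :
    (coset L).Iso (coset (L.map (MulAut.conj x).toMonoidHom)) := by
  refine iso_coset (cosetMk L x) ?_ _ ?_
  · intro z
    obtain ⟨y, rfl⟩ := cosetMk_surjective L z
    refine ⟨(y.1 * x.1⁻¹, op (y.2 * x.2⁻¹)⁻¹), ?_⟩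
    rw [smul_cosetMk]
    simp
  · intro g h
    rw [smul_cosetMk, eq_comm, cosetMk_eq, Subgroup.mem_map_equiv]
    have h1 : x⁻¹ * (g * x.1, h⁻¹⁻¹ * x.2) = (MulAut.conj x).symm (g, h) := by
      rw [MulAut.conj_symm_apply]
      ext <;> simp [mul_assoc]
    exact iff_of_eq (congrArg (· ∈ L) h1)

end Biset

/-! ### The conjugation action on sections. -/

namespace GroupSection

variable {G : Type u} [Group G]

@[ext]
theorem ext' {s t : GroupSection G} (hT : s.T = t.T) (hS : s.S = t.S) : s = t := by
  obtain ⟨T, S, _, _⟩ := s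
  obtain ⟨T', S', _, _⟩ := t
  subst hT hS
  rfl

instance conjAction : MulAction G (GroupSection G) where
  smul g s :=
    { T := s.T.map (MulAut.conj g).toMonoidHom
      S := s.S.map (MulAut.conj g).toMonoidHom
      le := Subgroup.map_mono s.le
      normal := by
        rw [Subgroup.normal_subgroupOf_iff (Subgroup.map_mono s.le)]
        rintro _ _ ⟨h, hh, rfl⟩ ⟨k, hk, rfl⟩
        refine ⟨k * h * k⁻¹, ?_, by simp [mul_assoc]⟩
        exact (Subgroup.normal_subgroupOf_iff s.le).1 s.normal h k hh hk }
  one_smul s := by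
    refine GroupSection.ext' ?_ ?_
    · change s.T.map (MulAut.conj 1).toMonoidHom = s.T
      rw [map_one]
      exact Subgroup.map_id _
    · change s.S.map (MulAut.conj 1).toMonoidHom = s.S
      rw [map_one]
      exact Subgroup.map_id _
  mul_smul g h s := by
    refine GroupSection.ext' ?_ ?_
    · change s.T.map (MulAut.conj (g * h)).toMonoidHom = (s.T.map _).map _
      rw [Subgroup.map_map, map_mul]
      rfl
    · change s.S.map (MulAut.conj (g * h)).toMonoidHom = (s.S.map _).map _
      rw [Subgroup.map_map, map_mul]
      rfl

theorem isConj_iff_mem_orbit {s t : GroupSection G} : s.IsConj t ↔ t ∈ MulAction.orbit G s := by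
  constructor
  · rintro ⟨g, h1, h2⟩
    exact ⟨g, ext' h1.symm h2.symm⟩
  · rintro ⟨g, rfl⟩
    exact ⟨g, rfl, rfl⟩

theorem map_conj_eq_iff [Finite G] (T : Subgroup G) (g : G) :
    T.map (MulAut.conj g).toMonoidHom = T ↔ g ∈ Subgroup.normalizer (T : Set G) := by
  rw [Subgroup.mem_normalizer_iff]
  constructor
  · intro h x
    constructor
    · intro hx
      have : g * x * g⁻¹ ∈ T.map (MulAut.conj g).toMonoidHom := ⟨x, hx, rfl⟩
      rwa [h] at this
    · intro hx
      have hx' : g * x * g⁻¹ ∈ T := hx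
      rw [← h] at hx'
      obtain ⟨y, hy, hy'⟩ := hx'
      have : y = x := (MulAut.conj g).injective hy'
      exact this ▸ hy
  · intro h
    ext x
    constructor
    · rintro ⟨y, hy, rfl⟩
      exact (h y).1 hy
    · intro hx
      refine ⟨g⁻¹ * x * g, (h _).2 ?_, ?_⟩
      · simpa [mul_assoc] using hx
      · simp [mul_assoc]

theorem stabilizer_eq_normalizer [Finite G] (s : GroupSection G) :
    MulAction.stabilizer G s = s.normalizer := by
  ext g
  rw [MulAction.mem_stabilizer_iff, normalizer, Subgroup.mem_inf, ← map_conj_eq_iff,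
    ← map_conj_eq_iff]
  constructor
  · intro h
    exact ⟨congrArg T h, congrArg S h⟩
  · rintro ⟨h1, h2⟩
    exact ext' h1 h2

theorem T_le_normalizer (s : GroupSection G) : s.T ≤ s.normalizer := by
  refine le_inf Subgroup.le_normalizer ?_
  exact (Subgroup.normal_subgroupOf_iff_le_normalizer s.le).1 s.normal

end GroupSection

/-! ### Transport of the coefficients along isomorphisms. -/

section Transport

variable {T T' : Type u} [Group T] [Group T'] [Finite T] [Finite T']

/-- Isomorphic groups have isomorphic posets of normal subgroups. -/
def normalMapIso (e : T ≃* T') : NormalSubgroup T ≃o NormalSubgroup T' where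
  toFun N := ⟨e.mapSubgroup N.1, N.2.map e.toMonoidHom e.surjective⟩
  invFun N := ⟨e.mapSubgroup.symm N.1, N.2.map e.symm.toMonoidHom e.symm.surjective⟩
  left_inv N := Subtype.ext (e.mapSubgroup.symm_apply_apply N.1)
  right_inv N := Subtype.ext (e.mapSubgroup.apply_symm_apply N.1)
  map_rel_iff' := e.mapSubgroup.map_rel_iff

theorem map_frattini (e : T ≃* T') : e.mapSubgroup (frattini T) = frattini T' :=
  OrderIso.map_radical e.mapSubgroup

theorem phiCoeff_transport {R : Type v} [CommRing R] (e : T ≃* T') (N M : NormalSubgroup T)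
    (K : Subgroup T) :
    phiCoeff R (normalMapIso e N) (normalMapIso e M) (e.mapSubgroup K) = phiCoeff R N M K := by
  classical
  have h1 : (normalMapIso e N ≤ normalMapIso e M ∧ (normalMapIso e M).1 ≤ frattini T') ↔
      (N ≤ M ∧ M.1 ≤ frattini T) := by
    rw [(normalMapIso e).le_iff_le, ← map_frattini e]
    exact and_congr_right fun _ => e.mapSubgroup.le_iff_le
  have h2 : moebius (e.mapSubgroup K) ⊤ = moebius K ⊤ := by
    have := moebius_orderIso e.mapSubgroup K ⊤
    rwa [map_top] at this
  have h3 : Nat.card (e.mapSubgroup K) = Nat.card K :=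
    Nat.card_congr (e.subgroupMap K).toEquiv.symm
  unfold phiCoeff
  simp only [h1, h2, h3, moebius_orderIso]

end Transport

/-! ### The sum of the elements `ε_{T,S}`. -/

namespace GroupSection

variable {G : Type u} [Group G] [Finite G] (R : Type v) [CommRing R]

/-- The element `|T| u_{T,S} v_{T,S}` in expanded form. -/
def expansion (T : Subgroup G) (N : NormalSubgroup T) : RB R G G :=
  ∑ᶠ M : NormalSubgroup T, ∑ᶠ K : Subgroup T, phiCoeff R N M K • zElem R T M K

theorem map_delta {T T' : Type u} [Group T] [Group T'] [Finite T] [Finite T'] (e : T ≃* T') (M : NormalSubgroup T)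
    (K : Subgroup T) : (deltaSubgroup M.1 ⊓ K.prod ⊤).map (e.prodCongr e).toMonoidHom =
      deltaSubgroup (normalMapIso e M).1 ⊓ (e.mapSubgroup K).prod ⊤ := by
  ext ⟨a, b⟩
  obtain ⟨a, rfl⟩ := e.surjective a
  obtain ⟨b, rfl⟩ := e.surjective b
  have h1 : (e a, e b) = (e.prodCongr e).toMonoidHom (a, b) := rfl
  rw [h1, Subgroup.mem_map_iff_mem (e.prodCongr e).injective, ← h1]
  simp only [Subgroup.mem_inf, Subgroup.mem_prod, Subgroup.mem_top, and_true,
    Biset.mem_deltaSubgroup]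
  rw [← map_inv, ← map_mul]
  exact and_congr (Subgroup.mem_map_iff_mem (f := e.toMonoidHom) e.injective).symm
    (Subgroup.mem_map_iff_mem (f := e.toMonoidHom) e.injective).symm

/-- The isomorphism `e` is conjugation by `g`, so corresponding bisets are attached to subgroups of
`G × G` that are conjugate under `(g, g)`. -/
theorem expansion_transport {T T' : Subgroup G} (e : T ≃* T')
    (he : ∃ g : G, ∀ t : T, (e t : G) = g * t * g⁻¹) (N : NormalSubgroup T) :
    expansion R T' (normalMapIso e N) = expansion R T N := by
  obtain ⟨g, hg⟩ := he
  have hz : ∀ (M : NormalSubgroup T) (K : Subgroup T),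
      zElem R T' (normalMapIso e M) (e.mapSubgroup K) = zElem R T M K := by
    intro M K
    unfold zElem
    rw [RBurnside.mk_eq (Biset.coset_conj_iso (push (deltaSubgroup M.1 ⊓ K.prod ⊤)) (g, g)),
      ← map_delta, push, push, Subgroup.map_map, Subgroup.map_map]
    congr 3
    ext ⟨a, b⟩
    · exact hg a
    · exact hg b
  unfold expansion
  rw [← finsum_comp_equiv (normalMapIso e).toEquiv]
  refine finsum_congr fun M => ?_
  rw [← finsum_comp_equiv e.mapSubgroup.toEquiv]
  refine finsum_congr fun K => ?_
  change phiCoeff R (normalMapIso e N) (normalMapIso e M) (e.mapSubgroup K) •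
    zElem R T' (normalMapIso e M) (e.mapSubgroup K) = _
  rw [phiCoeff_transport, hz]

/-- The isomorphism between the top groups of conjugate sections. -/
def conjEquiv (s : GroupSection G) (g : G) : s.T ≃* (g • s).T :=
  (MulAut.conj g).subgroupMap s.T

theorem bot_smul (s : GroupSection G) (g : G) :
    (g • s).bot = normalMapIso (s.conjEquiv g) s.bot := by
  refine Subtype.ext ?_
  ext ⟨x, hx⟩
  change x ∈ (g • s).S ↔ _
  constructor
  · rintro ⟨y, hy, rfl⟩
    exact ⟨⟨y, s.le hy⟩, hy, rfl⟩
  · rintro ⟨y, hy, hyx⟩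
    exact ⟨y, hy, congrArg Subtype.val hyx⟩

theorem expansion_smul (s : GroupSection G) (g : G) :
    expansion R (g • s).T (g • s).bot = expansion R s.T s.bot := by
  rw [bot_smul]
  exact expansion_transport R (s.conjEquiv g) ⟨g, fun _ => rfl⟩ s.bot

theorem isMinimal_smul (s : GroupSection G) (g : G) : (g • s).IsMinimal ↔ s.IsMinimal := by
  change (g • s).bot.1 ≤ _ ↔ s.bot.1 ≤ _
  rw [bot_smul, ← map_frattini (s.conjEquiv g)]
  exact (s.conjEquiv g).mapSubgroup.le_iff_le

/-- The section attached to a normal subgroup of a subgroup. -/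
def ofNormal (T : Subgroup G) (N : NormalSubgroup T) : GroupSection G where
  T := T
  S := N.1.map T.subtype
  le := Subgroup.map_subtype_le _
  normal := by
    have : (N.1.map T.subtype).subgroupOf T = N.1 :=
      Subgroup.comap_map_eq_self_of_injective T.subtype_injective _
    rw [this]
    exact N.2

theorem bot_ofNormal (T : Subgroup G) (N : NormalSubgroup T) : (ofNormal T N).bot = N :=
  Subtype.ext (Subgroup.comap_map_eq_self_of_injective T.subtype_injective _)

variable (G) in
/-- Sections as pairs of a subgroup and a normal subgroup of it. -/
def equivSigma : (Σ T : Subgroup G, NormalSubgroup T) ≃ GroupSection G where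
  toFun x := ofNormal x.1 x.2
  invFun s := ⟨s.T, s.bot⟩
  left_inv x := Sigma.ext rfl (heq_of_eq (bot_ofNormal x.1 x.2))
  right_inv s := ext' rfl (Subgroup.map_subgroupOf_eq_of_le s.le)

/-- Summation over the normal subgroups `N ≤ M` of the coefficients. -/
theorem finsum_phiCoeff {T : Type u} [Group T] [Finite T] (M : NormalSubgroup T)
    (K : Subgroup T) [Decidable (M.1 = ⊥)] : ∑ᶠ N : NormalSubgroup T, phiCoeff R N M K =
      if M.1 = ⊥ then (Nat.card K : R) * (moebius K ⊤ : R) else 0 := by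
  classical
  have := Fintype.ofFinite (NormalSubgroup T)
  by_cases hM : M.1 ≤ frattini T
  · have h1 : ∀ N : NormalSubgroup T, phiCoeff R N M K =
        (moebius N M : R) * ((Nat.card K : R) * (moebius K ⊤ : R)) := by
      intro N
      unfold phiCoeff
      by_cases hN : N ≤ M
      · rw [if_pos ⟨hN, hM⟩]
      · rw [if_neg (fun h => hN h.1), moebius_eq_zero hN, Int.cast_zero, zero_mul]
    simp only [h1, finsum_eq_sum_of_fintype]
    rw [← Finset.sum_mul, ← Int.cast_sum]
    have h2 := sum_moebius_left (⟨⊥, inferInstance⟩ : NormalSubgroup T) M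
    have h3 : ∀ c : NormalSubgroup T, (⟨⊥, inferInstance⟩ : NormalSubgroup T) ≤ c :=
      fun c => (bot_le : (⊥ : Subgroup T) ≤ c.1)
    simp only [h3, if_true] at h2
    rw [h2]
    by_cases hb : M.1 = ⊥
    · rw [if_pos hb, if_pos (Subtype.ext hb.symm), Int.cast_one, one_mul]
    · rw [if_neg hb, if_neg (fun h => hb (congrArg Subtype.val h).symm), Int.cast_zero, zero_mul]
  · rw [finsum_eq_zero_of_forall_eq_zero, if_neg]
    · intro h
      exact hM (h ▸ bot_le)
    · intro N
      exact if_neg fun h => hM h.2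

/-- `zElem R T M K` does not involve `N`, so the sum over `N` can be taken on the coefficients,
where Möbius inversion leaves only `M = 1`. -/
theorem finsum_expansion_normal (T : Subgroup G) : ∑ᶠ N : NormalSubgroup T, expansion R T N =
    ∑ᶠ K : Subgroup T, ((Nat.card K : R) * (moebius K ⊤ : R)) •
      zElem R T ⟨⊥, inferInstance⟩ K := by
  classical
  unfold expansion
  rw [finsum_comm_of_finite, finsum_eq_single _ ⟨⊥, inferInstance⟩]
  · rw [finsum_comm_of_finite]
    refine finsum_congr fun K => ?_
    rw [← finsum_smul_of_finite, finsum_phiCoeff, if_pos rfl]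
  · intro M hM
    rw [finsum_comm_of_finite, finsum_eq_zero_of_forall_eq_zero]
    intro K
    rw [← finsum_smul_of_finite, finsum_phiCoeff, if_neg (fun h => hM (Subtype.ext h)), zero_smul]

/-- For `M = 1` the biset no longer remembers `T`; this permits the summation over `T` in
`finsum_expansion`. -/
theorem zElem_bot (T : Subgroup G) (K : Subgroup T) : zElem R T ⟨⊥, inferInstance⟩ K =
    RBurnside.mk R (Biset.coset (deltaSubgroup ⊥ ⊓ (K.map T.subtype).prod ⊤)) := by
  unfold zElem
  congr 2
  ext ⟨a, b⟩
  rw [mem_push]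
  simp only [Subgroup.mem_inf, Subgroup.mem_prod, Subgroup.mem_top, and_true,
    Biset.mem_deltaSubgroup, Subgroup.mem_bot, mul_inv_eq_one]
  constructor
  · rintro ⟨t, t', ⟨rfl, h⟩, h'⟩
    obtain ⟨rfl, rfl⟩ := Prod.ext_iff.1 h'
    exact ⟨rfl, t, h, rfl⟩
  · rintro ⟨rfl, t, h, rfl⟩
    exact ⟨t, t, ⟨rfl, h⟩, rfl⟩

/-- The identity of `G` as a sum over all sections. -/
theorem finsum_expansion :
    ∑ᶠ s : GroupSection G, expansion R s.T s.bot = (Nat.card G : R) • RB.id R G := by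
  classical
  have := Fintype.ofFinite (Subgroup G)
  have : ∀ T : Subgroup G, Fintype (NormalSubgroup T) := fun T => Fintype.ofFinite _
  have := Fintype.ofFinite (GroupSection G)
  have h1 : ∑ᶠ s : GroupSection G, expansion R s.T s.bot =
      ∑ᶠ T : Subgroup G, ∑ᶠ N : NormalSubgroup T, expansion R T N := by
    rw [← finsum_comp_equiv (equivSigma G)]
    simp only [finsum_eq_sum_of_fintype]
    rw [Fintype.sum_sigma]
    refine Finset.sum_congr rfl fun T _ => Finset.sum_congr rfl fun N _ => ?_
    exact congrArg (expansion R T) (bot_ofNormal T N)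
  have h2 : ∀ T : Subgroup G, ∑ᶠ N : NormalSubgroup T, expansion R T N =
      ∑ᶠ K : Subgroup G, ((Nat.card K : R) * (moebius K T : R)) •
        RBurnside.mk R (Biset.coset (deltaSubgroup ⊥ ⊓ K.prod ⊤)) := by
    intro T
    rw [finsum_expansion_normal]
    let j : Subgroup T ↪o Subgroup G :=
      OrderEmbedding.ofMapLEIff (Subgroup.map T.subtype) fun _ _ =>
        Subgroup.map_subtype_le_map_subtype
    have hj : ∀ K ≤ T, K ∈ Set.range j := fun K hK =>
      ⟨K.subgroupOf T, Subgroup.map_subgroupOf_eq_of_le hK⟩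
    refine finsum_of_injective j j.injective _ _ ?_ ?_
    · intro K hK
      rw [moebius_eq_zero (fun h => hK (hj K h)), Int.cast_zero, mul_zero, zero_smul]
    · intro K
      have h3 := moebius_orderEmbedding j K ⊤ fun y _ hy => hj y (by
        have : j ⊤ = T := by
          change Subgroup.map T.subtype ⊤ = T
          rw [← MonoidHom.range_eq_map, Subgroup.range_subtype]
        exact this ▸ hy)
      have h4 : j ⊤ = T := by
        change Subgroup.map T.subtype ⊤ = T
        rw [← MonoidHom.range_eq_map, Subgroup.range_subtype]
      rw [h4] at h3
      rw [zElem_bot, h3]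
      congr 3
      exact Nat.card_congr (K.equivMapOfInjective _ T.subtype_injective).toEquiv
  rw [h1]
  simp only [h2]
  -- With `K` fixed, `∑_T μ(K, T)` vanishes unless `K = G`, and then `T = G` is the only term.
  rw [finsum_comm_of_finite, finsum_eq_single _ (⊤ : Subgroup G)]
  · rw [finsum_eq_single _ (⊤ : Subgroup G)]
    · rw [moebius_self, Int.cast_one, mul_one, Subgroup.card_top, Subgroup.top_prod_top,
        inf_top_eq, ← RBurnside.mk_eq Biset.id_iso_coset]
      rfl
    · intro T hT
      rw [moebius_eq_zero (fun h => hT (top_le_iff.1 h)), Int.cast_zero, mul_zero, zero_smul]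
  · intro K hK
    rw [← finsum_smul_of_finite, finsum_eq_sum_of_fintype, ← Finset.mul_sum, ← Int.cast_sum]
    have h3 := sum_moebius_right K ⊤
    simp only [le_top, if_true, if_neg hK] at h3
    rw [h3, Int.cast_zero, mul_zero, zero_smul]

/-- The coefficients require `S ≤ M ≤ Φ(T)`. Hence non-minimal sections are harmless in a sum over
all sections, which is the sum that Möbius inversion needs. -/
theorem expansion_eq_zero {s : GroupSection G} (hs : ¬ s.IsMinimal) :
    expansion R s.T s.bot = 0 := by
  unfold expansion
  refine finsum_eq_zero_of_forall_eq_zero fun M => finsum_eq_zero_of_forall_eq_zero fun K => ?_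
  rw [phiCoeff, if_neg, zero_smul]
  rintro ⟨h1, h2⟩
  exact hs (le_trans (show s.bot.1 ≤ M.1 from h1) h2)

variable {R}

/-- The stabilizer of `(T, S)` under conjugation is `N_G(T,S)`, so `|G|` is the length of the orbit
times `|T| |N_G(T,S) : T|`. -/
theorem card_smul_epsilon (hG : IsUnit (Nat.card G : R)) {s : GroupSection G} (hs : s.IsMinimal) :
    (Nat.card (MulAction.orbit G s) : R) • expansion R s.T s.bot =
      (Nat.card G : R) • s.epsilon R := by
  classical
  have := Fintype.ofFinite G
  have := Fintype.ofFinite (MulAction.orbit G s)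
  have h1 : Nat.card (MulAction.orbit G s) * (Nat.card s.T * s.T.relIndex s.normalizer) =
      Nat.card G := by
    have h2 := MulAction.card_orbit_mul_card_stabilizer_eq_card_group G s
    have h3 := Subgroup.relIndex_mul_relIndex ⊥ s.T s.normalizer bot_le s.T_le_normalizer
    rw [Subgroup.relIndex_bot_left, Subgroup.relIndex_bot_left] at h3
    rw [h3, ← stabilizer_eq_normalizer, Nat.card_eq_fintype_card, Nat.card_eq_fintype_card,
      Nat.card_eq_fintype_card, ← h2]
  have h4 : IsUnit (s.T.relIndex s.normalizer : R) := by
    rw [← h1, Nat.cast_mul, Nat.cast_mul] at hG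
    exact isUnit_of_mul_isUnit_right (isUnit_of_mul_isUnit_right hG)
  have h5 : expansion R s.T s.bot = (Nat.card s.T : R) • RB.comp (s.u R) (s.v R) :=
    (card_smul_u_comp_v hG s hs).symm
  unfold epsilon
  rw [h5, ← h1, smul_smul, smul_smul, Nat.cast_mul, Nat.cast_mul, mul_assoc, mul_assoc,
    Ring.mul_inverse_cancel _ h4, mul_one]

/-- The idempotents `ε_{T,S}` sum to the identity. -/
theorem finsum_epsilon (hG : IsUnit (Nat.card G : R)) {X : Set (GroupSection G)}
    (hX : IsRepresentatives X) : ∑ᶠ s : X, s.1.epsilon R = RB.id R G := by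
  classical
  obtain ⟨hX1, hX2⟩ := hX
  refine (hG.smul_left_cancel).1 ?_
  have := Fintype.ofFinite (GroupSection G)
  have := Fintype.ofFinite X
  -- Conjugate sections have the same expansion, so a conjugacy class contributes its length times
  -- the expansion of its representative.
  have h1 : ∀ t : X, ∑ s : GroupSection G,
      (if s.IsConj t then expansion R s.T s.bot else 0) =
      (Nat.card G : R) • t.1.epsilon R := by
    intro t
    rw [← card_smul_epsilon hG (hX1 t t.2), ← Finset.sum_filter,
      Finset.sum_congr rfl (g := fun _ => expansion R t.1.T t.1.bot), Finset.sum_const,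
      ← Nat.cast_smul_eq_nsmul R]
    · congr 2
      rw [Nat.card_eq_card_toFinset]
      congr 1
      ext s
      simp only [Finset.mem_filter, Finset.mem_univ, true_and, Set.mem_toFinset]
      rw [isConj_iff_mem_orbit, MulAction.mem_orbit_symm]
    · intro s hs
      simp only [Finset.mem_filter, Finset.mem_univ, true_and] at hs
      rw [isConj_iff_mem_orbit] at hs
      obtain ⟨g, hg⟩ := hs
      change g • s = _ at hg
      rw [← hg, expansion_smul]
  rw [smul_finsum_of_finite, ← finsum_expansion, finsum_eq_sum_of_fintype,
    finsum_eq_sum_of_fintype]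
  simp only [← h1]
  rw [Finset.sum_comm]
  refine Finset.sum_congr rfl fun s _ => ?_
  by_cases hs : s.IsMinimal
  · obtain ⟨t, ⟨ht1, ht2⟩, ht3⟩ := hX2 s hs
    rw [Finset.sum_eq_single ⟨t, ht1⟩]
    · exact if_pos ht2
    · intro t' _ ht'
      refine if_neg fun h => ht' (Subtype.ext (ht3 t' ⟨t'.2, h⟩))
    · simp
  · simp [expansion_eq_zero R hs]

end GroupSection

/-! ### Frattini subgroups of `p`-groups and atoric groups. -/

section PGroup

variable {p : ℕ} [hp : Fact p.Prime]

theorem mem_of_zpow_mem {G : Type*} [Group G] {H : Subgroup G} {g : G} {i : ℤ}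
    (hi : ¬ (p : ℤ) ∣ i) (h1 : g ^ p ∈ H) (h2 : g ^ i ∈ H) : g ∈ H := by
  obtain ⟨a, b, hab⟩ := ((Nat.prime_iff_prime_int.1 hp.out).coprime_iff_not_dvd.2 hi)
  have h3 : g = (g ^ p) ^ a * (g ^ i) ^ b := by
    rw [← zpow_natCast, ← zpow_mul, ← zpow_mul, ← zpow_add, mul_comm (p : ℤ), mul_comm i, hab,
      zpow_one]
  rw [h3]
  exact mul_mem (zpow_mem h1 _) (zpow_mem h2 _)

variable {G H : Type u} [Group G] [Group H]

theorem normal_of_forall_commutator_mem {F A : Subgroup G}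
    (hc : ∀ x y : G, x * y * x⁻¹ * y⁻¹ ∈ F) (hA : F ≤ A) : A.Normal :=
  ⟨fun n hn g => by
    have := mul_mem (hA (hc g n)) hn
    simpa using this⟩

/-- Subgroups over `F` have complements over `F` if `G / F` is elementary abelian. -/
theorem exists_complement [Finite G] {F A : Subgroup G}
    (hc : ∀ x y : G, x * y * x⁻¹ * y⁻¹ ∈ F) (hF : ∀ x : G, x ^ p ∈ F) (hA : F ≤ A) :
    ∃ C, F ≤ C ∧ A ⊓ C = F ∧ A ⊔ C = ⊤ := by
  obtain ⟨C, hC⟩ := Set.Finite.exists_maximal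
    (Set.toFinite {C : Subgroup G | F ≤ C ∧ A ⊓ C ≤ F}) ⟨F, le_rfl, inf_le_right⟩
  have hFC := hC.prop.1
  refine ⟨C, hFC, le_antisymm hC.prop.2 (le_inf hA hFC), ?_⟩
  by_contra h
  obtain ⟨g, hg⟩ : ∃ g, g ∉ A ⊔ C := by
    by_contra! h'
    exact h (eq_top_iff.2 fun x _ => h' x)
  have hCn : C.Normal := normal_of_forall_commutator_mem hc hFC
  -- `C⟨g⟩` still meets `A` inside `F`: if `c gⁱ ∈ A`, then `gⁱ ∈ AC`, and as `g ∉ AC` while `gᵖ ∈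
  -- F`, the prime `p` divides `i`; so `gⁱ ∈ F ≤ C`.
  have h1 : C ⊔ Subgroup.zpowers g ≤ C := by
    refine hC.le_of_ge ⟨hFC.trans le_sup_left, ?_⟩ le_sup_left
    rintro x ⟨hxA, hx⟩
    obtain ⟨c, hc', y, ⟨i, rfl⟩, rfl⟩ := Subgroup.mem_sup_of_normal_left.1 hx
    have h2 : g ^ i ∈ A ⊔ C := by
      have := mul_mem (inv_mem (Subgroup.mem_sup_right (S := A) hc'))
        (Subgroup.mem_sup_left (T := C) hxA)
      simpa using this
    have h3 : (p : ℤ) ∣ i := by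
      by_contra h3
      exact hg (mem_of_zpow_mem h3 (Subgroup.mem_sup_left (hA (hF g))) h2)
    obtain ⟨j, rfl⟩ := h3
    have h4 : g ^ ((p : ℤ) * j) ∈ F := by
      rw [zpow_mul, zpow_natCast]
      exact zpow_mem (hF g) _
    exact hC.prop.2 ⟨hxA, mul_mem hc' (hFC h4)⟩
  exact hg (Subgroup.mem_sup_right (h1 (Subgroup.mem_sup_right (Subgroup.mem_zpowers g))))

/-- For `x ∈ Φ(G)` let `C` be a complement of `F⟨x⟩` over `F`. Then `C` and `x` generate `G`, and
`x` is a non-generator, so `C = G` and `F⟨x⟩ = F`. -/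
theorem frattini_le_of_elementary [Finite G] {F : Subgroup G}
    (hc : ∀ x y : G, x * y * x⁻¹ * y⁻¹ ∈ F) (hF : ∀ x : G, x ^ p ∈ F) : frattini G ≤ F := by
  intro x hx
  obtain ⟨C, hC1, hC2, hC3⟩ := exists_complement hc hF
    (le_sup_left : F ≤ F ⊔ Subgroup.zpowers x)
  have h1 : C = ⊤ := by
    refine frattini_nongenerating (top_le_iff.1 ?_)
    rw [← hC3]
    refine sup_le (sup_le (hC1.trans le_sup_left) ?_) le_sup_left
    exact (Subgroup.zpowers_le.2 hx).trans le_sup_right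
  rw [h1, inf_top_eq] at hC2
  rw [← hC2]
  exact Subgroup.mem_sup_right (Subgroup.mem_zpowers x)

/-- Maximal subgroups of a finite `p`-group are normal by nilpotency, and the quotient has order
dividing `p`: otherwise a subgroup of order `p` in it would give a proper intermediate subgroup. -/
theorem coatom_elementary [Finite G] (hG : IsPGroup p G) {C : Subgroup G} (hC : IsCoatom C) :
    (∀ x y : G, x * y * x⁻¹ * y⁻¹ ∈ C) ∧ ∀ x : G, x ^ p ∈ C := by
  have hnil : Group.IsNilpotent G := hG.isNilpotent
  have hn : C.Normal := Subgroup.NormalizerCondition.normal_of_coatom C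
    Group.normalizerCondition_of_isNilpotent hC
  obtain ⟨n, hn'⟩ := IsPGroup.iff_card.1 (hG.to_quotient C)
  have hn1 : n ≤ 1 := by
    by_contra h
    obtain ⟨K, hK⟩ := Sylow.exists_subgroup_card_pow_prime p (n := 1)
      (show p ^ 1 ∣ Nat.card (G ⧸ C) by
        rw [hn']
        exact pow_dvd_pow p (by omega))
    have hp1 := hp.out.one_lt
    have h1 : C < K.comap (QuotientGroup.mk' C) := by
      refine lt_of_le_of_ne ?_ ?_
      · intro x hx
        rw [Subgroup.mem_comap, QuotientGroup.mk'_apply, (QuotientGroup.eq_one_iff x).2 hx]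
        exact one_mem _
      · intro h2
        have h3 := Subgroup.map_comap_eq_self_of_surjective (QuotientGroup.mk'_surjective C) K
        rw [← h2, QuotientGroup.map_mk'_self] at h3
        rw [← h3, Subgroup.card_bot, pow_one] at hK
        omega
    have h2 := hC.2 _ h1
    have h3 := Subgroup.map_comap_eq_self_of_surjective (QuotientGroup.mk'_surjective C) K
    rw [h2, Subgroup.map_top_of_surjective _ (QuotientGroup.mk'_surjective C)] at h3
    rw [← h3, Subgroup.card_top, hn'] at hK
    have := Nat.pow_right_injective hp.out.two_le hK
    omega
  have hcard : Nat.card (G ⧸ C) ∣ p := by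
    rw [hn']
    exact (pow_dvd_pow p hn1).trans (by rw [pow_one])
  have hcomm : ∀ x y : G ⧸ C, x * y = y * x := by
    rcases (Nat.dvd_prime hp.out).1 hcard with h | h
    · have := (Nat.card_eq_one_iff_unique.1 h).1
      exact fun x y => Subsingleton.elim _ _
    · have := isCyclic_of_prime_card h
      let := IsCyclic.commGroup (α := G ⧸ C)
      exact fun x y => mul_comm x y
  constructor
  · intro x y
    rw [← QuotientGroup.eq_one_iff]
    change (x : G ⧸ C) * y * (x : G ⧸ C)⁻¹ * (y : G ⧸ C)⁻¹ = 1
    rw [hcomm x y]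
    group
  · intro x
    rw [← QuotientGroup.eq_one_iff]
    change (x : G ⧸ C) ^ p = 1
    obtain ⟨k, hk⟩ := hcard
    rw [hk, pow_mul, pow_card_eq_one', one_pow]

theorem mem_frattini_iff {x : G} : x ∈ frattini G ↔ ∀ C : Subgroup G, IsCoatom C → x ∈ C := by
  rw [frattini, Order.radical]
  simp only [Subgroup.mem_iInf]
  rfl

theorem commutator_mem_frattini [Finite G] (hG : IsPGroup p G) (x y : G) :
    x * y * x⁻¹ * y⁻¹ ∈ frattini G :=
  mem_frattini_iff.2 fun _ hC => (coatom_elementary hG hC).1 x y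

theorem pow_mem_frattini [Finite G] (hG : IsPGroup p G) (x : G) : x ^ p ∈ frattini G :=
  mem_frattini_iff.2 fun _ hC => (coatom_elementary hG hC).2 x

/-- The preimage of `Φ(G)` contains all commutators and `p`-th powers, so
`frattini_le_of_elementary` applies to it. -/
theorem frattini_le_comap_of_injective [Finite G] [Finite H] (hG : IsPGroup p G) (i : H →* G) :
    frattini H ≤ (frattini G).comap i :=
  frattini_le_of_elementary (p := p)
    (fun x y => by simpa using commutator_mem_frattini hG (i x) (i y))
    (fun x => by simpa using pow_mem_frattini hG (i x))

section Disjoint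

variable [Finite G] (hG : IsPGroup p G) {N : Subgroup G} [N.Normal] (hN : N ⊓ frattini G = ⊥)
include hG hN

/-- A commutator `[n, x]` lies in `N` by normality and in `Φ(G)` because `G/Φ(G)` is abelian. -/
theorem commute_of_inf_frattini_eq_bot {n : G} (hn : n ∈ N) (x : G) : n * x = x * n := by
  have h1 : n * x * n⁻¹ * x⁻¹ ∈ N ⊓ frattini G := by
    refine ⟨?_, commutator_mem_frattini hG n x⟩
    have := mul_mem hn (Subgroup.Normal.conj_mem ‹N.Normal› _ (inv_mem hn) x)
    simpa [mul_assoc] using this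
  rw [hN, Subgroup.mem_bot] at h1
  have h2 := mul_inv_eq_one.1 h1
  exact mul_inv_eq_iff_eq_mul.1 h2

theorem pow_eq_one_of_inf_frattini_eq_bot {n : G} (hn : n ∈ N) : n ^ p = 1 := by
  have : n ^ p ∈ N ⊓ frattini G := ⟨pow_mem hn _, pow_mem_frattini hG n⟩
  rwa [hN] at this

/-- A complement of `NΦ(G)` over `Φ(G)` is a complement of `N`, since `N` meets `Φ(G)` trivially. -/
theorem exists_isCompl : ∃ C, frattini G ≤ C ∧ N ⊓ C = ⊥ ∧ N ⊔ C = ⊤ := by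
  obtain ⟨C, h1, h2, h3⟩ := exists_complement (commutator_mem_frattini hG) (pow_mem_frattini hG)
    (le_sup_right : frattini G ≤ N ⊔ frattini G)
  refine ⟨C, h1, ?_, ?_⟩
  · refine le_bot_iff.1 (le_trans (le_inf inf_le_left ?_) hN.le)
    rw [← h2]
    exact inf_le_inf_right _ le_sup_left
  · rw [eq_top_iff, ← h3]
    exact sup_le (sup_le le_sup_left (h1.trans le_sup_right)) le_sup_right

end Disjoint

/-- If `N` meets `Φ(G)` trivially, it is central, elementary abelian and complemented, hence a
direct factor. Conversely, for `G = E × Q` with `E` elementary abelian, `Φ(E) = 1`, so `Φ(G)`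
projects trivially to `E` and meets that factor trivially. -/
theorem isAtoric_iff [Finite G] (hG : IsPGroup p G) :
    IsAtoric p G ↔ ∀ N : Subgroup G, N.Normal → N ⊓ frattini G = ⊥ → N = ⊥ := by
  constructor
  · intro h N hNn hN
    obtain ⟨C, hC1, hC2, hC3⟩ := exists_isCompl hG hN
    let f : N × C →* G := MonoidHom.noncommCoprod N.subtype C.subtype fun n c =>
      commute_of_inf_frattini_eq_bot hG hN n.2 c
    have hf : Function.Bijective f := by
      constructor
      · rw [injective_iff_map_eq_one]
        rintro ⟨n, c⟩ h
        change (n : G) * c = 1 at h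
        have h1 : (c : G) ∈ N ⊓ C :=
          ⟨inv_eq_of_mul_eq_one_right h ▸ N.inv_mem n.2, c.2⟩
        rw [hC2, Subgroup.mem_bot] at h1
        rw [h1, mul_one] at h
        exact Prod.ext (Subtype.ext h) (Subtype.ext h1)
      · intro x
        have hx : x ∈ N ⊔ C := hC3 ▸ trivial
        obtain ⟨n, hn, c, hc, rfl⟩ := Subgroup.mem_sup_of_normal_left.1 hx
        exact ⟨(⟨n, hn⟩, ⟨c, hc⟩), rfl⟩
    have := h.subsingleton N C
      ⟨fun x y => Subtype.ext (commute_of_inf_frattini_eq_bot hG hN x.2 y),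
        fun x => Subtype.ext (pow_eq_one_of_inf_frattini_eq_bot hG hN x.2)⟩
      ⟨(MulEquiv.ofBijective f hf).symm⟩
    exact (Subgroup.eq_bot_iff_forall N).2 fun x hx =>
      congrArg Subtype.val (Subsingleton.elim (⟨x, hx⟩ : N) 1)
  · intro h
    refine ⟨inferInstance, hG, ?_⟩
    rintro E Q _ _ ⟨hE1, hE2⟩ ⟨e⟩
    have hsurj : Function.Surjective ((MonoidHom.fst E Q).comp e.toMonoidHom) :=
      Prod.fst_surjective.comp e.surjective
    have hfin : Finite E := Finite.of_surjective _ hsurj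
    have hE : frattini E = ⊥ := le_bot_iff.1 (frattini_le_of_elementary (p := p)
      (fun x y => by rw [hE1 x y, Subgroup.mem_bot]; group)
      (fun x => (Subgroup.mem_bot).2 (hE2 x)))
    have h1 := h ((MonoidHom.snd E Q).comp e.toMonoidHom).ker inferInstance (by
      rw [Subgroup.eq_bot_iff_forall]
      rintro x ⟨hx1, hx2⟩
      have hx3 := frattini_le_comap_frattini_of_surjective hsurj hx2
      rw [hE] at hx3
      have h4 : e x = 1 := Prod.ext hx3 hx1
      exact (map_eq_one_iff e e.injective).1 h4)
    refine ⟨fun a b => ?_⟩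
    have h2 : ∀ a : E, a = 1 := by
      intro a
      have h3 : e.symm (a, 1) ∈ ((MonoidHom.snd E Q).comp e.toMonoidHom).ker := by
        rw [MonoidHom.mem_ker]
        change (e (e.symm (a, 1))).2 = 1
        rw [e.apply_symm_apply]
      rw [h1, Subgroup.mem_bot, map_eq_one_iff e.symm e.symm.injective] at h3
      exact congrArg Prod.fst h3
    rw [h2 a, h2 b]

/-- If `w` were outside `NΦ(G)`, then `N⟨w⟩` would be a larger normal subgroup meeting `Φ(G)`
trivially: `n wⁱ ∈ Φ(G)` puts `wⁱ` in `NΦ(G)`, so `p` divides `i` and `wⁱ = 1`. -/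
theorem mem_sup_frattini_of_maximal [Finite G] {N : Subgroup G}
    (hN : Maximal (fun N : Subgroup G => N.Normal ∧ N ⊓ frattini G = ⊥) N) {w : G}
    (hw1 : ∀ x, w * x = x * w) (hw2 : w ^ p = 1) : w ∈ N ⊔ frattini G := by
  by_contra hw
  have hNn : N.Normal := hN.prop.1
  have hz : (Subgroup.zpowers w).Normal := ⟨by
    rintro _ ⟨i, rfl⟩ g
    refine ⟨i, ?_⟩
    have : Commute (w ^ i) g := Commute.zpow_left (hw1 g) i
    simp only
    rw [← this.eq, mul_inv_cancel_right]⟩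
  have h1 : N ⊔ Subgroup.zpowers w ≤ N := by
    refine hN.le_of_ge ⟨inferInstance, ?_⟩ le_sup_left
    rw [Subgroup.eq_bot_iff_forall]
    rintro x ⟨hx, hxf⟩
    obtain ⟨n, hn, y, ⟨i, rfl⟩, rfl⟩ := Subgroup.mem_sup_of_normal_left.1 hx
    have h2 : w ^ i ∈ N ⊔ frattini G := by
      have := mul_mem (inv_mem (Subgroup.mem_sup_left (T := frattini G) hn))
        (Subgroup.mem_sup_right (S := N) hxf)
      simpa using this
    have h3 : (p : ℤ) ∣ i := by
      by_contra h3
      exact hw (mem_of_zpow_mem h3 (hw2 ▸ one_mem _) h2)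
    obtain ⟨j, rfl⟩ := h3
    have h4 : w ^ ((p : ℤ) * j) = 1 := by rw [zpow_mul, zpow_natCast, hw2, one_zpow]
    simp only [h4, mul_one] at hxf ⊢
    have h5 : n ∈ N ⊓ frattini G := ⟨hn, hxf⟩
    rwa [hN.prop.2] at h5
  exact hw (Subgroup.mem_sup_left (h1 (Subgroup.mem_sup_right (Subgroup.mem_zpowers w))))

/-- A complement of a normal subgroup is isomorphic to the quotient. -/
theorem nonempty_quotient_equiv {N C : Subgroup G} [N.Normal] (h1 : N ⊓ C = ⊥)
    (h2 : N ⊔ C = ⊤) : Nonempty (G ⧸ N ≃* C) := by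
  refine ⟨(MulEquiv.ofBijective ((QuotientGroup.mk' N).comp C.subtype) ⟨?_, ?_⟩).symm⟩
  · rw [injective_iff_map_eq_one]
    intro c hc
    have h3 : (c : G) ∈ N ⊓ C := ⟨(QuotientGroup.eq_one_iff _).1 hc, c.2⟩
    rw [h1, Subgroup.mem_bot] at h3
    exact Subtype.ext h3
  · intro x
    obtain ⟨x, rfl⟩ := QuotientGroup.mk_surjective x
    have hx : x ∈ N ⊔ C := h2 ▸ trivial
    obtain ⟨n, hn, c, hc, rfl⟩ := Subgroup.mem_sup_of_normal_left.1 hx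
    refine ⟨⟨c, hc⟩, ?_⟩
    change (c : G ⧸ N) = (n : G ⧸ N) * (c : G ⧸ N)
    rw [(QuotientGroup.eq_one_iff n).2 hn, one_mul]

/-- Elements of `N` are central of order dividing `p`, so `mem_sup_frattini_of_maximal` yields
`NΦ(G) = N'Φ(G)`. A complement of this group over `Φ(G)` is a complement of both `N` and `N'`. Thus
`G^@` does not depend on the choice of kernel. -/
theorem nonempty_quotient_equiv_of_maximal [Finite G] (hG : IsPGroup p G) {N N' : Subgroup G}
    [N.Normal] [N'.Normal]
    (hN : Maximal (fun N : Subgroup G => N.Normal ∧ N ⊓ frattini G = ⊥) N)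
    (hN' : Maximal (fun N : Subgroup G => N.Normal ∧ N ⊓ frattini G = ⊥) N') :
    Nonempty (G ⧸ N ≃* G ⧸ N') := by
  have key : ∀ {N N' : Subgroup G},
      Maximal (fun N : Subgroup G => N.Normal ∧ N ⊓ frattini G = ⊥) N →
      Maximal (fun N : Subgroup G => N.Normal ∧ N ⊓ frattini G = ⊥) N' →
      N ⊔ frattini G ≤ N' ⊔ frattini G := by
    intro N N' hN hN'
    have := hN.prop.1
    refine sup_le (fun n hn => ?_) le_sup_right
    exact mem_sup_frattini_of_maximal hN' (commute_of_inf_frattini_eq_bot hG hN.prop.2 hn)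
      (pow_eq_one_of_inf_frattini_eq_bot hG hN.prop.2 hn)
  have heq : N' ⊔ frattini G = N ⊔ frattini G := le_antisymm (key hN' hN) (key hN hN')
  obtain ⟨C, h1, h2, h3⟩ := exists_complement (commutator_mem_frattini hG) (pow_mem_frattini hG)
    (le_sup_right : frattini G ≤ N ⊔ frattini G)
  have key2 : ∀ {N : Subgroup G}, N ⊓ frattini G = ⊥ → (N ⊔ frattini G) ⊓ C = frattini G →
      (N ⊔ frattini G) ⊔ C = ⊤ → N ⊓ C = ⊥ ∧ N ⊔ C = ⊤ := by
    intro N hN h2 h3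
    constructor
    · refine le_bot_iff.1 (le_trans (le_inf inf_le_left ?_) hN.le)
      rw [← h2]
      exact inf_le_inf_right _ le_sup_left
    · rw [eq_top_iff, ← h3]
      exact sup_le (sup_le le_sup_left (h1.trans le_sup_right)) le_sup_right
  obtain ⟨e⟩ := nonempty_quotient_equiv (key2 hN.prop.2 h2 h3).1 (key2 hN.prop.2 h2 h3).2
  rw [← heq] at h2 h3
  obtain ⟨e'⟩ := nonempty_quotient_equiv (key2 hN'.prop.2 h2 h3).1 (key2 hN'.prop.2 h2 h3).2
  exact ⟨e.trans e'.symm⟩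

/-- `Q^@ ≅ G^@` if `Q` is a quotient of `G` by a normal subgroup that meets `Φ(G)` trivially. -/
theorem nonempty_atQuotient_equiv [Finite G] [Finite H] (hG : IsPGroup p G) {f : G →* H}
    (hf : Function.Surjective f) (hker : f.ker ⊓ frattini G = ⊥) :
    Nonempty (AtQuotient G ≃* AtQuotient H) := by
  have hH : IsPGroup p H := hG.of_surjective f hf
  let g : G →* AtQuotient H := (QuotientGroup.mk' (atKernel H)).comp f
  have hg : Function.Surjective g := (QuotientGroup.mk'_surjective _).comp hf
  have hgker : ∀ x, x ∈ g.ker ↔ f x ∈ atKernel H := fun x => QuotientGroup.eq_one_iff (f x)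
  have hspec := atKernel_spec H
  have hfr : frattini H ≤ (frattini G).map f := by
    refine frattini_le_of_elementary (p := p) (fun x y => ?_) (fun x => ?_)
    · obtain ⟨x, rfl⟩ := hf x
      obtain ⟨y, rfl⟩ := hf y
      exact ⟨_, commutator_mem_frattini hG x y, by simp⟩
    · obtain ⟨x, rfl⟩ := hf x
      exact ⟨_, pow_mem_frattini hG x, by simp⟩
  -- The preimage in `G` of the chosen kernel for `H` is again maximal, so `H^@` is a quotient of
  -- `G` by a legitimate choice of kernel.
  have hmax : Maximal (fun N : Subgroup G => N.Normal ∧ N ⊓ frattini G = ⊥) g.ker := by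
    refine ⟨⟨inferInstance, ?_⟩, ?_⟩
    · rw [Subgroup.eq_bot_iff_forall]
      rintro x ⟨hx1, hx2⟩
      have h1 : f x ∈ atKernel H ⊓ frattini H :=
        ⟨(hgker x).1 hx1, frattini_le_comap_frattini_of_surjective hf hx2⟩
      rw [hspec.prop.2] at h1
      have h2 : x ∈ f.ker ⊓ frattini G := ⟨h1, hx2⟩
      rwa [hker] at h2
    · rintro M ⟨hM1, hM2⟩ hM x hx
      rw [hgker]
      have hkM : f.ker ≤ M := by
        intro y hy
        refine hM ((hgker y).2 ?_)
        rw [MonoidHom.mem_ker.1 hy]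
        exact one_mem _
      refine hspec.le_of_ge (y := M.map f) ⟨hM1.map f hf, ?_⟩ ?_ ⟨x, hx, rfl⟩
      · rw [Subgroup.eq_bot_iff_forall]
        rintro _ ⟨⟨m, hm, rfl⟩, hm2⟩
        obtain ⟨z, hz, hzm⟩ := hfr hm2
        have h1 : z⁻¹ * m ∈ f.ker := by
          rw [MonoidHom.mem_ker, map_mul, map_inv, hzm, inv_mul_cancel]
        have h2 : z ∈ M ⊓ frattini G := by
          refine ⟨?_, hz⟩
          have := mul_mem hm (inv_mem (hkM h1))
          simpa using this
        rw [hM2, Subgroup.mem_bot] at h2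
        rw [← hzm, h2, map_one]
      · intro y hy
        obtain ⟨x, rfl⟩ := hf y
        exact ⟨x, hM ((hgker x).2 hy), rfl⟩
  obtain ⟨e⟩ := nonempty_quotient_equiv_of_maximal hG (atKernel_spec G) hmax
  exact ⟨e.trans (QuotientGroup.quotientKerEquivOfSurjective g hg)⟩

theorem nonempty_atQuotient_congr [Finite G] [Finite H] (hG : IsPGroup p G) (e : G ≃* H) :
    Nonempty (AtQuotient G ≃* AtQuotient H) :=
  nonempty_atQuotient_equiv hG (f := e.toMonoidHom) e.surjective (by
    rw [(MonoidHom.ker_eq_bot_iff e.toMonoidHom).2 e.injective, bot_inf_eq])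

/-- The preimage of a normal subgroup meeting the Frattini subgroup trivially has the same property
in `G`; by maximality it is no larger than the kernel. -/
theorem isAtoric_atQuotient [Finite G] (hG : IsPGroup p G) : IsAtoric p (AtQuotient G) := by
  rw [isAtoric_iff (hG.to_quotient _)]
  intro M hMn hM
  have hspec := atKernel_spec G
  have h1 : M.comap (QuotientGroup.mk' (atKernel G)) ≤ atKernel G := by
    refine hspec.le_of_ge ⟨inferInstance, ?_⟩ ?_
    · rw [Subgroup.eq_bot_iff_forall]
      rintro x ⟨hx1, hx2⟩
      have h1 : (x : AtQuotient G) ∈ M ⊓ frattini (AtQuotient G) := ⟨hx1,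
        frattini_le_comap_frattini_of_surjective (QuotientGroup.mk'_surjective (atKernel G)) hx2⟩
      rw [hM] at h1
      have h2 : x ∈ atKernel G ⊓ frattini G := ⟨(QuotientGroup.eq_one_iff x).1 h1, hx2⟩
      rwa [hspec.prop.2] at h2
    · intro x hx
      change (x : AtQuotient G) ∈ M
      rw [(QuotientGroup.eq_one_iff x).2 hx]
      exact one_mem _
  rw [Subgroup.eq_bot_iff_forall]
  intro y hy
  obtain ⟨x, rfl⟩ := QuotientGroup.mk_surjective y
  exact (QuotientGroup.eq_one_iff x).2 (h1 hy)

theorem IsAtoric.nonempty_equiv_atQuotient [Finite G] (hG : IsAtoric p G) :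
    Nonempty (AtQuotient G ≃* G) := by
  have h := (isAtoric_iff hG.isPGroup).1 hG (atKernel G) inferInstance (atKernel_spec G).prop.2
  exact ⟨(QuotientGroup.quotientMulEquivOfEq h).trans QuotientGroup.quotientBot⟩

theorem IsAtoric.mem_frattini_of_central [Finite G] (hG : IsAtoric p G) {z : G}
    (hz1 : ∀ x, z * x = x * z) (hz2 : z ^ p = 1) : z ∈ frattini G := by
  have hb : Maximal (fun N : Subgroup G => N.Normal ∧ N ⊓ frattini G = ⊥) ⊥ :=
    ⟨⟨inferInstance, bot_inf_eq _⟩, fun M hM _ =>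
      ((isAtoric_iff hG.isPGroup).1 hG M hM.1 hM.2).le⟩
  have := mem_sup_frattini_of_maximal hb hz1 hz2
  rwa [bot_sup_eq] at this

end PGroup

/-! ### Subquotients and minimal sections. -/

section Subquotient

variable {G H K : Type u} [Group G] [Group H] [Group K]

/-- The section of `G` defined by an injective homomorphism `i : K →* G` and a homomorphism
`f : K →* H`. -/
def GroupSection.ofHom (i : K →* G) (f : K →* H) : GroupSection G where
  T := i.range
  S := f.ker.map i
  le := Subgroup.map_le_range i _
  normal := by
    rw [Subgroup.normal_subgroupOf_iff (Subgroup.map_le_range i _)]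
    rintro _ _ ⟨x, hx, rfl⟩ ⟨y, rfl⟩
    exact ⟨y * x * y⁻¹, Subgroup.Normal.conj_mem inferInstance _ hx _, by simp⟩

/-- The top group of `ofHom i f` is isomorphic to the domain of `i`. -/
def GroupSection.ofHomEquiv {i : K →* G} (hi : Function.Injective i) (f : K →* H) :
    K ≃* (ofHom i f).T := MonoidHom.ofInjective hi

theorem GroupSection.ofHom_bot {i : K →* G} (hi : Function.Injective i) (f : K →* H) :
    (ofHom i f).S.subgroupOf (ofHom i f).T = (ofHomEquiv hi f).mapSubgroup f.ker := by
  ext ⟨x, hx⟩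
  constructor
  · rintro ⟨y, hy, hyx⟩
    exact ⟨y, hy, Subtype.ext hyx⟩
  · rintro ⟨y, hy, hyx⟩
    exact ⟨y, hy, congrArg Subtype.val hyx⟩

theorem GroupSection.nonempty_ofHom_quot {i : K →* G} (hi : Function.Injective i) {f : K →* H}
    (hf : Function.Surjective f) : Nonempty ((ofHom i f).quot ≃* H) := by
  let e := ofHomEquiv hi f
  let g : (ofHom i f).T →* H := f.comp e.symm.toMonoidHom
  have hg : Function.Surjective g := hf.comp e.symm.surjective
  have hk : (ofHom i f).S.subgroupOf (ofHom i f).T = g.ker := by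
    rw [ofHom_bot hi]
    ext x
    obtain ⟨y, rfl⟩ := e.surjective x
    change e y ∈ f.ker.map e.toMonoidHom ↔ f (e.symm (e y)) = 1
    rw [e.symm_apply_apply]
    exact Subgroup.mem_map_iff_mem (f := e.toMonoidHom) e.injective
  exact ⟨(QuotientGroup.quotientMulEquivOfEq hk).trans
    (QuotientGroup.quotientKerEquivOfSurjective g hg)⟩

theorem GroupSection.isMinimal_ofHom [Finite G] [Finite K] {i : K →* G}
    (hi : Function.Injective i) {f : K →* H} (hf : f.ker ≤ frattini K) :
    (ofHom i f).IsMinimal := by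
  unfold IsMinimal
  rw [ofHom_bot hi, ← map_frattini (ofHomEquiv hi f)]
  exact (ofHomEquiv hi f).mapSubgroup.monotone hf

theorem IsSubquotient.exists_hom (h : IsSubquotient H G) : ∃ (T : Subgroup G) (f : T →* H),
    Function.Surjective f := by
  obtain ⟨s, ⟨e⟩⟩ := h
  exact ⟨s.T, e.toMonoidHom.comp (QuotientGroup.mk' _),
    e.surjective.comp (QuotientGroup.mk'_surjective _)⟩

theorem isSubquotient_of_hom {i : K →* G} (hi : Function.Injective i) {f : K →* H}
    (hf : Function.Surjective f) : IsSubquotient H G :=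
  ⟨GroupSection.ofHom i f, GroupSection.nonempty_ofHom_quot hi hf⟩

theorem IsSubquotient.of_surjective {Q : Type u} [Group Q] (h : IsSubquotient H Q) (f : G →* Q)
    (hf : Function.Surjective f) : IsSubquotient H G := by
  obtain ⟨T, g, hg⟩ := h.exists_hom
  refine isSubquotient_of_hom (T.comap f).subtype_injective
    (f := g.comp (f.subgroupComap T)) (hg.comp ?_)
  rintro ⟨y, hy⟩
  obtain ⟨x, rfl⟩ := hf y
  exact ⟨⟨x, hy⟩, rfl⟩

/-- Every subquotient is given by a minimal section. -/
theorem IsSubquotient.exists_isMinimal [Finite G] (h : IsSubquotient H G) :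
    ∃ s : GroupSection G, s.IsMinimal ∧ Nonempty (s.quot ≃* H) := by
  obtain ⟨K, f, hf⟩ := h.exists_hom
  -- For `T` minimal among the subgroups mapping onto `H`, the kernel lies in every maximal subgroup
  -- `C` of `T`: otherwise `C` and the kernel generate `T`, and `C` would already map onto `H`.
  obtain ⟨T, hT⟩ := Set.Finite.exists_minimal
    (Set.toFinite {T : Subgroup K | T.map f = ⊤}) ⟨⊤, Subgroup.map_top_of_surjective f hf⟩
  have hTf : Function.Surjective (f.comp T.subtype) := by
    intro y
    have hy : y ∈ T.map f := by
      rw [show T.map f = ⊤ from hT.prop]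
      trivial
    obtain ⟨x, hx, rfl⟩ := hy
    exact ⟨⟨x, hx⟩, rfl⟩
  have hi : Function.Injective (K.subtype.comp T.subtype) :=
    Subtype.val_injective.comp Subtype.val_injective
  refine ⟨GroupSection.ofHom (K.subtype.comp T.subtype) (f.comp T.subtype), ?_,
    GroupSection.nonempty_ofHom_quot hi hTf⟩
  refine GroupSection.isMinimal_ofHom hi ?_
  intro x hx
  rw [mem_frattini_iff]
  intro C hC
  by_contra hxC
  have h1 : C ⊔ (f.comp T.subtype).ker = ⊤ := by
    refine hC.2 _ (lt_of_le_of_ne le_sup_left fun h => hxC ?_)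
    rw [h]
    exact Subgroup.mem_sup_right hx
  have h2 : C.map (f.comp T.subtype) = ⊤ := by
    rw [← Subgroup.map_top_of_surjective _ hTf, ← h1, Subgroup.map_sup,
      (Subgroup.map_eq_bot_iff _).2 le_rfl, sup_bot_eq]
  have h3 := hT.le_of_le (y := C.map T.subtype) (by
    change (C.map T.subtype).map f = ⊤
    rw [Subgroup.map_map, h2]) (Subgroup.map_subtype_le C)
  refine hC.1 (eq_top_iff.2 fun t _ => ?_)
  obtain ⟨c, hc, hct⟩ := h3 t.2
  have : c = t := Subtype.ext hct
  exact this ▸ hc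

/-- An atoric subquotient of `G` is a subquotient of the quotients of `G` by normal subgroups
that meet `Φ(G)` trivially. -/
theorem IsSubquotient.of_ker_inf_frattini {p : ℕ} [hp : Fact p.Prime] {L Q : Type u} [Group L]
    [Group Q] [Finite G] (hG : IsPGroup p G) (hL : IsAtoric p L) (h : IsSubquotient L G)
    (f : G →* Q) (hker : f.ker ⊓ frattini G = ⊥) : IsSubquotient L Q := by
  obtain ⟨T, g, hg⟩ := h.exists_hom
  have hT : IsPGroup p T := hG.to_subgroup T
  have hLfin := hL.finite
  let A : Subgroup T := (f.comp T.subtype).ker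
  have hA : A ⊓ frattini T = ⊥ := by
    rw [Subgroup.eq_bot_iff_forall]
    rintro x ⟨hx1, hx2⟩
    have h1 : (x : G) ∈ f.ker ⊓ frattini G :=
      ⟨hx1, frattini_le_comap_of_injective hG T.subtype hx2⟩
    rw [hker] at h1
    exact Subtype.ext h1
  obtain ⟨C, -, hC2, hC3⟩ := exists_isCompl hT hA
  -- `A` is central in `T` of exponent dividing `p`, hence so is its image in `L`; as `L` is atoric,
  -- such elements lie in `Φ(L)`.
  have h1 : A.map g ≤ frattini L := by
    rintro _ ⟨a, ha, rfl⟩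
    refine hL.mem_frattini_of_central (fun y => ?_) ?_
    · obtain ⟨y, rfl⟩ := hg y
      rw [← map_mul, ← map_mul, commute_of_inf_frattini_eq_bot hT hA ha]
    · rw [← map_pow, pow_eq_one_of_inf_frattini_eq_bot hT hA ha, map_one]
  -- The image of `A` consists of non-generators, so the complement `C` already maps onto `L`;
  -- moreover `C` embeds in `Q`.
  have h2 : C.map g = ⊤ := by
    refine frattini_nongenerating (top_le_iff.1 ?_)
    rw [← Subgroup.map_top_of_surjective g hg, ← hC3, Subgroup.map_sup]
    exact sup_le (h1.trans le_sup_right) le_sup_left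
  refine isSubquotient_of_hom (K := C) (i := (f.comp T.subtype).comp C.subtype)
    (f := g.comp C.subtype) ?_ ?_
  · rw [injective_iff_map_eq_one]
    intro c hc
    have h3 : (c : T) ∈ A ⊓ C := ⟨hc, c.2⟩
    rw [hC2] at h3
    exact Subtype.ext h3
  · intro y
    have hy : y ∈ C.map g := h2 ▸ trivial
    obtain ⟨c, hc, rfl⟩ := hy
    exact ⟨⟨c, hc⟩, rfl⟩

end Subquotient

/-! ### Vanishing of products for different atoric quotients. -/

section Vanishing

variable {R : Type v} [CommRing R] {p : ℕ} [hp : Fact p.Prime]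

theorem IsPGroup.isUnit_card {G : Type u} [Group G] [Finite G] (hpR : IsUnit (p : R))
    (hG : IsPGroup p G) : IsUnit (Nat.card G : R) := by
  obtain ⟨n, hn⟩ := IsPGroup.iff_card.1 hG
  rw [hn, Nat.cast_pow]
  exact hpR.pow n

variable {G H : Type u} [Group G] [Group H] [Finite G] [Finite H]

theorem exists_iso_biset_coset (A : Subgroup (G × Hᵐᵒᵖ)) :
    ∃ L : Subgroup (G × H), (FinGSet.coset A : Biset G H).Iso (Biset.coset L) := by
  let ψ : G × Hᵐᵒᵖ →* G × H :=
    { toFun := fun c => (c.1, c.2.unop⁻¹)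
      map_one' := by simp
      map_mul' := fun c d => by simp }
  refine ⟨A.map ψ, Biset.iso_coset
    (show (FinGSet.coset A : Biset G H) from ((1 : G × Hᵐᵒᵖ) : (G × Hᵐᵒᵖ) ⧸ A)) ?_ _ ?_⟩
  · intro z
    obtain ⟨c, rfl⟩ := QuotientGroup.mk_surjective z
    refine ⟨c, ?_⟩
    change ((c * 1 : G × Hᵐᵒᵖ) : (G × Hᵐᵒᵖ) ⧸ A) = c
    rw [mul_one]
  · intro g h
    have h1 : ((((g, op h⁻¹) : G × Hᵐᵒᵖ) * 1 : G × Hᵐᵒᵖ) : (G × Hᵐᵒᵖ) ⧸ A) =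
        ((1 : G × Hᵐᵒᵖ) : (G × Hᵐᵒᵖ) ⧸ A) ↔ (g, op h⁻¹) ∈ A := by
      rw [eq_comm, QuotientGroup.eq]
      simp
    refine h1.trans ?_
    constructor
    · intro h2
      exact ⟨_, h2, by simp [ψ]⟩
    · rintro ⟨⟨a, b⟩, hab, h2⟩
      obtain ⟨rfl, rfl⟩ := Prod.ext_iff.1 h2
      simpa [ψ] using hab

theorem nonempty_atQuotient_equiv_of_comp_ne_zero (hpR : IsUnit (p : R)) (hG : IsPGroup p G)
    (hH : IsPGroup p H) {a : RB R G H}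
    (h : RB.comp (RB.comp (idemPhiOne R G) a) (idemPhiOne R H) ≠ 0) :
    Nonempty (AtQuotient G ≃* AtQuotient H) := by
  have hGu := hG.isUnit_card hpR
  have hHu := hH.isUnit_card hpR
  have key : ∀ L : Subgroup (G × H), RB.comp (RB.comp (idemPhiOne R G)
      (RBurnside.mk R (Biset.coset L))) (idemPhiOne R H) ≠ 0 →
      Nonempty (AtQuotient G ≃* AtQuotient H) := by
    intro L hL
    have h1 := idemPhiOne_comp_coset_ne_zero (L := L) hGu hHu (fun h0 => hL (by
      rw [h0, map_zero, LinearMap.zero_apply]))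
    have h2 := coset_comp_idemPhiOne_ne_zero (L := L) hHu hGu (fun h0 => hL (by
      rw [RB.comp_assoc, h0, map_zero]))
    obtain ⟨m, hm⟩ := IsPGroup.iff_card.1 hG
    obtain ⟨n, hn⟩ := IsPGroup.iff_card.1 hH
    have hLp : IsPGroup p L := IsPGroup.to_subgroup (IsPGroup.of_card (n := m + n) (by
      rw [Nat.card_prod, hm, hn, pow_add])) L
    have hf1 : Function.Surjective ((MonoidHom.fst G H).comp L.subtype) := by
      intro g
      obtain ⟨k, hk⟩ := h1.1 g
      exact ⟨⟨(g, k), hk⟩, rfl⟩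
    have hf2 : Function.Surjective ((MonoidHom.snd G H).comp L.subtype) := by
      intro g
      obtain ⟨k, hk⟩ := h2.1 g
      exact ⟨⟨(k, g), hk⟩, rfl⟩
    -- An element `(1, y)` of `Φ(L)` has `y ∈ Φ(H)`, because the projection to `H` is onto; then `y
    -- = 1` by the condition coming from `φ_1^H`.
    obtain ⟨e1⟩ := nonempty_atQuotient_equiv hLp hf1 (by
      rw [Subgroup.eq_bot_iff_forall]
      rintro ⟨⟨x, y⟩, hxy⟩ ⟨hx1, hx2⟩
      change x = 1 at hx1
      subst hx1
      have h3 : y ∈ frattini H := frattini_le_comap_frattini_of_surjective hf2 hx2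
      have h4 := h2.2 y h3 hxy
      subst h4
      rfl)
    obtain ⟨e2⟩ := nonempty_atQuotient_equiv hLp hf2 (by
      rw [Subgroup.eq_bot_iff_forall]
      rintro ⟨⟨x, y⟩, hxy⟩ ⟨hx1, hx2⟩
      change y = 1 at hx1
      subst hx1
      have h3 : x ∈ frattini G := frattini_le_comap_frattini_of_surjective hf1 hx2
      have h4 := h1.2 x h3 hxy
      subst h4
      rfl)
    exact ⟨e1.symm.trans e2⟩
  by_contra hne
  refine h ?_
  -- Since `|G × H|` is invertible, every biset is a combination of transitive ones by
  -- `card_smul_mk`, and these are covered by `key`.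
  have h0 : (RB.comp.flip (idemPhiOne R H) ∘ₗ RB.comp (idemPhiOne R G) :
      RB R G H →ₗ[R] RB R G H) = 0 := by
    refine RBurnside.hom_ext fun U => ?_
    refine ((isUnit_card_biset hGu hHu).smul_left_cancel).1 ?_
    rw [LinearMap.zero_apply, smul_zero, ← map_smul, RBurnside.card_smul_mk,
      LinearMap.map_finsum_of_finite]
    refine finsum_eq_zero_of_forall_eq_zero fun x => ?_
    obtain ⟨L, hL⟩ := exists_iso_biset_coset (MulAction.stabilizer (G × Hᵐᵒᵖ) x)
    rw [RBurnside.wt, map_smul, RBurnside.mk_eq hL, LinearMap.comp_apply, LinearMap.flip_apply]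
    by_contra h1
    exact hne (key L fun h2 => h1 (by rw [h2, smul_zero]))
  exact LinearMap.congr_fun h0 a

theorem GroupSection.isPGroup_quot (hG : IsPGroup p G) (s : GroupSection G) :
    IsPGroup p s.quot := (hG.to_subgroup s.T).to_quotient _

/-- The product `u v a u' v'` contains the middle factor `v a u' = φ (Defres a Indinf) φ`, to which
the preceding theorem applies. -/
theorem nonempty_atQuotient_equiv_of_epsilon (hpR : IsUnit (p : R)) (hG : IsPGroup p G)
    (hH : IsPGroup p H) {s : GroupSection G} {t : GroupSection H} {a : RB R G H}
    (h : RB.comp (RB.comp (s.epsilon R) a) (t.epsilon R) ≠ 0) :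
    Nonempty (AtQuotient s.quot ≃* AtQuotient t.quot) := by
  refine nonempty_atQuotient_equiv_of_comp_ne_zero hpR (s.isPGroup_quot hG) (t.isPGroup_quot hH)
    (a := RB.comp (RBurnside.mk R s.defres) (RB.comp a (RBurnside.mk R t.indinf)))
    fun h0 => h ?_
  have h1 : RB.comp (s.v R) (RB.comp a (t.u R)) = 0 := by
    unfold GroupSection.u GroupSection.v
    rw [← h0]
    simp only [RB.comp_assoc]
  have h2 : RB.comp (RB.comp (RB.comp (s.u R) (s.v R)) a) (RB.comp (t.u R) (t.v R)) =
      RB.comp (s.u R) (RB.comp (RB.comp (s.v R) (RB.comp a (t.u R))) (t.v R)) := by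
    simp only [RB.comp_assoc]
  unfold GroupSection.epsilon
  simp only [map_smul, LinearMap.smul_apply, h2, h1, map_zero, LinearMap.zero_apply, smul_zero]

end Vanishing

/-! ### Counting points with a given stabilizer, and `ε_{T,S} ≠ 0`. -/

section Counting

variable {Γ : Type u} [Group Γ] (R : Type v) [CommRing R]

/-- The number of points of a `Γ`-set with stabilizer `D`, on isomorphism classes. -/
def countClass (D : Subgroup Γ) : FinGSet.Class Γ →+ R where
  toFun := Quotient.lift (fun X : FinGSet Γ =>
    (Nat.card {x : X // MulAction.stabilizer Γ x = D} : R)) (by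
      rintro X Y ⟨e, he⟩
      refine congrArg Nat.cast (Nat.card_congr (e.subtypeEquiv fun x => ?_))
      have : MulAction.stabilizer Γ (e x) = MulAction.stabilizer Γ x := by
        ext g
        rw [MulAction.mem_stabilizer_iff, MulAction.mem_stabilizer_iff, ← he,
          e.injective.eq_iff]
      rw [this])
  map_zero' := by
    change (Nat.card {x : FinGSet.empty Γ // MulAction.stabilizer Γ x = D} : R) = 0
    have : IsEmpty {x : FinGSet.empty Γ // MulAction.stabilizer Γ x = D} :=
      ⟨fun x => PEmpty.elim x.1⟩
    rw [Nat.card_of_isEmpty, Nat.cast_zero]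
  map_add' := by
    rintro ⟨X⟩ ⟨Y⟩
    change (Nat.card {x : X.sum Y // MulAction.stabilizer Γ x = D} : R) =
      (Nat.card {x : X // MulAction.stabilizer Γ x = D} : R) +
      (Nat.card {x : Y // MulAction.stabilizer Γ x = D} : R)
    rw [← Nat.cast_add, ← Nat.card_sum]
    refine congrArg Nat.cast (Nat.card_congr ((Equiv.subtypeSum (α := X) (β := Y)
      (p := fun x => MulAction.stabilizer Γ (show X.sum Y from x) = D)).trans
      (Equiv.sumCongr (Equiv.subtypeEquivRight fun x => ?_)
        (Equiv.subtypeEquivRight fun x => ?_))))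
    · have : MulAction.stabilizer Γ (FinGSet.inl X Y x) = MulAction.stabilizer Γ x := by
        ext g
        exact FinGSet.inl_inj
      exact iff_of_eq (congrArg (· = D) this)
    · have : MulAction.stabilizer Γ (FinGSet.inr X Y x) = MulAction.stabilizer Γ x := by
        ext g
        exact FinGSet.inr_inj
      exact iff_of_eq (congrArg (· = D) this)

/-- The linear form on `R B(Γ)` counting the points with stabilizer `D`. -/
def countPoints (D : Subgroup Γ) : RBurnside R Γ →ₗ[R] R :=
  LinearMap.liftBaseChange R
    (Algebra.GrothendieckAddGroup.lift (countClass R D)).toIntLinearMap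

theorem countPoints_mk (D : Subgroup Γ) (X : FinGSet Γ) : countPoints R D (RBurnside.mk R X) =
    (Nat.card {x : X // MulAction.stabilizer Γ x = D} : R) := by
  unfold countPoints RBurnside.mk
  rw [LinearMap.liftBaseChange_tmul, AddMonoidHom.coe_toIntLinearMap, grothLift_of, one_smul]
  rfl

/-- The coset `gD` has stabilizer `gDg⁻¹`, so the count is `|N_Γ(D) : D|`, a divisor of `|Γ|`. -/
theorem isUnit_countPoints_coset [Finite Γ] (hΓ : IsUnit (Nat.card Γ : R)) (D : Subgroup Γ) :
    IsUnit (countPoints R D (RBurnside.mk R (FinGSet.coset D))) := by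
  classical
  have := Fintype.ofFinite Γ
  have := Fintype.ofFinite (Γ ⧸ D)
  rw [countPoints_mk]
  have h1 := FinGSet.sum_mk_coset D
    (fun x : Γ ⧸ D => if MulAction.stabilizer Γ x = D then 1 else 0)
  have h2 : ∑ g : Γ, (if MulAction.stabilizer Γ (g : Γ ⧸ D) = D then 1 else 0) =
      Nat.card (Subgroup.normalizer (D : Set Γ)) := by
    rw [← Finset.card_filter]
    refine (Nat.subtype_card _ fun g => ?_).symm
    simp only [Finset.mem_filter, Finset.mem_univ, true_and]
    rw [← GroupSection.map_conj_eq_iff]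
    have h3 := MulAction.stabilizer_smul_eq_stabilizer_map_conj g ((1 : Γ) : Γ ⧸ D)
    rw [MulAction.stabilizer_quotient] at h3
    have h4 : g • ((1 : Γ) : Γ ⧸ D) = (g : Γ ⧸ D) := by
      change ((g * 1 : Γ) : Γ ⧸ D) = _
      rw [mul_one]
    rw [h4] at h3
    rw [h3]
  have h5 : Nat.card {x : FinGSet.coset D // MulAction.stabilizer Γ x = D} =
      ∑ x : Γ ⧸ D, (if MulAction.stabilizer Γ x = D then 1 else 0) := by
    rw [← Finset.card_filter]
    exact Nat.subtype_card (p := fun x : Γ ⧸ D => MulAction.stabilizer Γ x = D) _ (by simp)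
  rw [h2, ← h5, smul_eq_mul] at h1
  obtain ⟨k, hk⟩ := Subgroup.card_subgroup_dvd_card (Subgroup.normalizer (D : Set Γ))
  rw [hk, h1, Nat.cast_mul, Nat.cast_mul] at hΓ
  exact isUnit_of_mul_isUnit_right (isUnit_of_mul_isUnit_left hΓ)

end Counting

namespace GroupSection

variable {R : Type v} [CommRing R] {G : Type u} [Group G] [Finite G]

/-- Points are counted whose stabilizer is the one attached to the term `M = S`, `K = T`. No other
term with `M ≥ S` has such points, and this term has coefficient `|T|`, so the count on `|T| u v` is
a unit, hence nonzero. -/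
theorem epsilon_ne_zero [Nontrivial R] (hG : IsUnit (Nat.card G : R)) {s : GroupSection G}
    (hs : s.IsMinimal) : s.epsilon R ≠ 0 := by
  classical
  let L0 : Subgroup (G × G) := push (deltaSubgroup s.bot.1 ⊓ (⊤ : Subgroup s.T).prod ⊤)
  let D := MulAction.stabilizer (G × Gᵐᵒᵖ) (Biset.cosetMk L0 1)
  have hD : ∀ g h, (g, op h⁻¹) ∈ D ↔ (g, h) ∈ L0 := by
    intro g h
    rw [MulAction.mem_stabilizer_iff, Biset.smul_cosetMk, eq_comm, Biset.cosetMk_eq]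
    simp
  have hu : IsUnit (countPoints R D (zElem R s.T s.bot ⊤)) := by
    have h1 : (Biset.coset L0).Iso (FinGSet.coset D) := FinGSet.iso_coset _ (by
      intro y
      obtain ⟨x, rfl⟩ := Biset.cosetMk_surjective _ y
      refine ⟨(x.1, op x.2⁻¹), ?_⟩
      rw [Biset.smul_cosetMk]
      simp)
    unfold zElem
    rw [RBurnside.mk_eq h1]
    exact isUnit_countPoints_coset R (isUnit_card_biset hG hG) D
  -- Such a point makes the two subgroups of `G × G` conjugate. First projections then embed `T` in
  -- `K`, and elements `(m, 1)` embed `M` in `S`; comparing orders gives `K = T` and `M = S`.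
  have h0 : ∀ (M : NormalSubgroup s.T) (K : Subgroup s.T), s.bot ≤ M →
      countPoints R D (zElem R s.T M K) ≠ 0 → K = ⊤ ∧ M = s.bot := by
    intro M K hM hne
    unfold zElem at hne
    rw [countPoints_mk] at hne
    have hne' : Nat.card {x : Biset.coset (push (deltaSubgroup M.1 ⊓ K.prod ⊤)) //
        MulAction.stabilizer (G × Gᵐᵒᵖ) x = D} ≠ 0 := fun h => hne (by rw [h, Nat.cast_zero])
    obtain ⟨⟨⟨x, hx⟩⟩, -⟩ := Nat.card_ne_zero.1 hne'
    obtain ⟨⟨a, b⟩, rfl⟩ := Biset.cosetMk_surjective _ x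
    have h1 : ∀ g h, (a⁻¹ * g * a, b⁻¹ * h * b) ∈ push (deltaSubgroup M.1 ⊓ K.prod ⊤) ↔
        (g, h) ∈ L0 := by
      intro g h
      rw [← hD, ← hx, MulAction.mem_stabilizer_iff, Biset.smul_cosetMk, eq_comm,
        Biset.cosetMk_eq]
      simp [mul_assoc]
    have h2 : ∀ t : s.T, ∃ k ∈ K, a⁻¹ * t * a = (k : G) := by
      intro t
      have h3 : ((t : G), (t : G)) ∈ L0 := mem_push.2 ⟨t, t, by
        simp [Biset.mem_deltaSubgroup], rfl⟩
      obtain ⟨k, k', hk, hk'⟩ := mem_push.1 ((h1 _ _).2 h3)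
      exact ⟨k, hk.2.1, congrArg Prod.fst hk'⟩
    have hK : K = ⊤ := by
      choose f hf1 hf2 using h2
      refine Subgroup.eq_top_of_le_card K ?_
      refine Nat.card_le_card_of_injective (fun t => (⟨f t, hf1 t⟩ : K)) fun t t' htt => ?_
      have h4 : f t = f t' := congrArg Subtype.val htt
      have h5 := hf2 t
      rw [h4, ← hf2 t'] at h5
      exact Subtype.ext (by simpa using h5)
    refine ⟨hK, le_antisymm ?_ hM⟩
    have h6 : ∀ m : M.1, ∃ z ∈ s.bot.1, a * (m : s.T) * a⁻¹ = (z : G) := by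
      intro m
      have h7 : (((m : s.T) : G), (1 : G)) ∈ push (deltaSubgroup M.1 ⊓ K.prod ⊤) :=
        mem_push.2 ⟨m, 1, by
          rw [hK]
          simp [Biset.mem_deltaSubgroup], rfl⟩
      have h8 := (h1 (a * (m : s.T) * a⁻¹) 1).1 (by simpa [mul_assoc] using h7)
      obtain ⟨k, k', hk, hk'⟩ := mem_push.1 h8
      have h9 : k' = 1 := Subtype.ext (congrArg Prod.snd hk').symm
      refine ⟨k, ?_, congrArg Prod.fst hk'⟩
      have : (k, k') ∈ deltaSubgroup s.bot.1 := hk.1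
      rw [Biset.mem_deltaSubgroup, h9] at this
      simpa using this
    choose f hf1 hf2 using h6
    have hle : Nat.card M.1 ≤ Nat.card s.bot.1 := by
      refine Nat.card_le_card_of_injective (fun t => (⟨f t, hf1 t⟩ : s.bot.1)) fun t t' htt => ?_
      have h4 : f t = f t' := congrArg Subtype.val htt
      have h5 := hf2 t
      rw [h4, ← hf2 t'] at h5
      exact Subtype.ext (Subtype.ext (by simpa using h5))
    have := Subgroup.eq_of_le_of_card_ge (show s.bot.1 ≤ M.1 from hM) hle
    exact this.ge
  have hT := isUnit_card_subgroup s.T hG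
  have hcount : IsUnit (countPoints R D ((Nat.card s.T : R) • RB.comp (s.u R) (s.v R))) := by
    rw [card_smul_u_comp_v hG s hs, LinearMap.map_finsum_of_finite, finsum_eq_single _ s.bot,
      LinearMap.map_finsum_of_finite, finsum_eq_single _ (⊤ : Subgroup s.T), map_smul, phiCoeff,
      if_pos ⟨le_rfl, hs⟩, moebius_self, moebius_self, Int.cast_one, one_mul, mul_one,
      Subgroup.card_top]
    · exact hT.mul hu
    · intro K hK
      rw [map_smul]
      by_contra h
      exact hK (h0 s.bot K le_rfl fun h' => h (by rw [h', smul_zero])).1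
    · intro M hM
      rw [LinearMap.map_finsum_of_finite]
      refine finsum_eq_zero_of_forall_eq_zero fun K => ?_
      rw [map_smul]
      by_contra h
      by_cases hsM : s.bot ≤ M
      · exact hM (h0 M K hsM fun h' => h (by rw [h', smul_zero])).2
      · exact h (by rw [phiCoeff, if_neg (fun h' => hsM h'.1), zero_smul])
  intro hε
  have h1 := card_smul_epsilon hG hs
  rw [hε, smul_zero] at h1
  have h2 : expansion R s.T s.bot = (Nat.card s.T : R) • RB.comp (s.u R) (s.v R) :=
    (card_smul_u_comp_v hG s hs).symm
  obtain ⟨k, hk⟩ : Nat.card (MulAction.orbit G s) ∣ Nat.card G := by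
    have := Fintype.ofFinite G
    have := Fintype.ofFinite (MulAction.orbit G s)
    rw [Nat.card_eq_fintype_card, Nat.card_eq_fintype_card]
    exact Dvd.intro _ (MulAction.card_orbit_mul_card_stabilizer_eq_card_group G s)
  rw [hk, Nat.cast_mul] at hG
  have h3 := ((isUnit_of_mul_isUnit_left hG).smul_left_cancel (y := (0 : RB R G G))).1
    (h1.trans (smul_zero _).symm)
  rw [← h2, h3, map_zero] at hcount
  exact not_isUnit_zero hcount

theorem nonempty_quot_equiv_smul (s : GroupSection G) (g : G) :
    Nonempty (s.quot ≃* (g • s).quot) := by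
  refine ⟨QuotientGroup.congr _ _ (s.conjEquiv g) ?_⟩
  exact (congrArg Subtype.val (bot_smul s g)).symm

end GroupSection

/-! ### The elements `b_L^P`. -/

section CentralIdempotents

variable {R : Type v} [CommRing R] {p : ℕ} [hp : Fact p.Prime]
variable {P Q : Type u} [Group P] [Finite P] [Group Q] [Finite Q]
variable {L M : Type u} [Group L] [Group M]

theorem idemB_congr (e : L ≃* M) (X : Set (GroupSection P)) : idemB R L X = idemB R M X := by
  have h : ∀ s : GroupSection P, (s ∈ X ∧ Nonempty (AtQuotient s.quot ≃* L)) ↔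
      (s ∈ X ∧ Nonempty (AtQuotient s.quot ≃* M)) := fun s =>
    and_congr_right fun _ => ⟨fun ⟨f⟩ => ⟨f.trans e⟩, fun ⟨f⟩ => ⟨f.trans e.symm⟩⟩
  exact finsum_comp_equiv (Equiv.subtypeEquivRight h)
    (f := fun s : {s : GroupSection P // s ∈ X ∧ Nonempty (AtQuotient s.quot ≃* M)} =>
      s.1.epsilon R)

theorem exists_mem_of_idemB_ne_zero {X : Set (GroupSection P)} (h : idemB R L X ≠ 0) :
    ∃ s ∈ X, Nonempty (AtQuotient s.quot ≃* L) := by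
  by_contra hne
  refine h (finsum_eq_zero_of_forall_eq_zero fun s => ?_)
  exact (hne ⟨s.1, s.2.1, s.2.2⟩).elim

theorem nonempty_equiv_of_epsilon_comp_idemB (hpR : IsUnit (p : R)) (hP : IsPGroup p P)
    (hQ : IsPGroup p Q) {X : Set (GroupSection P)} {s : GroupSection Q} {a : RB R Q P}
    (h : RB.comp (RB.comp (s.epsilon R) a) (idemB R L X) ≠ 0) :
    Nonempty (AtQuotient s.quot ≃* L) := by
  by_contra hne
  refine h ?_
  rw [idemB, RB.comp_finsum]
  refine finsum_eq_zero_of_forall_eq_zero fun t => ?_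
  by_contra h1
  obtain ⟨e⟩ := nonempty_atQuotient_equiv_of_epsilon hpR hQ hP h1
  obtain ⟨f⟩ := t.2.2
  exact hne ⟨e.trans f⟩

theorem nonempty_equiv_of_idemB_comp_idemB (hpR : IsUnit (p : R)) (hP : IsPGroup p P)
    (hQ : IsPGroup p Q) {X : Set (GroupSection P)} {Y : Set (GroupSection Q)} {a : RB R Q P}
    (h : RB.comp (RB.comp (idemB R M Y) a) (idemB R L X) ≠ 0) : Nonempty (M ≃* L) := by
  by_contra hne
  refine h ?_
  rw [idemB, RB.finsum_comp, RB.finsum_comp]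
  refine finsum_eq_zero_of_forall_eq_zero fun t => ?_
  by_contra h1
  obtain ⟨e⟩ := nonempty_equiv_of_epsilon_comp_idemB hpR hP hQ h1
  obtain ⟨f⟩ := t.2.2
  exact hne ⟨f.symm.trans e⟩

variable {ι : Type*} {A : ι → Type u} [∀ i, Group (A i)]

/-- Each section determines a unique index through `(T/S)^@`, and there are finitely many sections.
-/
theorem finite_idemB_ne_zero (hA : ∀ (L : Type u) [Group L], IsAtoric p L →
    ∃! i, Nonempty (A i ≃* L)) (hP : IsPGroup p P) (X : Set (GroupSection P)) :
    {i | idemB R (A i) X ≠ 0}.Finite := by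
  have hκ : ∀ s : GroupSection P, ∃! i, Nonempty (A i ≃* AtQuotient s.quot) := fun s =>
    hA _ (isAtoric_atQuotient (s.isPGroup_quot hP))
  choose κ hκ1 hκ2 using hκ
  refine (Set.finite_range κ).subset fun i hi => ?_
  obtain ⟨s, -, ⟨e⟩⟩ := exists_mem_of_idemB_ne_zero hi
  exact ⟨s, (hκ2 s i ⟨e.symm⟩).symm⟩

theorem finsum_idemB (hpR : IsUnit (p : R)) (hA : ∀ (L : Type u) [Group L], IsAtoric p L →
    ∃! i, Nonempty (A i ≃* L)) (hP : IsPGroup p P) {X : Set (GroupSection P)}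
    (hX : GroupSection.IsRepresentatives X) : ∑ᶠ i, idemB R (A i) X = RB.id R P := by
  classical
  have hκ : ∀ s : GroupSection P, ∃! i, Nonempty (A i ≃* AtQuotient s.quot) := fun s =>
    hA _ (isAtoric_atQuotient (s.isPGroup_quot hP))
  choose κ hκ1 hκ2 using hκ
  -- All the sums are rewritten over the same set `X`, so that exchanging the order leaves each `ε`
  -- exactly once, at `i = κ s`.
  have hb : ∀ i, idemB R (A i) X = ∑ᶠ s : X, if i = κ s then s.1.epsilon R else 0 := by
    intro i
    have h1 : ∀ s : GroupSection P, Nonempty (AtQuotient s.quot ≃* A i) ↔ i = κ s :=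
      fun s => ⟨fun ⟨e⟩ => hκ2 s i ⟨e.symm⟩, by
        rintro rfl
        exact ⟨(hκ1 s).some.symm⟩⟩
    refine finsum_of_injective
      (fun s : {s : GroupSection P // s ∈ X ∧ Nonempty (AtQuotient s.quot ≃* A i)} =>
        (⟨s.1, s.2.1⟩ : X)) (fun s t h => Subtype.ext (congrArg (fun x : X => x.1) h)) _ _ ?_ ?_
    · intro s hs
      refine if_neg fun h => hs ⟨⟨s.1, s.2, (h1 s.1).2 h⟩, rfl⟩
    · intro s
      exact (if_pos ((h1 s.1).1 s.2.2)).symm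
  have := Fintype.ofFinite X
  simp only [hb, finsum_eq_sum_of_fintype]
  rw [finsum_sum_comm, ← GroupSection.finsum_epsilon (hP.isUnit_card hpR) hX,
    finsum_eq_sum_of_fintype]
  · refine Finset.sum_congr rfl fun s _ => ?_
    rw [finsum_eq_single _ (κ s) fun i hi => if_neg hi, if_pos rfl]
  · intro s _
    refine (Set.finite_singleton (κ s)).subset fun i hi => ?_
    by_contra h
    exact hi (if_neg h)

variable (hpR : IsUnit (p : R)) (hA : ∀ (L : Type u) [Group L], IsAtoric p L →
  ∃! i, Nonempty (A i ≃* L))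
include hpR hA

/-- Expand `a = a · 1` with `1 = ∑ b_{A i}`: by hypothesis only the index of the isomorphism class
of `L` survives. -/
theorem comp_idemB_eq_self (hP : IsPGroup p P) {X : Set (GroupSection P)}
    (hX : GroupSection.IsRepresentatives X) (hL : IsAtoric p L) {a : RB R Q P}
    (h : ∀ i, RB.comp a (idemB R (A i) X) ≠ 0 → Nonempty (L ≃* A i)) :
    RB.comp a (idemB R L X) = a := by
  obtain ⟨i, ⟨e⟩, hi⟩ := hA L hL
  have h1 : RB.comp a (∑ᶠ j, idemB R (A j) X) = ∑ᶠ j, RB.comp a (idemB R (A j) X) :=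
    map_finsum (RB.comp a) (finite_idemB_ne_zero hA hP X)
  rw [finsum_idemB hpR hA hP hX, RB.comp_id, finsum_eq_single _ i] at h1
  · rw [idemB_congr e.symm, ← h1]
  · intro j hj
    by_contra h2
    exact hj (hi j ⟨(h j h2).some.symm⟩)

theorem idemB_comp_eq_self (hP : IsPGroup p P) {X : Set (GroupSection P)}
    (hX : GroupSection.IsRepresentatives X) (hL : IsAtoric p L) {a : RB R P Q}
    (h : ∀ i, RB.comp (idemB R (A i) X) a ≠ 0 → Nonempty (L ≃* A i)) :
    RB.comp (idemB R L X) a = a := by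
  obtain ⟨i, ⟨e⟩, hi⟩ := hA L hL
  have h1 : RB.comp.flip a (∑ᶠ j, idemB R (A j) X) = ∑ᶠ j, RB.comp.flip a (idemB R (A j) X) :=
    map_finsum (RB.comp.flip a) (finite_idemB_ne_zero hA hP X)
  rw [finsum_idemB hpR hA hP hX, LinearMap.flip_apply, RB.id_comp, finsum_eq_single _ i] at h1
  · rw [idemB_congr e.symm]
    exact h1.symm
  · intro j hj
    by_contra h2
    exact hj (hi j ⟨(h j h2).some.symm⟩)

/-- Both sides equal `b_L^Q a b_L^P`. -/
theorem idemB_comp_comm (hP : IsPGroup p P) (hQ : IsPGroup p Q) {X : Set (GroupSection P)}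
    (hX : GroupSection.IsRepresentatives X) {Y : Set (GroupSection Q)}
    (hY : GroupSection.IsRepresentatives Y) (hL : IsAtoric p L) (a : RB R Q P) :
    RB.comp (idemB R L Y) a = RB.comp a (idemB R L X) := by
  have h1 : RB.comp (RB.comp (idemB R L Y) a) (idemB R L X) = RB.comp (idemB R L Y) a :=
    comp_idemB_eq_self hpR hA hP hX hL fun _ h =>
      nonempty_equiv_of_idemB_comp_idemB hpR hP hQ h
  have h2 : RB.comp (idemB R L Y) (RB.comp a (idemB R L X)) = RB.comp a (idemB R L X) :=
    idemB_comp_eq_self hpR hA hQ hY hL fun _ h =>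
      ⟨(nonempty_equiv_of_idemB_comp_idemB hpR hP hQ (by rwa [RB.comp_assoc])).some.symm⟩
  rw [← h1, RB.comp_assoc, h2]

theorem idemB_comp_self (hP : IsPGroup p P) {X : Set (GroupSection P)}
    (hX : GroupSection.IsRepresentatives X) (hL : IsAtoric p L) :
    RB.comp (idemB R L X) (idemB R L X) = idemB R L X :=
  comp_idemB_eq_self hpR hA hP hX hL fun i h =>
    nonempty_equiv_of_idemB_comp_idemB hpR hP hP (a := RB.id R P) (X := X) (Y := X)
      (by rwa [RB.comp_id])

/-- A nonzero term exhibits `L` as a quotient of some `T/S`. Conversely, a minimal section with `T/S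
≅ L` has `(T/S)^@ ≅ L`, and its nonzero `ε` is fixed by `b_L^P`. -/
theorem idemB_ne_zero_iff [Nontrivial R] (hP : IsPGroup p P) {X : Set (GroupSection P)}
    (hX : GroupSection.IsRepresentatives X) (hL : IsAtoric p L) :
    idemB R L X ≠ 0 ↔ IsSubquotient L (AtQuotient P) := by
  constructor
  · intro h
    obtain ⟨s, -, ⟨e⟩⟩ := exists_mem_of_idemB_ne_zero h
    have h1 : IsSubquotient L P := isSubquotient_of_hom s.T.subtype_injective
      (f := e.toMonoidHom.comp ((QuotientGroup.mk' (atKernel s.quot)).comp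
        (QuotientGroup.mk' (s.S.subgroupOf s.T))))
      (e.surjective.comp ((QuotientGroup.mk'_surjective _).comp
        (QuotientGroup.mk'_surjective _)))
    refine h1.of_ker_inf_frattini hP hL (QuotientGroup.mk' (atKernel P)) ?_
    rw [QuotientGroup.ker_mk']
    exact (atKernel_spec P).prop.2
  · intro h
    have hLfin := hL.finite
    obtain ⟨s, hs, ⟨e⟩⟩ := (h.of_surjective (QuotientGroup.mk' (atKernel P))
      (QuotientGroup.mk'_surjective _)).exists_isMinimal
    obtain ⟨t, ⟨htX, ht⟩, -⟩ := hX.2 s hs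
    obtain ⟨g, rfl⟩ := GroupSection.isConj_iff_mem_orbit.1 ht
    obtain ⟨f⟩ := s.nonempty_quot_equiv_smul g
    obtain ⟨e1⟩ := nonempty_atQuotient_congr ((g • s).isPGroup_quot hP) (f.symm.trans e)
    obtain ⟨e2⟩ := hL.nonempty_equiv_atQuotient
    have h1 : RB.comp ((g • s).epsilon R) (idemB R L X) = (g • s).epsilon R := by
      refine comp_idemB_eq_self hpR hA hP hX hL fun i h => ?_
      obtain ⟨e3⟩ := nonempty_equiv_of_epsilon_comp_idemB hpR hP hP (s := g • s)
        (a := RB.id R P) (by rwa [RB.comp_id])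
      exact ⟨(e1.trans e2).symm.trans e3⟩
    intro h0
    rw [h0, map_zero] at h1
    exact GroupSection.epsilon_ne_zero (hP.isUnit_card hpR)
      ((GroupSection.isMinimal_smul s g).2 hs) h1.symm

end CentralIdempotents

/-! ### Passage to the center of `R C_p`. -/

/-- The additive map sending a morphism `P ⟶ Q` of `R C_p` to the element of `R B(Q, P)`. -/
def PBisetCat.toRBHom {R : Type v} [CommRing R] {p : ℕ} (P Q : PBisetCat.{u, v} R p) :
    (P ⟶ Q) →+ RB R Q.obj P.obj where
  toFun := PBisetCat.toRB
  map_zero' := rfl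
  map_add' _ _ := rfl

theorem PBisetCat.toRB_injective {R : Type v} [CommRing R] {p : ℕ} {P Q : PBisetCat.{u, v} R p} :
    Function.Injective (PBisetCat.toRB : (P ⟶ Q) → RB R Q.obj P.obj) :=
  fun _ _ h => ObjectProperty.hom_ext _ h

end

theorem mainTheorem3 {R : Type v} [CommRing R] [Nontrivial R] {p : ℕ} [Fact p.Prime]
    (hp : IsUnit (p : R))
    -- `X P` is a set of representatives of the conjugacy classes of minimal sections of `P`
    (X : ∀ (P : Type u) [Group P] [Finite P], Set (GroupSection P))
    (hX : ∀ (P : Type u) [Group P] [Finite P], IsPGroup p P →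
      GroupSection.IsRepresentatives (X P))
    -- `A i`, for `i` in `ι`, are representatives of the isomorphism classes of atoric `p`-groups
    {ι : Type*} (A : ι → Type u) [∀ i, Group (A i)] (hA : ∀ i, IsAtoric p (A i))
    (hA' : ∀ (L : Type u) [Group L], IsAtoric p L → ∃! i, Nonempty (A i ≃* L)) :
    -- `b_L^P` is nonzero if and only if `L ⊑ P^@`
    (∀ (L : Type u) [Group L], IsAtoric p L →
      ∀ (P : Type u) [Group P] [Finite P], IsPGroup p P →
        (idemB R L (X P) ≠ 0 ↔ IsSubquotient L (AtQuotient P))) ∧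
    -- if `b_M^Q RB(Q,P) b_L^P ≠ 0`, then `M ≅ L`
    (∀ (L M : Type u) [Group L] [Group M], IsAtoric p L → IsAtoric p M →
      ∀ (P Q : Type u) [Group P] [Finite P] [Group Q] [Finite Q], IsPGroup p P → IsPGroup p Q →
        (∃ a : RB R Q P, RB.comp (RB.comp (idemB R M (X Q)) a) (idemB R L (X P)) ≠ 0) →
          Nonempty (M ≃* L)) ∧
    -- `b_L^Q a = a b_L^P`
    (∀ (L : Type u) [Group L], IsAtoric p L →
      ∀ (P Q : Type u) [Group P] [Finite P] [Group Q] [Finite Q], IsPGroup p P → IsPGroup p Q →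
        ∀ a : RB R Q P, RB.comp (idemB R L (X Q)) a = RB.comp a (idemB R L (X P))) ∧
    -- the `b_L` are orthogonal idempotents of the center of `R C_p`, with (locally finite) sum `1`
    (∃ b : ∀ (L : Type u) [Group L], IsAtoric p L → CatCenter (PBisetCat.{u, v} R p),
      (∀ (L : Type u) [Group L] (hL : IsAtoric p L),
        (∀ P : PBisetCat.{u, v} R p,
          PBisetCat.toRB ((b L hL).app P) = idemB R L (X P.obj)) ∧
        IsIdempotentElem (b L hL)) ∧
      (∀ i j, i ≠ j → b (A i) (hA i) * b (A j) (hA j) = 0) ∧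
      (∀ P : PBisetCat.{u, v} R p,
        {i | (b (A i) (hA i)).app P ≠ 0}.Finite ∧
        ∑ᶠ i, (b (A i) (hA i)).app P = (1 : CatCenter (PBisetCat.{u, v} R p)).app P)) ∧
    -- the nonzero `b_L^P` for a fixed `P`
    (∀ (P : Type u) [Group P] [Finite P], IsPGroup p P →
      {i | IsSubquotient (A i) (AtQuotient P)}.Finite ∧
      (∀ i, IsSubquotient (A i) (AtQuotient P) →
        idemB R (A i) (X P) ≠ 0 ∧
        RB.comp (idemB R (A i) (X P)) (idemB R (A i) (X P)) = idemB R (A i) (X P) ∧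
        ∀ a : RB R P P, RB.comp (idemB R (A i) (X P)) a = RB.comp a (idemB R (A i) (X P))) ∧
      (∀ i j, IsSubquotient (A i) (AtQuotient P) → IsSubquotient (A j) (AtQuotient P) → i ≠ j →
        RB.comp (idemB R (A i) (X P)) (idemB R (A j) (X P)) = 0) ∧
      ∑ᶠ i : {i // IsSubquotient (A i) (AtQuotient P)}, idemB R (A i.1) (X P) = RB.id R P) := by
  have h2 : ∀ (L M : Type u) [Group L] [Group M],
      ∀ (P Q : Type u) [Group P] [Finite P] [Group Q] [Finite Q], IsPGroup p P → IsPGroup p Q →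
        ∀ a : RB R Q P, RB.comp (RB.comp (idemB R M (X Q)) a) (idemB R L (X P)) ≠ 0 →
          Nonempty (M ≃* L) := fun _ _ _ _ _ _ _ _ _ _ hP hQ _ h =>
    nonempty_equiv_of_idemB_comp_idemB hp hP hQ h
  have horth : ∀ (P : Type u) [Group P] [Finite P], IsPGroup p P → ∀ i j, i ≠ j →
      RB.comp (idemB R (A i) (X P)) (idemB R (A j) (X P)) = 0 := by
    intro P _ _ hP i j hij
    by_contra h
    obtain ⟨e⟩ := h2 (A j) (A i) P P hP hP (RB.id R P) (by rwa [RB.comp_id])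
    exact hij ((hA' (A j) (hA j)).unique ⟨e⟩ ⟨MulEquiv.refl _⟩)
  refine ⟨fun L _ hL P _ _ hP => idemB_ne_zero_iff hp hA' hP (hX P hP) hL,
    fun L M _ _ _ _ P Q _ _ _ _ hP hQ ⟨a, ha⟩ => h2 L M P Q hP hQ a ha,
    fun L _ hL P Q _ _ _ _ hP hQ a => idemB_comp_comm hp hA' hP hQ (hX P hP) (hX Q hQ) hL a,
    ⟨fun L _ hL =>
      { app := fun P => ObjectProperty.homMk (idemB R L (X P.obj))
        naturality := fun P Q f => PBisetCat.toRB_injective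
          (idemB_comp_comm hp hA' P.property Q.property (hX _ P.property) (hX _ Q.property) hL
            (PBisetCat.toRB f)) }, fun L _ hL => ⟨fun _ => rfl, ?_⟩, ?_, fun P => ⟨?_, ?_⟩⟩,
    fun P _ _ hP => ⟨?_, ?_, ?_, ?_⟩⟩
  · refine CatCenter.ext _ _ fun P => PBisetCat.toRB_injective ?_
    exact idemB_comp_self hp hA' P.property (hX _ P.property) hL
  · intro i j hij
    refine CatCenter.ext _ _ fun P => PBisetCat.toRB_injective ?_
    exact horth P.obj P.property i j hij
  · refine (finite_idemB_ne_zero (R := R) hA' P.property (X P.obj)).subset fun i hi h => hi ?_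
    exact PBisetCat.toRB_injective h
  · refine PBisetCat.toRB_injective ?_
    refine (map_finsum (PBisetCat.toRBHom P P) ?_).trans ?_
    · refine (finite_idemB_ne_zero (R := R) hA' P.property (X P.obj)).subset fun i hi h => hi ?_
      exact PBisetCat.toRB_injective h
    · exact finsum_idemB hp hA' P.property (hX _ P.property)
  · simp only [← idemB_ne_zero_iff hp hA' hP (hX P hP) (hA _)]
    exact finite_idemB_ne_zero (R := R) hA' hP (X P)
  · intro i hi
    exact ⟨(idemB_ne_zero_iff hp hA' hP (hX P hP) (hA i)).2 hi,
      idemB_comp_self hp hA' hP (hX P hP) (hA i),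
      idemB_comp_comm hp hA' hP hP (hX P hP) (hX P hP) (hA i)⟩
  · exact fun i j _ _ hij => horth P hP i j hij
  · rw [← finsum_idemB hp hA' hP (hX P hP)]
    -- Indices outside the subtype have `b_L^P = 0` by the first assertion, so the restricted sum is
    -- the full one.
    refine (finsum_set_coe_eq_finsum_mem {i | IsSubquotient (A i) (AtQuotient P)}
      (f := fun i => idemB R (A i) (X P))).trans ?_
    classical
    refine finsum_congr fun i => ?_
    by_cases hi : IsSubquotient (A i) (AtQuotient P)
    · exact finsum_eq_if.trans (if_pos hi)
    · refine (finsum_eq_if.trans (if_neg hi)).trans ?_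
      rw [← idemB_ne_zero_iff hp hA' hP (hX P hP) (hA i), not_not] at hi
      exact hi.symm
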